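/- Let $F$ be a closed hyperbolic surface with locally isometric universal covering $\pi\colon\mathbb{H}^2\to F$, let $\mathcal S\subset F$ be a finite nonempty set, and put $\widetilde{\mathcal S}=\pi^{-1}(\mathcal S)$. For $x\in\widetilde{\mathcal S}$ let $V_x=\{p\in\mathbb{H}^2 : d(p,x)\le d(p,y)\ \text{for all } y\in\widetilde{\mathcal S}\}$. Let $\widetilde V^{(0)}$ be the set of points that lie in $V_x\cap V_y\cap V_z$ for some distinct $x,y,z\in\widetilde{\mathcal S}$, and let $V^{(0)}=\pi(\widetilde V^{(0)})$. For distinct $x,y\in\widetilde{\mathcal S}$, an intersection $e=V_x\cap V_y$ with more than one point is a Voronoi edge, whose geometric dual is the geodesic arc $\gamma_{xy}$ from $x$ to $y$; the edge $e$ is centered if $\gamma_{xy}$ meets the interior of $e$. Let $\widetilde P_c^{(1)}$ be the union of the geometric duals to the centered edges, and let $P_c^{(1)}=\pi(\widetilde P_c^{(1)})$. The 2-cells of the centered dual decomposition of $F$ are the closures of the connected components of $F-P_c^{(1)}$. For $v\in\widetilde V^{(0)}$ the Delaunay polygon $P_v$ is the convex hull of the set of all $x\in\widetilde{\mathcal S}$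 with $v\in V_x$; these points lie on a circle centered at $v$ and are the vertices of $P_v$. For a convex polygon $P$ with $n$ vertices and interior angles $\theta_1,\dots,\theta_n$, the radius-$R$ defect is $$D_R(P)=(n-2)\pi-\cosh R\,\sum_{i=1}^n\theta_i ,$$ i.e. the area of $P$ minus the total area of the radius-$R$ sectors with angles $\theta_1,\dots,\theta_n$. For $v\in V^{(0)}$ let $D_R(P_v)=D_R(P_{\tilde v})$ for any $\tilde v\in\pi^{-1}(v)$. The injectivity radius $i(\mathcal S)$ is the supremum of all $r\ge0$ such that $d(x,y)>2r$ for all distinct $x,y\in\widetilde{\mathcal S}$. Let $0\le R\le i(\mathcal S)$, and for $x\in\mathcal S$ let $U_x\subset F$ be the open hyperbolic disk of radius $R$ centered at $x$ (the image of the open disk of radius $R$ about any lift of $x$). Then for every 2-cell $Q$ of the centered dual decomposition, $Q\cap V^{(0)}$ is finite and $$\mathrm{area}\Big(Q-\bigcup_{x\in\mathcal S}(U_x\cap Q)\Big)=\sum_{v\in Q\cap V^{(0)}}D_R(P_v).$$ Moreover, the disks meet the cells in full sectors: if $\widetilde Q$ is the closure of a connected component of $\mathbb{H}^2-\widetilde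 P_c^{(1)}$ and $x\in\widetilde{\mathcal S}$, then the intersection of $\widetilde Q$ with the open disk of radius $R$ about $x$ is the union of the radius-$R$ sectors at $x$ determined by those polygons $P_v$, $v\in\widetilde Q\cap\widetilde V^{(0)}$, that have $x$ as a vertex. -/

import Mathlib

open scoped UpperHalfPlane

noncomputable section

namespace CenteredDual

/-! ### Hyperbolic plane geometry

The hyperbolic plane is the upper half-plane `ℍ` with the Poincaré distance (curvature `-1`) and the
area measure `volume = dx dy / y ^ 2`. -/

/-- The geodesic arc joining `x` to `y`. -/
def geodesicArc (x y : ℍ) : Set ℍ := {p | dist x p + dist p y = dist x y}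

/-- The interior of a geodesic arc `e` (possibly unbounded): the points of `e` lying strictly
between two other points of `e`. -/
def arcInterior (e : Set ℍ) : Set ℍ :=
  {p | p ∈ e ∧ ∃ a ∈ e, ∃ b ∈ e, a ≠ p ∧ b ≠ p ∧ p ∈ geodesicArc a b}

/-- Convexity in the hyperbolic plane. -/
def GeodesicallyConvex (K : Set ℍ) : Prop := ∀ p ∈ K, ∀ q ∈ K, geodesicArc p q ⊆ K

/-- The hyperbolic convex hull. -/
def geodesicHull (X : Set ℍ) : Set ℍ := ⋂₀ {K | GeodesicallyConvex K ∧ X ⊆ K}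

/-- The angle at `x` between the geodesic arcs from `x` to `y` and from `x` to `z`, by the
hyperbolic law of cosines (for `y ≠ x` and `z ≠ x`). -/
def hypAngle (x y z : ℍ) : ℝ :=
  Real.arccos ((Real.cosh (dist x y) * Real.cosh (dist x z) - Real.cosh (dist y z)) /
    (Real.sinh (dist x y) * Real.sinh (dist x z)))

/-- The interior angle at `x` of the convex polygon with vertex set `X`: the largest angle at `x`
subtended by two other vertices (which is attained at the two neighbours of `x`). -/
def interiorAngle (X : Set ℍ) (x : ℍ) : ℝ :=
  sSup {θ | ∃ y ∈ X, ∃ z ∈ X, y ≠ x ∧ z ≠ x ∧ θ = hypAngle x y z}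

/-- The radius-`R` defect `(n - 2) π - cosh R * (sum of the interior angles)` of the convex
`n`-gon with vertex set `X`. Since the polygon has area `(n - 2) π - ∑ angles` and a sector of
radius `R` and angle `θ` has area `(cosh R - 1) θ`, this is the area of the polygon minus the total
area of the radius-`R` sectors it determines at its vertices. -/
def radiusDefect (R : ℝ) (X : Set ℍ) : ℝ :=
  ((X.ncard : ℝ) - 2) * Real.pi - Real.cosh R * ∑ᶠ x ∈ X, interiorAngle X x

/-- The sector of the open disk of radius `R` about `x` determined by the convex set `P`: the
points of that disk that lie on a geodesic ray issuing from `x` through a point of `P` other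
than `x`. -/
def sector (R : ℝ) (x : ℍ) (P : Set ℍ) : Set ℍ :=
  {p | dist p x < R ∧ ∃ q ∈ P, q ≠ x ∧ (p ∈ geodesicArc x q ∨ q ∈ geodesicArc x p)}

/-! ### Voronoi and Delaunay tessellations of the hyperbolic plane -/

/-- The Voronoi cell `V_x`. -/
def voronoiCell (S : Set ℍ) (x : ℍ) : Set ℍ := {p | ∀ y ∈ S, dist p x ≤ dist p y}

/-- The vertex set `V⁽⁰⁾` of the Voronoi tessellation. -/
def voronoiVertices (S : Set ℍ) : Set ℍ :=
  {v | ∃ x ∈ S, ∃ y ∈ S, ∃ z ∈ S, x ≠ y ∧ x ≠ z ∧ y ≠ z ∧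
    v ∈ voronoiCell S x ∩ voronoiCell S y ∩ voronoiCell S z}

/-- `V_x ∩ V_y` is an edge of the Voronoi tessellation, i.e. it has more than one point. -/
def IsVoronoiEdge (S : Set ℍ) (x y : ℍ) : Prop :=
  x ∈ S ∧ y ∈ S ∧ x ≠ y ∧ (voronoiCell S x ∩ voronoiCell S y).Nontrivial

/-- `V_x ∩ V_y` is a centered edge: its interior meets its geometric dual, the geodesic arc
joining `x` to `y`. -/
def IsCenteredEdge (S : Set ℍ) (x y : ℍ) : Prop :=
  IsVoronoiEdge S x y ∧
    (arcInterior (voronoiCell S x ∩ voronoiCell S y) ∩ geodesicArc x y).Nonempty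

/-- The centered dual graph: the union of the geometric duals to the centered edges. -/
def centeredDualGraph (S : Set ℍ) : Set ℍ :=
  {p | ∃ x y, IsCenteredEdge S x y ∧ p ∈ geodesicArc x y}

/-- The vertices of the Delaunay polygon `P_v`: the points of `S` whose Voronoi cells contain `v`. -/
def delaunayVertices (S : Set ℍ) (v : ℍ) : Set ℍ := {x | x ∈ S ∧ v ∈ voronoiCell S x}

/-- The Delaunay polygon `P_v`. -/
def delaunayPolygon (S : Set ℍ) (v : ℍ) : Set ℍ := geodesicHull (delaunayVertices S v)

/-- The injectivity radius of a subset of the hyperbolic plane: the supremum of the `r ≥ 0` such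
that distinct points are at distance more than `2 r`. -/
def injRadius (S : Set ℍ) : ℝ :=
  sSup {r | 0 ≤ r ∧ ∀ x ∈ S, ∀ y ∈ S, x ≠ y → 2 * r < dist x y}

/-- The closed `2`-cells of the decomposition with one-skeleton `G`: the closures of the connected
components of the complement of `G`. -/
def twoCells {X : Type*} [TopologicalSpace X] (G : Set X) : Set (Set X) :=
  {Q | ∃ p ∈ Gᶜ, Q = closure (connectedComponentIn Gᶜ p)}

/-! ### Hyperbolic surfaces -/

/-- `π` is a locally isometric universal covering of `F` by the hyperbolic plane. -/
structure IsLocallyIsometricCovering {F : Type*} [MetricSpace F] (π : ℍ → F) : Prop where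
  isCoveringMap : IsCoveringMap π
  surjective : Function.Surjective π
  locally_isometric : ∀ z : ℍ, ∃ r > 0, ∀ p ∈ Metric.ball z r, ∀ q ∈ Metric.ball z r,
    dist (π p) (π q) = dist p q

/-- Hyperbolic area on the surface covered by `π`: the least area of a measurable set in the
hyperbolic plane whose image contains `A`. For measurable `E` on which `π` is injective, the area
of `π '' E` is thus the hyperbolic area of `E`. -/
def surfaceArea {F : Type*} (π : ℍ → F) (A : Set F) : ENNReal :=
  ⨅ (E : Set ℍ) (_ : MeasurableSet E) (_ : A ⊆ π '' E), MeasureTheory.volume E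

/-- The open hyperbolic disk of radius `R` in the surface about `x`: the image of the disk of
radius `R` about any lift of `x`. -/
def surfaceDisk {F : Type*} (π : ℍ → F) (x : F) (R : ℝ) : Set F :=
  {p | ∃ x' p' : ℍ, π x' = x ∧ π p' = p ∧ dist p' x' < R}

end CenteredDual

end

/-! The plane is placed on the hyperboloid in Minkowski space by `lorentzVec`. There `cosh (dist p
q)` is a bilinear form, geodesic arcs and convex hulls consist of nonnegative linear combinations,
and being equidistant from two points is a linear condition. What has to be shown is that every
2-cell is a union of Delaunay polygons and that disks cut it in full sectors; the formula is then a
count of areas.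

Tessellation. For fixed `q` consider the normalized distance `cosh (dist p q) / cosh (infDist p S)`
as a function of `p`. If `q` lies in `P_v`, then `v` minimizes it, strictly if `q` is interior
(`IsNet.delaunay_le`, `IsNet.delaunay_lt`), and conversely a minimizer has `q` in its polygon
(`IsNet.exists_mem_geodesicHull`). So the polygons cover the plane and their interiors are disjoint.

Cells. The dual arc of a centered edge is contained in the degenerate Delaunay polygon of its
midpoint, so it misses the interior of every `P_v`. The center `v` may lie outside `P_v`, but it is
in the same component as the interior of `P_v`: on the segment from a vertex `z` of `P_v` to `v` the
point `z` is the only nearest one, which keeps the segment off the graph away from `z`, and for a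
suitable `z` the segment starts into the interior (`IsNet.connectedComponentIn_eq_of_mem_interior`).
Hence the closure of a component is the union of the `P_v` whose centers it contains.

Sectors. Within the injectivity radius of a net point `x` the graph consists of radii. The closure
of a cell is therefore invariant there under contraction towards `x`. Close to `x` it is a union of
polygons with vertex `x`, and each of them coincides there with its sector
(`IsCellUnion.ball_inter_closure`).

Areas. In the chart `gans x`, orthogonal projection to the tangent plane at `x`, area has the radial
density `1 / √(1 + ‖P‖ ^ 2)`. Polar coordinates give `(cosh R - 1) θ` for a sector and the angle
defect for a triangle. Cutting along diagonals gives `(n - 2) π - ∑ θ` for cyclic polygons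
(`volume_cyclic_polygon`), and the difference is the radius-`R` defect.

Quotient. Deck transformations are isometries and permute all the data. Choosing one lift of each
Voronoi vertex of a cell gives polygons whose interiors project injectively and whose union projects
onto the cell. Sectors may stick out of their polygons, so their areas are compared only after
projection, by cutting and moving pieces with deck transformations
(`IsLocallyIsometricCovering.volume_le`). -/

open scoped UpperHalfPlane

noncomputable section

namespace CenteredDual

section
/-! ### The hyperboloid and Klein models -/

/-- The Lorentzian bilinear form, in the coordinates of binary quadratic forms. -/
def lorentzForm : ℝ × ℝ × ℝ →ₗ[ℝ] ℝ × ℝ × ℝ →ₗ[ℝ] ℝ :=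
  LinearMap.mk₂ ℝ (fun u w => (u.1 * w.2.2 + u.2.2 * w.1 - 2 * u.2.1 * w.2.1) / 2)
    (fun _ _ _ => by simp; ring) (fun _ _ _ => by simp; ring)
    (fun _ _ _ => by simp; ring) (fun _ _ _ => by simp; ring)

theorem lorentzForm_apply (u w : ℝ × ℝ × ℝ) :
    lorentzForm u w = (u.1 * w.2.2 + u.2.2 * w.1 - 2 * u.2.1 * w.2.1) / 2 := rfl

theorem lorentzForm_comm (u w : ℝ × ℝ × ℝ) : lorentzForm u w = lorentzForm w u := by
  simp only [lorentzForm_apply]; ring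

/-- The point of the hyperboloid corresponding to a point of the upper half-plane. -/
def lorentzVec (p : ℍ) : ℝ × ℝ × ℝ := (1 / p.im, p.re / p.im, (p.re ^ 2 + p.im ^ 2) / p.im)

/-- Every comparison of distances below is turned by this into a linear inequality between vectors.
-/
theorem cosh_dist_eq (p q : ℍ) :
    Real.cosh (dist p q) = lorentzForm (lorentzVec p) (lorentzVec q) := by
  have hp := p.im_pos
  have hq := q.im_pos
  rw [UpperHalfPlane.cosh_dist, Complex.dist_eq_re_im, Real.sq_sqrt (by positivity)]
  simp only [lorentzForm_apply, lorentzVec, UpperHalfPlane.coe_re, UpperHalfPlane.coe_im]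
  field_simp
  ring

theorem lorentzForm_self (p : ℍ) : lorentzForm (lorentzVec p) (lorentzVec p) = 1 := by
  rw [← cosh_dist_eq]; simp

theorem lorentzForm_pos (p q : ℍ) : 0 < lorentzForm (lorentzVec p) (lorentzVec q) := by
  rw [← cosh_dist_eq]; exact Real.cosh_pos _

theorem one_le_lorentzForm (p q : ℍ) : 1 ≤ lorentzForm (lorentzVec p) (lorentzVec q) := by
  rw [← cosh_dist_eq]; exact Real.one_le_cosh _

theorem one_lt_lorentzForm {p q : ℍ} (h : p ≠ q) :
    1 < lorentzForm (lorentzVec p) (lorentzVec q) := by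
  rw [← cosh_dist_eq]; exact Real.one_lt_cosh.2 (dist_ne_zero.2 h)

theorem lorentzForm_eq_one_iff {p q : ℍ} :
    lorentzForm (lorentzVec p) (lorentzVec q) = 1 ↔ p = q := by
  refine ⟨fun h => ?_, fun h => h ▸ lorentzForm_self p⟩
  by_contra hne
  exact (one_lt_lorentzForm hne).ne' h

theorem lorentzVec_injective : Function.Injective lorentzVec := fun p q h =>
  lorentzForm_eq_one_iff.1 (h ▸ lorentzForm_self p)

theorem cosh_dist_le_cosh_dist {p q r s : ℍ} :
    Real.cosh (dist p q) ≤ Real.cosh (dist r s) ↔ dist p q ≤ dist r s := by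
  rw [Real.cosh_le_cosh, abs_of_nonneg dist_nonneg, abs_of_nonneg dist_nonneg]

theorem dist_le_dist_iff_lorentzForm {p q r s : ℍ} :
    dist p q ≤ dist r s ↔
      lorentzForm (lorentzVec p) (lorentzVec q) ≤ lorentzForm (lorentzVec r) (lorentzVec s) := by
  rw [← cosh_dist_eq, ← cosh_dist_eq, cosh_dist_le_cosh_dist]

theorem dist_eq_dist_iff_lorentzForm {p q r s : ℍ} :
    dist p q = dist r s ↔
      lorentzForm (lorentzVec p) (lorentzVec q) = lorentzForm (lorentzVec r) (lorentzVec s) := by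
  rw [le_antisymm_iff, dist_le_dist_iff_lorentzForm, dist_le_dist_iff_lorentzForm,
    ← le_antisymm_iff]

/-- The open cone of future timelike vectors. -/
def timelikeCone : Set (ℝ × ℝ × ℝ) := {u | 0 < u.1 ∧ u.2.1 ^ 2 < u.1 * u.2.2}

theorem lorentzVec_mem_timelikeCone (p : ℍ) : lorentzVec p ∈ timelikeCone := by
  have hp := p.im_pos
  refine ⟨by simp only [lorentzVec]; positivity, ?_⟩
  simp only [lorentzVec]
  rw [← sub_pos]
  have : 1 / p.im * ((p.re ^ 2 + p.im ^ 2) / p.im) - (p.re / p.im) ^ 2 = 1 := by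
    field_simp; ring
  rw [this]; exact one_pos

theorem smul_mem_timelikeCone {u : ℝ × ℝ × ℝ} (hu : u ∈ timelikeCone) {t : ℝ} (ht : 0 < t) :
    t • u ∈ timelikeCone := by
  obtain ⟨h1, h2⟩ := hu
  refine ⟨mul_pos ht h1, ?_⟩
  simp only [Prod.smul_fst, Prod.smul_snd, smul_eq_mul]
  nlinarith [mul_pos ht ht]

/-- The cross term is bounded by the arithmetic-geometric mean inequality for `u.1 * w.2.2` and `w.1
* u.2.2`, whose product dominates `(u.2.1 * w.2.1) ^ 2`. -/
theorem add_mem_timelikeCone {u w : ℝ × ℝ × ℝ} (hu : u ∈ timelikeCone) (hw : w ∈ timelikeCone) :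
    u + w ∈ timelikeCone := by
  obtain ⟨h1, h2⟩ := hu
  obtain ⟨h3, h4⟩ := hw
  refine ⟨add_pos h1 h3, ?_⟩
  simp only [Prod.fst_add, Prod.snd_add]
  have h5 : 0 < u.2.2 := by
    by_contra h; nlinarith [sq_nonneg u.2.1]
  have h6 : 0 < w.2.2 := by
    by_contra h; nlinarith [sq_nonneg w.2.1]
  have key : 2 * (u.2.1 * w.2.1) ≤ u.1 * w.2.2 + w.1 * u.2.2 := by
    have h7 : (u.2.1 * w.2.1) ^ 2 ≤ (u.1 * w.2.2) * (w.1 * u.2.2) := by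
      calc (u.2.1 * w.2.1) ^ 2 = u.2.1 ^ 2 * w.2.1 ^ 2 := by ring
        _ ≤ (u.1 * u.2.2) * (w.1 * w.2.2) := by gcongr
        _ = _ := by ring
    have h8 : (2 * (u.2.1 * w.2.1)) ^ 2 ≤ (u.1 * w.2.2 + w.1 * u.2.2) ^ 2 := by
      nlinarith [sq_nonneg (u.1 * w.2.2 - w.1 * u.2.2)]
    exact (abs_le.1 (abs_le_of_sq_le_sq h8 (by positivity))).2
  nlinarith

theorem exists_smul_lorentzVec {u : ℝ × ℝ × ℝ} (hu : u ∈ timelikeCone) :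
    ∃ l : ℝ, 0 < l ∧ ∃ p : ℍ, u = l • lorentzVec p := by
  obtain ⟨h1, h2⟩ := hu
  have hpos : 0 < u.1 * u.2.2 - u.2.1 ^ 2 := by linarith
  set s := √(u.1 * u.2.2 - u.2.1 ^ 2) with hs
  have hs0 : 0 < s := Real.sqrt_pos.2 hpos
  have hs2 : s ^ 2 = u.1 * u.2.2 - u.2.1 ^ 2 := Real.sq_sqrt hpos.le
  refine ⟨s, hs0, ⟨⟨u.2.1 / u.1, s / u.1⟩, by positivity⟩, ?_⟩
  have h0 := h1.ne'
  have h0s := hs0.ne'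
  simp only [lorentzVec, UpperHalfPlane.mk_re, UpperHalfPlane.mk_im]
  ext
  · simp; field_simp
  · simp; field_simp
  · simp only [Prod.smul_snd, smul_eq_mul]
    field_simp
    rw [hs2]; ring

/-- A future timelike vector of Lorentz norm one lies on the hyperboloid. -/
theorem exists_eq_lorentzVec {u : ℝ × ℝ × ℝ} (hu : u ∈ timelikeCone) (h1 : lorentzForm u u = 1) :
    ∃ p : ℍ, u = lorentzVec p := by
  obtain ⟨l, hl, p, rfl⟩ := exists_smul_lorentzVec hu
  simp only [map_smul, LinearMap.smul_apply, lorentzForm_self, smul_eq_mul, mul_one] at h1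
  refine ⟨p, ?_⟩
  have : l = 1 := by nlinarith
  rw [this, one_smul]

theorem combo_mem_timelikeCone (a b : ℍ) {s t : ℝ} (hs : 0 ≤ s) (ht : 0 ≤ t) (hst : 0 < s + t) :
    s • lorentzVec a + t • lorentzVec b ∈ timelikeCone := by
  rcases hs.eq_or_lt with rfl | hs
  · simpa using smul_mem_timelikeCone (lorentzVec_mem_timelikeCone b) (by linarith : 0 < t)
  rcases ht.eq_or_lt with rfl | ht
  · simpa using smul_mem_timelikeCone (lorentzVec_mem_timelikeCone a) hs
  exact add_mem_timelikeCone (smul_mem_timelikeCone (lorentzVec_mem_timelikeCone a) hs)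
    (smul_mem_timelikeCone (lorentzVec_mem_timelikeCone b) ht)

/-- Forward, the weights are `sinh (dist p b) / sinh (dist a b)` and `sinh (dist a p) / sinh (dist a
b)`: the combination has norm one and product one with `lorentzVec p`, hence is equal to it.
Backward, the same weights compute both partial distances, and the addition formula for `cosh`
finishes. -/
theorem mem_geodesicArc_iff_lorentzVec {p a b : ℍ} :
    p ∈ geodesicArc a b ↔
      ∃ s t : ℝ, 0 ≤ s ∧ 0 ≤ t ∧ lorentzVec p = s • lorentzVec a + t • lorentzVec b := by
  constructor
  · intro h
    have h : dist a p + dist p b = dist a b := h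
    rcases eq_or_ne a b with rfl | hab
    · have : p = a := by
        rw [dist_self] at h
        have h1 := dist_nonneg (x := a) (y := p)
        have h2 := dist_nonneg (x := p) (y := a)
        exact dist_eq_zero.1 (by linarith)
      exact ⟨1, 0, zero_le_one, le_rfl, by simp [this]⟩
    have hD : 0 < dist a b := dist_pos.2 hab
    have hS : 0 < Real.sinh (dist a b) := Real.sinh_pos_iff.2 hD
    set d1 := dist a p
    set d2 := dist p b
    set D := dist a b with hDdef
    have h1 : 0 ≤ Real.sinh d1 := Real.sinh_nonneg_iff.2 dist_nonneg
    have h2 : 0 ≤ Real.sinh d2 := Real.sinh_nonneg_iff.2 dist_nonneg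
    have hadd : Real.sinh D = Real.sinh d1 * Real.cosh d2 + Real.cosh d1 * Real.sinh d2 := by
      rw [← h, Real.sinh_add]
    have hcadd : Real.cosh D = Real.cosh d1 * Real.cosh d2 + Real.sinh d1 * Real.sinh d2 := by
      rw [← h, Real.cosh_add]
    have hs : 0 ≤ Real.sinh d2 / Real.sinh D := by positivity
    have ht : 0 ≤ Real.sinh d1 / Real.sinh D := by positivity
    refine ⟨_, _, hs, ht, ?_⟩
    have hst : 0 < Real.sinh d2 / Real.sinh D + Real.sinh d1 / Real.sinh D := by
      refine lt_of_le_of_ne (add_nonneg hs ht) fun h0 => ?_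
      have e1 : Real.sinh d2 / Real.sinh D = 0 := by linarith
      have e2 : Real.sinh d1 / Real.sinh D = 0 := by linarith
      rw [div_eq_zero_iff, or_iff_left hS.ne'] at e1 e2
      rw [e1, e2] at hadd
      simp at hadd
      exact hD.ne' hadd
    have c1 := Real.cosh_sq d1
    have c2 := Real.cosh_sq d2
    have cab : lorentzForm (lorentzVec a) (lorentzVec b) = Real.cosh D := (cosh_dist_eq a b).symm
    have cba : lorentzForm (lorentzVec b) (lorentzVec a) = Real.cosh D := by
      rw [lorentzForm_comm, cab]
    obtain ⟨q, hq⟩ := exists_eq_lorentzVec (combo_mem_timelikeCone a b hs ht hst) (by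
      simp only [map_add, map_smul, LinearMap.add_apply, LinearMap.smul_apply, lorentzForm_self,
        cab, cba, smul_eq_mul]
      field_simp
      rw [hcadd, hadd]
      linear_combination (-(Real.sinh d2 ^ 2)) * c1 - Real.sinh d1 ^ 2 * c2)
    rw [hq]
    congr 1
    rw [← lorentzForm_eq_one_iff, ← hq]
    simp only [map_add, map_smul, ← cosh_dist_eq, smul_eq_mul]
    rw [dist_comm p a]
    change Real.sinh d2 / Real.sinh D * Real.cosh d1 + Real.sinh d1 / Real.sinh D * Real.cosh d2 = 1
    field_simp
    rw [hadd]; ring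
  · rintro ⟨s, t, hs, ht, h⟩
    change dist a p + dist p b = dist a b
    set C := Real.cosh (dist a b) with hC
    have cab : lorentzForm (lorentzVec a) (lorentzVec b) = C := (cosh_dist_eq a b).symm
    have cba : lorentzForm (lorentzVec b) (lorentzVec a) = C := by rw [lorentzForm_comm, cab]
    have hA : Real.cosh (dist a p) = s + t * C := by
      rw [cosh_dist_eq, h]
      simp only [map_add, map_smul, lorentzForm_self, cab, smul_eq_mul]; ring
    have hB : Real.cosh (dist p b) = s * C + t := by
      rw [cosh_dist_eq, h]
      simp only [map_add, map_smul, LinearMap.add_apply, LinearMap.smul_apply, lorentzForm_self,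
        cab, smul_eq_mul]; ring
    have h1 : s ^ 2 + t ^ 2 + 2 * s * t * C = 1 := by
      have := lorentzForm_self p
      rw [h] at this
      simp only [map_add, map_smul, LinearMap.add_apply, LinearMap.smul_apply, lorentzForm_self,
        cab, cba, smul_eq_mul] at this
      linarith
    have hD : 0 ≤ Real.sinh (dist a b) := Real.sinh_nonneg_iff.2 dist_nonneg
    have hDC := Real.cosh_sq (dist a b)
    have s1 : Real.sinh (dist a p) = t * Real.sinh (dist a b) := by
      have h3 : 0 ≤ Real.sinh (dist a p) := Real.sinh_nonneg_iff.2 dist_nonneg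
      rw [← sq_eq_sq₀ h3 (by positivity)]
      have := Real.cosh_sq (dist a p)
      rw [hA] at this
      rw [mul_pow]
      linear_combination -this + h1 + t ^ 2 * hDC
    have s2 : Real.sinh (dist p b) = s * Real.sinh (dist a b) := by
      have h3 : 0 ≤ Real.sinh (dist p b) := Real.sinh_nonneg_iff.2 dist_nonneg
      rw [← sq_eq_sq₀ h3 (by positivity)]
      have := Real.cosh_sq (dist p b)
      rw [hB] at this
      rw [mul_pow]
      linear_combination -this + h1 + s ^ 2 * hDC
    have : Real.cosh (dist a p + dist p b) = Real.cosh (dist a b) := by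
      rw [Real.cosh_add, hA, hB, s1, s2]
      linear_combination (-s * t) * hDC + C * h1
    have h4 := Real.cosh_strictMonoOn.injOn (x₁ := dist a p + dist p b) (x₂ := dist a b)
      (by simp; positivity) (by simp) this
    exact h4

/-! ### The Klein model and hyperbolic convexity -/

/-- The Klein model, as the region above a parabola. -/
def klein (p : ℍ) : ℝ × ℝ := (p.re, p.re ^ 2 + p.im ^ 2)

/-- The image of the Klein model. -/
def kleinRegion : Set (ℝ × ℝ) := {k | k.1 ^ 2 < k.2}

theorem klein_mem (p : ℍ) : klein p ∈ kleinRegion := by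
  have := p.im_pos
  simp only [klein, kleinRegion, Set.mem_ofPred_eq]
  nlinarith

theorem lorentzVec_eq_smul (p : ℍ) : lorentzVec p = (1 / p.im) • ((1 : ℝ), klein p) := by
  ext <;> simp [lorentzVec, klein] <;> ring

theorem smul_lorentzVec_eq (p : ℍ) : p.im • lorentzVec p = ((1 : ℝ), klein p) := by
  rw [lorentzVec_eq_smul, smul_smul, mul_one_div_cancel p.im_ne_zero, one_smul]

theorem isOpen_kleinRegion : IsOpen kleinRegion :=
  isOpen_lt (by fun_prop) (by fun_prop)

theorem convex_kleinRegion : Convex ℝ kleinRegion := by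
  intro k hk l hl a b ha hb hab
  simp only [kleinRegion, Set.mem_ofPred_eq, Prod.fst_add, Prod.snd_add, Prod.smul_fst,
    Prod.smul_snd, smul_eq_mul] at *
  have hb' : b = 1 - a := by linarith
  subst hb'
  rcases ha.eq_or_lt with rfl | ha
  · simpa using hl
  rcases hb.eq_or_lt with hb | hb
  · have : a = 1 := by linarith
    subst this; simpa using hk
  nlinarith [mul_lt_mul_of_pos_left hk ha, mul_lt_mul_of_pos_left hl hb,
    mul_nonneg (mul_pos ha hb).le (sq_nonneg (k.1 - l.1))]

/-- The inverse of the Klein chart. -/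
def kleinInv (k : ℝ × ℝ) : ℍ := UpperHalfPlane.ofComplex ⟨k.1, √(k.2 - k.1 ^ 2)⟩

theorem kleinInv_eq {k : ℝ × ℝ} (hk : k ∈ kleinRegion) :
    kleinInv k = ⟨⟨k.1, √(k.2 - k.1 ^ 2)⟩, Real.sqrt_pos.2 (sub_pos.2 hk)⟩ :=
  UpperHalfPlane.ofComplex_apply_of_im_pos (z := ⟨k.1, √(k.2 - k.1 ^ 2)⟩)
    (Real.sqrt_pos.2 (sub_pos.2 hk))

theorem klein_kleinInv {k : ℝ × ℝ} (hk : k ∈ kleinRegion) : klein (kleinInv k) = k := by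
  rw [kleinInv_eq hk]
  ext
  · rfl
  · simp only [klein, UpperHalfPlane.mk_re, UpperHalfPlane.mk_im]
    rw [Real.sq_sqrt (sub_pos.2 hk).le]; ring

theorem klein_injective : Function.Injective klein := by
  intro p q h
  simp only [klein, Prod.mk.injEq] at h
  refine UpperHalfPlane.ext_re_im h.1 ?_
  have h2 := h.2
  rw [h.1] at h2
  exact (sq_eq_sq₀ p.im_pos.le q.im_pos.le).1 (by linarith)

theorem kleinInv_klein (p : ℍ) : kleinInv (klein p) = p :=
  klein_injective (klein_kleinInv (klein_mem p))

theorem continuous_klein : Continuous klein := by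
  unfold klein
  have h1 := UpperHalfPlane.continuous_re
  have h2 := UpperHalfPlane.continuous_im
  fun_prop

theorem continuousOn_kleinInv : ContinuousOn kleinInv kleinRegion := by
  have h : ContinuousOn (fun k : ℝ × ℝ => (⟨k.1, √(k.2 - k.1 ^ 2)⟩ : ℂ)) kleinRegion := by
    have : (fun k : ℝ × ℝ => (⟨k.1, √(k.2 - k.1 ^ 2)⟩ : ℂ)) =
        fun k => Complex.equivRealProdCLM.symm (k.1, √(k.2 - k.1 ^ 2)) := by
      ext k; rfl
    rw [this]; fun_prop
  rw [continuousOn_iff_continuous_domRestrict]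
  have h2 : kleinRegion.domRestrict kleinInv = fun k : kleinRegion =>
      (⟨⟨k.1.1, √(k.1.2 - k.1.1 ^ 2)⟩, Real.sqrt_pos.2 (sub_pos.2 k.2)⟩ : ℍ) := by
    ext k
    simp [Set.domRestrict_apply, kleinInv_eq k.2]
  rw [h2]
  exact (continuousOn_iff_continuous_domRestrict.1 h).upperHalfPlaneMk _

theorem range_klein : Set.range klein = kleinRegion := by
  ext k
  exact ⟨fun ⟨p, hp⟩ => hp ▸ klein_mem p, fun hk => ⟨_, klein_kleinInv hk⟩⟩

theorem isOpenEmbedding_klein : Topology.IsOpenEmbedding klein := by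
  refine .of_continuous_injective_isOpenMap continuous_klein klein_injective fun U hU => ?_
  have : klein '' U = kleinRegion ∩ kleinInv ⁻¹' U := by
    ext k
    constructor
    · rintro ⟨p, hp, rfl⟩
      exact ⟨klein_mem p, by simpa [kleinInv_klein] using hp⟩
    · rintro ⟨hk, hU⟩
      exact ⟨_, hU, klein_kleinInv hk⟩
  rw [this]
  exact continuousOn_kleinInv.isOpen_inter_preimage isOpen_kleinRegion hU

/-- Positive linear relations between points of the hyperboloid correspond to affine relations
between points of the Klein model. -/
theorem sum_klein_iff {ι : Type*} (s : Finset ι) (x : ι → ℍ) (q : ℍ) :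
    (∃ w : ι → ℝ, (∀ i ∈ s, 0 ≤ w i) ∧ ∑ i ∈ s, w i = 1 ∧ ∑ i ∈ s, w i • klein (x i) = klein q) ↔
      ∃ t : ι → ℝ, (∀ i ∈ s, 0 ≤ t i) ∧ lorentzVec q = ∑ i ∈ s, t i • lorentzVec (x i) := by
  have hq := q.im_pos
  constructor
  · rintro ⟨w, hw, h1, h2⟩
    -- As `lorentzVec p` is `(1, klein p)` divided by `p.im`, affine weights and cone coefficients
    -- differ by ratios of imaginary parts; the first coordinate records that the weights sum to
    -- one.
    refine ⟨fun i => w i * (x i).im / q.im, fun i hi => ?_, ?_⟩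
    · have := (x i).im_pos
      have := hw i hi
      positivity
    · have : ∀ i ∈ s, (w i * (x i).im / q.im) • lorentzVec (x i) =
          (1 / q.im) • (w i, w i • klein (x i)) := fun i _ => by
        have := smul_lorentzVec_eq (x i)
        rw [show w i * (x i).im / q.im = (1 / q.im) * w i * (x i).im by ring, mul_smul, this,
          mul_smul]
        simp
      rw [Finset.sum_congr rfl this, ← Finset.smul_sum, lorentzVec_eq_smul]
      congr 1
      ext
      · simp [Prod.fst_sum, h1]
      · simp [Prod.snd_sum, Prod.fst_sum, ← h2]
      · simp [Prod.snd_sum, ← h2]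
  · rintro ⟨t, ht, h⟩
    have h2 : ((1 : ℝ), klein q) = ∑ i ∈ s, (t i * q.im / (x i).im, (t i * q.im / (x i).im) • klein (x i)) := by
      rw [← smul_lorentzVec_eq, h, Finset.smul_sum]
      refine Finset.sum_congr rfl fun i _ => ?_
      rw [lorentzVec_eq_smul, smul_smul, smul_smul, show q.im * t i * (1 / (x i).im) =
        t i * q.im / (x i).im by ring]
      simp
    refine ⟨fun i => t i * q.im / (x i).im, fun i hi => ?_, ?_, ?_⟩
    · have := (x i).im_pos
      have := ht i hi
      positivity
    · have := congrArg Prod.fst h2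
      rw [Prod.fst_sum] at this
      exact this.symm
    · have := congrArg Prod.snd h2
      rw [Prod.snd_sum] at this
      exact this.symm

theorem mem_geodesicArc_iff_klein {p a b : ℍ} :
    p ∈ geodesicArc a b ↔ klein p ∈ segment ℝ (klein a) (klein b) := by
  rw [mem_geodesicArc_iff_lorentzVec]
  have := sum_klein_iff Finset.univ ![a, b] p
  simp only [Fin.forall_fin_two, Finset.mem_univ, forall_const, Fin.sum_univ_two,
    Matrix.cons_val_zero, Matrix.cons_val_one] at this
  constructor
  · rintro ⟨s, t, hs, ht, h⟩
    obtain ⟨w, hw, h1, h2⟩ := this.2 ⟨![s, t], ⟨hs, ht⟩, h⟩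
    exact ⟨w 0, w 1, hw.1, hw.2, h1, h2⟩
  · rintro ⟨s, t, hs, ht, h1, h2⟩
    obtain ⟨w, hw, h⟩ := this.1 ⟨![s, t], ⟨hs, ht⟩, h1, h2⟩
    exact ⟨w 0, w 1, hw.1, hw.2, h⟩

theorem geodesicallyConvex_preimage {K : Set (ℝ × ℝ)} (hK : Convex ℝ K) :
    GeodesicallyConvex (klein ⁻¹' K) := fun p hp q hq r hr =>
  hK.segment_subset hp hq (mem_geodesicArc_iff_klein.1 hr)

theorem GeodesicallyConvex.convex_image {K : Set ℍ} (hK : GeodesicallyConvex K) :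
    Convex ℝ (klein '' K) := by
  rw [convex_iff_segment_subset]
  rintro _ ⟨p, hp, rfl⟩ _ ⟨q, hq, rfl⟩ r hr
  have hr' : r ∈ kleinRegion := convex_kleinRegion.segment_subset (klein_mem p) (klein_mem q) hr
  refine ⟨kleinInv r, hK p hp q hq (mem_geodesicArc_iff_klein.2 ?_), klein_kleinInv hr'⟩
  rwa [klein_kleinInv hr']

/-- Geodesic arcs are the chords of the Klein model, so taking images and preimages under `klein`
exchanges the two notions of convexity. -/
theorem geodesicHull_eq (X : Set ℍ) :
    geodesicHull X = klein ⁻¹' convexHull ℝ (klein '' X) := by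
  apply Set.Subset.antisymm
  · refine Set.sInter_subset_of_mem ⟨geodesicallyConvex_preimage (convex_convexHull ℝ _), ?_⟩
    exact fun x hx => subset_convexHull ℝ _ (Set.mem_image_of_mem _ hx)
  · rintro p hp K ⟨hK, hX⟩
    obtain ⟨q, hq, h⟩ := convexHull_min (Set.image_mono hX) hK.convex_image hp
    rwa [← klein_injective h]

/-- In this form any linear form on Minkowski space can be evaluated on a point of a hull through
the vertices. -/
theorem mem_geodesicHull_finset {X : Finset ℍ} {q : ℍ} :
    q ∈ geodesicHull (X : Set ℍ) ↔
      ∃ t : ℍ → ℝ, (∀ x ∈ X, 0 ≤ t x) ∧ lorentzVec q = ∑ x ∈ X, t x • lorentzVec x := by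
  classical
  rw [geodesicHull_eq, Set.mem_preimage, ← Finset.coe_image, Finset.mem_convexHull',
    ← sum_klein_iff X (fun x => x) q]
  constructor
  · rintro ⟨w, hw, h1, h2⟩
    rw [Finset.sum_image klein_injective.injOn] at h1 h2
    exact ⟨fun x => w (klein x), fun x hx => hw _ (Finset.mem_image_of_mem _ hx), h1, h2⟩
  · rintro ⟨w, hw, h1, h2⟩
    refine ⟨fun k => w (kleinInv k), ?_, ?_, ?_⟩
    · intro y hy
      obtain ⟨x, hx, rfl⟩ := Finset.mem_image.1 hy
      simpa [kleinInv_klein] using hw x hx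
    · rw [Finset.sum_image klein_injective.injOn]; simpa [kleinInv_klein] using h1
    · rw [Finset.sum_image klein_injective.injOn]; simpa [kleinInv_klein] using h2

theorem subset_geodesicHull (X : Set ℍ) : X ⊆ geodesicHull X :=
  Set.subset_sInter fun _ hK => hK.2

theorem geodesicallyConvex_geodesicHull (X : Set ℍ) : GeodesicallyConvex (geodesicHull X) := by
  rw [geodesicHull_eq]
  exact geodesicallyConvex_preimage (convex_convexHull ℝ _)

theorem geodesicHull_subset {X K : Set ℍ} (hK : GeodesicallyConvex K) (h : X ⊆ K) :
    geodesicHull X ⊆ K := Set.sInter_subset_of_mem ⟨hK, h⟩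

theorem geodesicHull_mono {X Y : Set ℍ} (h : X ⊆ Y) : geodesicHull X ⊆ geodesicHull Y :=
  geodesicHull_subset (geodesicallyConvex_geodesicHull Y) (h.trans (subset_geodesicHull Y))

end

section
open MeasureTheory

/-! ### Charts of the hyperboloid by orthogonal projection -/

/-- The orthogonal projection of Minkowski space to the tangent plane at a point of the
hyperboloid. -/
def tangentProj (x : ℍ) : ℝ × ℝ × ℝ →ₗ[ℝ] ℂ where
  toFun u := ⟨u.2.1 - x.re * u.1,
    (u.2.2 - 2 * x.re * u.2.1 + (x.re ^ 2 - x.im ^ 2) * u.1) / (2 * x.im)⟩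
  map_add' u w := by
    apply Complex.ext
    · simp; ring
    · simp; ring
  map_smul' t u := by
    apply Complex.ext
    · simp; ring
    · simp; ring

theorem tangentProj_apply (x : ℍ) (u : ℝ × ℝ × ℝ) : tangentProj x u = ⟨u.2.1 - x.re * u.1,
    (u.2.2 - 2 * x.re * u.2.1 + (x.re ^ 2 - x.im ^ 2) * u.1) / (2 * x.im)⟩ := rfl

/-- Minkowski space is the orthogonal sum of the line of `lorentzVec x` and a plane on which the
form is negative definite; `tangentProj x` identifies that plane with `ℂ`. -/
theorem lorentzForm_eq_sub (x : ℍ) (u w : ℝ × ℝ × ℝ) :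
    lorentzForm u w = lorentzForm (lorentzVec x) u * lorentzForm (lorentzVec x) w -
      (tangentProj x u * (starRingEnd ℂ) (tangentProj x w)).re := by
  have := x.im_pos
  simp only [lorentzForm_apply, tangentProj_apply, lorentzVec, Complex.mul_re, Complex.conj_re,
    Complex.conj_im]
  field_simp
  ring

/-- The chart of the hyperbolic plane by orthogonal projection of the hyperboloid. -/
def gans (x p : ℍ) : ℂ := tangentProj x (lorentzVec p)

theorem cosh_dist_gans (x p q : ℍ) : Real.cosh (dist p q) =
    Real.cosh (dist x p) * Real.cosh (dist x q) -
      (gans x p * (starRingEnd ℂ) (gans x q)).re := by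
  rw [cosh_dist_eq, lorentzForm_eq_sub x, cosh_dist_eq, cosh_dist_eq]; rfl

theorem norm_gans_sq (x p : ℍ) : ‖gans x p‖ ^ 2 = Real.cosh (dist x p) ^ 2 - 1 := by
  have := cosh_dist_gans x p p
  rw [dist_self, Real.cosh_zero, Complex.mul_conj, Complex.ofReal_re, Complex.normSq_eq_norm_sq]
    at this
  linarith

theorem norm_gans (x p : ℍ) : ‖gans x p‖ = Real.sinh (dist x p) := by
  rw [← sq_eq_sq₀ (norm_nonneg _) (Real.sinh_nonneg_iff.2 dist_nonneg), norm_gans_sq,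
    Real.cosh_sq]; ring

theorem cosh_dist_eq_sqrt (x p : ℍ) : Real.cosh (dist x p) = √(1 + ‖gans x p‖ ^ 2) := by
  rw [norm_gans_sq, add_sub_cancel, Real.sqrt_sq (Real.cosh_pos _).le]

@[simp] theorem gans_self (x : ℍ) : gans x x = 0 := by
  rw [← norm_eq_zero, norm_gans]; simp

theorem gans_injective (x : ℍ) : Function.Injective (gans x) := by
  intro p q h
  rw [← lorentzForm_eq_one_iff, ← cosh_dist_eq, cosh_dist_gans x, cosh_dist_eq_sqrt x p,
    cosh_dist_eq_sqrt x q, h, Complex.mul_conj, Complex.ofReal_re, Complex.normSq_eq_norm_sq,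
    Real.mul_self_sqrt (by positivity)]
  ring

theorem gans_eq_zero_iff {x p : ℍ} : gans x p = 0 ↔ p = x := by
  rw [← gans_self x, (gans_injective x).eq_iff]

/-- The projection is an isomorphism when combined with the coordinate along the base point. -/
theorem lorentzVec_ext (x : ℍ) {u w : ℝ × ℝ × ℝ}
    (h0 : lorentzForm (lorentzVec x) u = lorentzForm (lorentzVec x) w)
    (h : tangentProj x u = tangentProj x w) : u = w := by
  have hx := x.im_pos
  simp only [lorentzForm_apply, tangentProj_apply, lorentzVec, Complex.mk.injEq] at h0 h
  obtain ⟨h1, h2⟩ := h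
  field_simp at h0 h2
  have e1 : u.1 = w.1 := by
    have : 2 * x.im ^ 2 * u.1 = 2 * x.im ^ 2 * w.1 := by
      linear_combination h0 - h2
    exact mul_left_cancel₀ (by positivity) this
  have e2 : u.2.1 = w.2.1 := by rw [e1] at h1; linarith
  have e3 : u.2.2 = w.2.2 := by rw [e1, e2] at h2; linarith
  exact Prod.ext e1 (Prod.ext e2 e3)

theorem exists_gans_eq (x : ℍ) (P : ℂ) : ∃ p, gans x p = P := by
  have hx := x.im_pos
  have h0 : P.im < √(1 + ‖P‖ ^ 2) := by
    refine (le_abs_self _).trans_lt (Real.lt_sqrt_of_sq_lt ?_)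
    rw [sq_abs, Complex.sq_norm, Complex.normSq_apply]
    nlinarith [mul_self_nonneg P.re]
  have hs : √(1 + ‖P‖ ^ 2) ^ 2 = 1 + (P.re ^ 2 + P.im ^ 2) := by
    rw [Real.sq_sqrt (by positivity), Complex.sq_norm, Complex.normSq_apply]; ring
  set s := √(1 + ‖P‖ ^ 2)
  have h1 : 0 < s - P.im := by linarith
  -- The height is forced by `cosh (dist x p) - (gans x p).im = x.im / p.im`, and the real part by
  -- `(gans x p).re = (p.re - x.re) / p.im`.
  refine ⟨⟨⟨x.re + P.re * (x.im / (s - P.im)), x.im / (s - P.im)⟩, by positivity⟩, ?_⟩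
  have h2 := h1.ne'
  rw [gans, tangentProj_apply]
  simp only [lorentzVec, UpperHalfPlane.mk_re, UpperHalfPlane.mk_im]
  apply Complex.ext
  · simp only; field_simp; ring
  · simp only; field_simp
    linear_combination -(x.im ^ 2) * hs

theorem continuous_lorentzVec : Continuous lorentzVec := by
  unfold lorentzVec
  have h1 := UpperHalfPlane.continuous_re
  have h2 := UpperHalfPlane.continuous_im
  have h3 : ∀ p : ℍ, p.im ≠ 0 := UpperHalfPlane.im_ne_zero
  fun_prop (disch := assumption)

theorem continuous_tangentProj (x : ℍ) : Continuous (tangentProj x) :=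
  LinearMap.continuous_of_finiteDimensional _

theorem continuous_gans (x : ℍ) : Continuous (gans x) :=
  (continuous_tangentProj x).comp continuous_lorentzVec

theorem measurable_gans (x : ℍ) : Measurable (gans x) := (continuous_gans x).measurable

/-- The derivative of the chart in upper half-plane coordinates. -/
def gansDeriv (x : ℍ) (z : ℂ) : ℂ →L[ℝ] ℂ :=
  Matrix.toLin Complex.basisOneI Complex.basisOneI
    !![1 / z.im, -(z.re - x.re) / z.im ^ 2;
      (z.re - x.re) / (x.im * z.im),
      (z.im ^ 2 - (z.re - x.re) ^ 2 + x.im ^ 2) / (2 * z.im ^ 2 * x.im)] |>.toContinuousLinearMap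

theorem gansDeriv_apply (x : ℍ) (z w : ℂ) : gansDeriv x z w =
    ⟨1 / z.im * w.re + -(z.re - x.re) / z.im ^ 2 * w.im, (z.re - x.re) / (x.im * z.im) * w.re +
      (z.im ^ 2 - (z.re - x.re) ^ 2 + x.im ^ 2) / (2 * z.im ^ 2 * x.im) * w.im⟩ := by
  simp only [gansDeriv, LinearMap.coe_toContinuousLinearMap', Matrix.toLin_apply,
    Fin.sum_univ_two]
  generalize 1 / z.im = a
  generalize -(z.re - x.re) / z.im ^ 2 = b
  generalize (z.re - x.re) / (x.im * z.im) = c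
  generalize (z.im ^ 2 - (z.re - x.re) ^ 2 + x.im ^ 2) / (2 * z.im ^ 2 * x.im) = d
  apply Complex.ext <;>
  simp [Matrix.mulVec, dotProduct, Fin.sum_univ_two, Complex.coe_basisOneI_repr,
    Complex.coe_basisOneI]

theorem gansDeriv_det (x p : ℍ) :
    (gansDeriv x p).det = Real.cosh (dist x p) / p.im ^ 2 := by
  have hx := x.im_pos
  have hp := p.im_pos
  rw [gansDeriv, ContinuousLinearMap.det, LinearMap.coe_toContinuousLinearMap, LinearMap.det_toLin,
    Matrix.det_fin_two_of, cosh_dist_eq]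
  simp only [lorentzForm_apply, lorentzVec, UpperHalfPlane.coe_re, UpperHalfPlane.coe_im]
  field_simp
  ring

theorem hasFDerivAt_gans (x p : ℍ) :
    HasFDerivAt (fun z : ℂ => (⟨(z.re - x.re) / z.im,
      ((z.re - x.re) ^ 2 + z.im ^ 2 - x.im ^ 2) / (2 * x.im * z.im)⟩ : ℂ)) (gansDeriv x p) p := by
  have hx := x.im_ne_zero
  have hp : (p : ℂ).im ≠ 0 := p.im_ne_zero
  have hre : HasFDerivAt (fun z : ℂ => z.re) Complex.reCLM (p : ℂ) := Complex.reCLM.hasFDerivAt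
  have him : HasFDerivAt (fun z : ℂ => z.im) Complex.imCLM (p : ℂ) := Complex.imCLM.hasFDerivAt
  have hinv := (hasDerivAt_inv hp).comp_hasFDerivAt (p : ℂ) him
  have h1 := (hre.sub_const x.re).mul hinv
  have h2 := (((hre.sub_const x.re).mul (hre.sub_const x.re)).add
    (him.mul him)).sub_const (x.im ^ 2) |>.mul (hinv.const_mul (1 / (2 * x.im)))
  have h3 := Complex.equivRealProdCLM.symm.hasFDerivAt.comp (p : ℂ) (h1.prodMk h2)
  refine (h3.congr_fderiv ?_).congr_of_eventuallyEq (.of_forall fun z => ?_)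
  · ext w <;> apply Complex.ext
    all_goals
      simp [gansDeriv_apply]
      try field_simp
      try ring
  · apply Complex.ext
    · simp [div_eq_mul_inv]
    · simp; field_simp

theorem gans_eq (x p : ℍ) : gans x p = ⟨(p.re - x.re) / p.im,
    ((p.re - x.re) ^ 2 + p.im ^ 2 - x.im ^ 2) / (2 * x.im * p.im)⟩ := by
  have hx := x.im_ne_zero
  have hp := p.im_ne_zero
  rw [gans, tangentProj_apply]
  apply Complex.ext
  · simp [lorentzVec]; field_simp
  · simp [lorentzVec]; field_simp; ring

/-- The density of the hyperbolic area in the projection chart. -/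
def gansDensity (P : ℂ) : ENNReal := ENNReal.ofReal (1 / √(1 + ‖P‖ ^ 2))

theorem measurable_gansDensity : Measurable gansDensity := by
  unfold gansDensity; fun_prop

/-- The Jacobian of the chart is `cosh (dist x p) / p.im ^ 2` and the area form is `dx dy / p.im ^
2`, so the density left over is `1 / cosh (dist x p)`, a function of the radius alone. -/
theorem volume_preimage_gans (x : ℍ) {A : Set ℂ} (hA : MeasurableSet A) :
    volume (gans x ⁻¹' A) = ∫⁻ P in A, gansDensity P := by
  have hs : MeasurableSet (gans x ⁻¹' A) := measurable_gans x hA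
  have main := lintegral_image_eq_lintegral_abs_det_fderiv_mul volume
    (UpperHalfPlane.measurableEmbedding_coe.measurableSet_image.2 hs)
    (f := (fun z : ℂ => (⟨(z.re - x.re) / z.im,
      ((z.re - x.re) ^ 2 + z.im ^ 2 - x.im ^ 2) / (2 * x.im * z.im)⟩ : ℂ)))
    (f' := gansDeriv x) ?_ ?_ gansDensity
  · have himg : (fun z : ℂ => (⟨(z.re - x.re) / z.im,
        ((z.re - x.re) ^ 2 + z.im ^ 2 - x.im ^ 2) / (2 * x.im * z.im)⟩ : ℂ)) ''
        ((↑) '' (gans x ⁻¹' A)) = A := by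
      rw [Set.image_image]
      have : (fun p : ℍ => (⟨((p : ℂ).re - x.re) / (p : ℂ).im, (((p : ℂ).re - x.re) ^ 2 +
          (p : ℂ).im ^ 2 - x.im ^ 2) / (2 * x.im * (p : ℂ).im)⟩ : ℂ)) = gans x := by
        funext p; rw [gans_eq]; rfl
      rw [this]
      exact Set.image_preimage_eq _ (exists_gans_eq x)
    rw [himg] at main
    rw [main, UpperHalfPlane.volume_eq_lintegral]
    refine setLIntegral_congr_fun
      (UpperHalfPlane.measurableEmbedding_coe.measurableSet_image.2 hs) ?_
    rintro _ ⟨p, -, rfl⟩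
    have e : (⟨((p : ℂ).re - x.re) / (p : ℂ).im, (((p : ℂ).re - x.re) ^ 2 +
          (p : ℂ).im ^ 2 - x.im ^ 2) / (2 * x.im * (p : ℂ).im)⟩ : ℂ) = gans x p := by
      rw [gans_eq]; rfl
    simp only [e, gansDensity]
    rw [gansDeriv_det, ← cosh_dist_eq_sqrt, ← ENNReal.ofReal_mul (abs_nonneg _)]
    have hc := Real.cosh_pos (dist x p)
    have hp := p.im_pos
    rw [abs_of_nonneg (by positivity), ← ENNReal.ofReal_coe_nnreal]
    congr 1
    simp
    field_simp
  · rintro _ ⟨p, -, rfl⟩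
    exact (hasFDerivAt_gans x p).hasFDerivWithinAt
  · rintro _ ⟨p, -, rfl⟩ _ ⟨q, -, rfl⟩ h
    have : gans x p = gans x q := by rw [gans_eq, gans_eq]; exact h
    rw [gans_injective x this]

/-- The density is radial, so the chart may be composed with any linear isometry of the plane, in
particular rotated. -/
theorem volume_preimage_of_norm_preserving (x : ℍ) (f : ℂ ≃ₗᵢ[ℝ] ℂ) {A : Set ℂ}
    (hA : MeasurableSet A) :
    volume ((fun p => f (gans x p)) ⁻¹' A) = ∫⁻ P in A, gansDensity P := by
  have h1 : (fun p => f (gans x p)) ⁻¹' A = gans x ⁻¹' (f ⁻¹' A) := rfl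
  rw [h1, volume_preimage_gans x (f.continuous.measurable hA)]
  have h2 := f.measurePreserving
  rw [← h2.setLIntegral_comp_preimage hA measurable_gansDensity]
  simp [gansDensity]

/-- Isometries of the hyperbolic plane preserve area. -/
theorem volume_preimage_isometry {g : ℍ → ℍ} (hg : Isometry g) (hs : Function.Surjective g)
    {A : Set ℍ} (hA : MeasurableSet A) : volume (g ⁻¹' A) = volume A := by
  let x : ℍ := UpperHalfPlane.I
  choose r hr using exists_gans_eq x
  have hrl : ∀ p, r (gans x p) = p := fun p => gans_injective x (hr _)
  have key : ∀ P, ‖gans (g x) (g (r P))‖ ^ 2 = ‖P‖ ^ 2 := fun P => by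
    rw [norm_gans_sq, hg.dist_eq, ← norm_gans_sq, hr]
  -- Read in the charts at `x` and `g x`, the isometry is an isometry of the Euclidean plane, since
  -- norms and inner products are functions of hyperbolic distances. It fixes the origin, so it is
  -- linear by the Mazur-Ulam theorem.
  let φ : ℂ → ℂ := fun P => gans (g x) (g (r P))
  have hφ : Isometry φ := by
    refine Isometry.of_dist_eq fun P Q => ?_
    rw [dist_eq_norm, dist_eq_norm, ← sq_eq_sq₀ (norm_nonneg _) (norm_nonneg _)]
    have h1 := cosh_dist_gans x (r P) (r Q)
    have h2 := cosh_dist_gans (g x) (g (r P)) (g (r Q))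
    simp only [hg.dist_eq, hr] at h1 h2
    simp only [Complex.sq_norm, Complex.normSq_sub]
    simp only [← Complex.sq_norm]
    have h3 := key P
    have h4 := key Q
    change ‖gans (g x) (g (r P))‖ ^ 2 + ‖gans (g x) (g (r Q))‖ ^ 2 - 2 * _ = _
    linarith
  have hφs : Function.Surjective φ := fun P => by
    obtain ⟨p, rfl⟩ := exists_gans_eq (g x) P
    obtain ⟨q, rfl⟩ := hs p
    exact ⟨gans x q, by simp only [φ, hrl]⟩
  have hφ0 : φ 0 = 0 := by
    have : r 0 = x := by rw [← hrl x, gans_self]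
    simp only [φ, this, gans_self]
  let e := (IsometryEquiv.mk (Equiv.ofBijective φ ⟨hφ.injective, hφs⟩) hφ)
  let f : ℂ ≃ₗᵢ[ℝ] ℂ := e.toRealLinearIsometryEquivOfMapZero hφ0
  have hf : ∀ p, f (gans x p) = gans (g x) (g p) := fun p => by
    change φ (gans x p) = _
    simp only [φ, hrl]
  have hB : MeasurableSet (gans (g x) '' A) :=
    ((continuous_gans (g x)).measurableEmbedding (gans_injective (g x))).measurableSet_image.2 hA
  have h1 := volume_preimage_of_norm_preserving x f hB
  have h2 := volume_preimage_gans (g x) hB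
  rw [← h2, Set.preimage_image_eq _ (gans_injective _)] at h1
  rw [← h1]
  congr 1
  ext p
  simp only [Set.mem_preimage, hf]
  exact ((gans_injective (g x)).mem_set_image).symm

end

section
open MeasureTheory

/-! ### Areas in polar coordinates -/

theorem lintegral_Ioc_radial {s : ℝ} (hs : 0 ≤ s) :
    ∫⁻ r in Set.Ioc 0 s, ENNReal.ofReal (r * (1 / √(1 + r ^ 2))) =
      ENNReal.ofReal (√(1 + s ^ 2) - 1) := by
  have hcont : Continuous fun r : ℝ => r * (1 / √(1 + r ^ 2)) := by
    have : ∀ r : ℝ, √(1 + r ^ 2) ≠ 0 := fun r => by positivity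
    fun_prop (disch := exact this _)
  rw [← ofReal_integral_eq_lintegral_ofReal]
  · rw [← intervalIntegral.integral_of_le hs,
      intervalIntegral.integral_eq_sub_of_hasDerivAt (f := fun r => √(1 + r ^ 2))]
    · simp
    · intro r _
      have h1 : HasDerivAt (fun r : ℝ => 1 + r ^ 2) (2 * r) r := by
        simpa using (hasDerivAt_pow 2 r).const_add 1
      convert! h1.sqrt (by positivity) using 1
      have : √(1 + r ^ 2) ≠ 0 := by positivity
      field_simp
    · exact hcont.intervalIntegrable _ _
  · exact (hcont.integrableOn_Icc).mono_set Set.Ioc_subset_Icc_self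
  · filter_upwards [ae_restrict_mem measurableSet_Ioc] with r hr
    have := hr.1
    positivity

/-- The region is star-shaped with radial function `ρ`. The hypotheses leave open whether the
boundary `r = ρ θ` belongs to it, since a single radius is a null set; thus open disks and closed
triangles are both covered. -/
theorem lintegral_gansDensity_polar {A : Set ℂ} (hA : MeasurableSet A) {a b : ℝ}
    (ha : -Real.pi < a) (hb : b < Real.pi) (ρ : ℝ → ℝ) (hρ : ∀ θ ∈ Set.Icc a b, 0 ≤ ρ θ)
    (h1 : ∀ r θ : ℝ, 0 < r → θ ∈ Set.Ioo (-Real.pi) Real.pi →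
      Complex.polarCoord.symm (r, θ) ∈ A → θ ∈ Set.Icc a b ∧ r ≤ ρ θ)
    (h2 : ∀ r θ : ℝ, 0 < r → θ ∈ Set.Icc a b → r < ρ θ → Complex.polarCoord.symm (r, θ) ∈ A) :
    ∫⁻ P in A, gansDensity P = ∫⁻ θ in Set.Icc a b, ENNReal.ofReal (√(1 + ρ θ ^ 2) - 1) := by
  have hsub : Set.Icc a b ⊆ Set.Ioo (-Real.pi) Real.pi := fun θ hθ =>
    ⟨ha.trans_le hθ.1, hθ.2.trans_lt hb⟩
  rw [← lintegral_indicator hA, ← Complex.lintegral_comp_polarCoord_symm, polarCoord_target,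
    Measure.volume_eq_prod, ← Measure.prod_restrict, lintegral_prod_symm]
  · rw [← lintegral_indicator measurableSet_Icc,
      ← lintegral_indicator measurableSet_Ioo]
    congr 1
    funext θ
    by_cases hθ : θ ∈ Set.Ioo (-Real.pi) Real.pi
    · rw [Set.indicator_of_mem hθ]
      by_cases hθ' : θ ∈ Set.Icc a b
      · rw [Set.indicator_of_mem hθ', ← lintegral_Ioc_radial (hρ θ hθ'),
          ← lintegral_indicator measurableSet_Ioi, ← lintegral_indicator measurableSet_Ioc]
        refine lintegral_congr_ae ?_
        have : ∀ᵐ r : ℝ, r ≠ ρ θ := by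
          simp [ae_iff, measure_singleton]
        filter_upwards [this] with r hr
        by_cases hr0 : 0 < r
        · rw [Set.indicator_of_mem (by exact hr0)]
          by_cases hrρ : r < ρ θ
          · rw [Set.indicator_of_mem (h2 r θ hr0 hθ' hrρ), Set.indicator_of_mem (show r ∈ Set.Ioc 0 (ρ θ) from ⟨hr0, hrρ.le⟩),
              gansDensity, Complex.norm_polarCoord_symm, smul_eq_mul, ← ENNReal.ofReal_mul hr0.le,
              sq_abs]
          · rw [Set.indicator_of_notMem, Set.indicator_of_notMem, smul_zero]
            · exact fun h => hrρ (lt_of_le_of_ne h.2 hr)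
            · exact fun h => hrρ (lt_of_le_of_ne (h1 r θ hr0 hθ h).2 hr)
        · rw [Set.indicator_of_notMem (by exact hr0), Set.indicator_of_notMem]
          exact fun h => hr0 h.1
      · rw [Set.indicator_of_notMem hθ', ← lintegral_indicator measurableSet_Ioi]
        rw [lintegral_eq_zero_iff']
        · filter_upwards with r
          by_cases hr0 : 0 < r
          · rw [Set.indicator_of_mem (by exact hr0), Set.indicator_of_notMem, smul_zero]
            · rfl
            · exact fun h => hθ' (h1 r θ hr0 hθ h).1
          · rw [Set.indicator_of_notMem (by exact hr0)]; rfl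
        · refine Measurable.aemeasurable ?_
          refine Measurable.indicator ?_ measurableSet_Ioi
          simp only [smul_eq_mul]
          refine Measurable.mul (by fun_prop) ?_
          refine (measurable_gansDensity.indicator hA).comp ?_
          have : (fun r : ℝ => Complex.polarCoord.symm (r, θ)) =
              fun r : ℝ => (r : ℂ) * (Real.cos θ + Real.sin θ * Complex.I) := by
            funext r; simp
          rw [this]; fun_prop
    · rw [Set.indicator_of_notMem hθ, Set.indicator_of_notMem (fun h => hθ (hsub h))]
  · refine Measurable.aemeasurable ?_
    simp only [smul_eq_mul]
    refine Measurable.mul (by fun_prop) ?_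
    refine (measurable_gansDensity.indicator hA).comp ?_
    have : (Complex.polarCoord.symm : ℝ × ℝ → ℂ) =
        fun p => (p.1 : ℂ) * (Real.cos p.2 + Real.sin p.2 * Complex.I) := by
      funext r; simp
    rw [this]; fun_prop

/-- The chart at `x` rotated by the unit complex number `c`. -/
theorem volume_preimage_rotated_gans (x : ℍ) {c : ℂ} (hc : ‖c‖ = 1) {A : Set ℂ}
    (hA : MeasurableSet A) :
    volume ((fun p => c * gans x p) ⁻¹' A) = ∫⁻ P in A, gansDensity P :=
  volume_preimage_of_norm_preserving x
    (rotation ⟨c, by simpa [Submonoid.unitSphere, mem_sphere_zero_iff_norm] using hc⟩) hA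

theorem polarCoord_symm_re (r θ : ℝ) :
    (Complex.polarCoord.symm (r, θ)).re = r * Real.cos θ := by
  simp [Complex.polarCoord_symm_apply, ← Complex.ofReal_cos, ← Complex.ofReal_sin]

theorem polarCoord_symm_im (r θ : ℝ) :
    (Complex.polarCoord.symm (r, θ)).im = r * Real.sin θ := by
  simp [Complex.polarCoord_symm_apply, ← Complex.ofReal_cos, ← Complex.ofReal_sin]

/-! ### Polar angles in the right half-plane -/

/-- The polar angle of a point of the open right half plane. -/
def halfAngle (P : ℂ) : ℝ := Real.arctan (P.im / P.re)

theorem halfAngle_mem (P : ℂ) : halfAngle P ∈ Set.Ioo (-(Real.pi / 2)) (Real.pi / 2) :=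
  Real.arctan_mem_Ioo _

theorem halfAngle_polar {r θ : ℝ} (hr : 0 < r)
    (hθ : θ ∈ Set.Ioo (-(Real.pi / 2)) (Real.pi / 2)) :
    halfAngle (Complex.polarCoord.symm (r, θ)) = θ := by
  rw [halfAngle, polarCoord_symm_re, polarCoord_symm_im, mul_div_mul_left _ _ hr.ne',
    ← Real.tan_eq_sin_div_cos, Real.arctan_tan hθ.1 hθ.2]

theorem polar_halfAngle {P : ℂ} (hP : 0 < P.re) :
    Complex.polarCoord.symm (‖P‖, halfAngle P) = P := by
  have h0 : 0 < ‖P‖ := norm_pos_iff.2 fun h => by simp [h] at hP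
  have h1 : √(1 + (P.im / P.re) ^ 2) = ‖P‖ / P.re := by
    rw [Real.sqrt_eq_iff_eq_sq (by positivity) (by positivity), div_pow, div_pow, Complex.sq_norm,
      Complex.normSq_apply]
    field_simp
  apply Complex.ext
  · rw [polarCoord_symm_re, halfAngle, Real.cos_arctan, h1]; field_simp
  · rw [polarCoord_symm_im, halfAngle, Real.sin_arctan, h1]; field_simp

theorem re_eq_cos_halfAngle {P : ℂ} (hP : 0 < P.re) : P.re = ‖P‖ * Real.cos (halfAngle P) := by
  conv_lhs => rw [← polar_halfAngle hP, polarCoord_symm_re]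

theorem im_eq_sin_halfAngle {P : ℂ} (hP : 0 < P.re) : P.im = ‖P‖ * Real.sin (halfAngle P) := by
  conv_lhs => rw [← polar_halfAngle hP, polarCoord_symm_im]

theorem halfAngle_le_iff {P Q : ℂ} (hP : 0 < P.re) (hQ : 0 < Q.re) :
    halfAngle P ≤ halfAngle Q ↔ P.im * Q.re ≤ Q.im * P.re := by
  rw [halfAngle, halfAngle, Real.arctan_le_arctan_iff, div_le_div_iff₀ hP hQ]

theorem halfAngle_lt_iff {P Q : ℂ} (hP : 0 < P.re) (hQ : 0 < Q.re) :
    halfAngle P < halfAngle Q ↔ P.im * Q.re < Q.im * P.re := by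
  rw [halfAngle, halfAngle, Real.arctan_lt_arctan_iff, div_lt_div_iff₀ hP hQ]

/-- In the right half-plane polar angles are plain arctangents and differ by less than `π`, so
`arccos` recovers the absolute difference from its cosine. -/
theorem hypAngle_eq_halfAngle {x y z : ℍ} {c : ℂ} (hc : ‖c‖ = 1) (hy : 0 < (c * gans x y).re)
    (hz : 0 < (c * gans x z).re) :
    hypAngle x y z = |halfAngle (c * gans x y) - halfAngle (c * gans x z)| := by
  have hcc : c * (starRingEnd ℂ) c = 1 := by
    rw [Complex.mul_conj, Complex.normSq_eq_norm_sq, hc]; simp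
  have h1 : (gans x y * (starRingEnd ℂ) (gans x z)).re =
      ((c * gans x y) * (starRingEnd ℂ) (c * gans x z)).re := by
    rw [map_mul, show c * gans x y * ((starRingEnd ℂ) c * (starRingEnd ℂ) (gans x z)) =
      (c * (starRingEnd ℂ) c) * (gans x y * (starRingEnd ℂ) (gans x z)) by ring, hcc, one_mul]
  have hny : ‖c * gans x y‖ = Real.sinh (dist x y) := by rw [norm_mul, hc, one_mul, norm_gans]
  have hnz : ‖c * gans x z‖ = Real.sinh (dist x z) := by rw [norm_mul, hc, one_mul, norm_gans]
  have hy0 : 0 < ‖c * gans x y‖ := norm_pos_iff.2 fun h => by simp [h] at hy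
  have hz0 : 0 < ‖c * gans x z‖ := norm_pos_iff.2 fun h => by simp [h] at hz
  have hsub : Real.cosh (dist x y) * Real.cosh (dist x z) - Real.cosh (dist y z) =
      (gans x y * (starRingEnd ℂ) (gans x z)).re := by
    rw [cosh_dist_gans x y z]; ring
  rw [hypAngle, hsub, h1, ← hny, ← hnz]
  set P := c * gans x y
  set Q := c * gans x z
  have h2 : (P * (starRingEnd ℂ) Q).re / (‖P‖ * ‖Q‖) =
      Real.cos |halfAngle P - halfAngle Q| := by
    rw [Real.cos_abs, Real.cos_sub, Complex.mul_re, Complex.conj_re, Complex.conj_im,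
      re_eq_cos_halfAngle hy, re_eq_cos_halfAngle hz, im_eq_sin_halfAngle hy,
      im_eq_sin_halfAngle hz]
    field_simp
    ring
  have hP := halfAngle_mem P
  have hQ := halfAngle_mem Q
  rw [h2, Real.arccos_cos (abs_nonneg _)]
  rw [abs_le]
  constructor <;> linarith [hP.1, hP.2, hQ.1, hQ.2]

theorem mem_Ioo_of_cos_pos {θ : ℝ} (hθ : θ ∈ Set.Ioo (-Real.pi) Real.pi) (hcos : 0 < Real.cos θ) :
    θ ∈ Set.Ioo (-(Real.pi / 2)) (Real.pi / 2) := by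
  have hpi := Real.pi_pos
  by_contra hcon
  rw [Set.mem_Ioo, not_and_or, not_lt, not_lt] at hcon
  rcases hcon with h | h
  · have := Real.cos_nonpos_of_pi_div_two_le_of_le (x := -θ) (by linarith)
      (by linarith [hθ.1])
    rw [Real.cos_neg] at this
    linarith
  · have := Real.cos_nonpos_of_pi_div_two_le_of_le (x := θ) h (by linarith [hθ.2])
    linarith

/-- The area of a circular sector. -/
theorem volume_sector_region (x : ℍ) {c : ℂ} (hc : ‖c‖ = 1) {a b R : ℝ} (hR : 0 ≤ R)
    (hab : a ≤ b) (ha : -(Real.pi / 2) < a) (hb : b < Real.pi / 2) :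
    volume {p | dist p x < R ∧ 0 < (c * gans x p).re ∧
      halfAngle (c * gans x p) ∈ Set.Icc a b} =
      ENNReal.ofReal ((Real.cosh R - 1) * (b - a)) := by
  have hpi := Real.pi_pos
  set A : Set ℂ := {P | ‖P‖ < Real.sinh R ∧ 0 < P.re ∧ halfAngle P ∈ Set.Icc a b} with hAdef
  have hA : MeasurableSet A := by
    refine (measurableSet_lt measurable_norm measurable_const).inter
      ((measurableSet_lt measurable_const Complex.measurable_re).inter ?_)
    have : Measurable halfAngle := by unfold halfAngle; fun_prop
    exact this measurableSet_Icc
  have h1 : {p | dist p x < R ∧ 0 < (c * gans x p).re ∧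
      halfAngle (c * gans x p) ∈ Set.Icc a b} = (fun p => c * gans x p) ⁻¹' A := by
    ext p
    simp only [Set.mem_ofPred_eq, hAdef, Set.mem_preimage, norm_mul, hc, one_mul, norm_gans,
      Real.sinh_lt_sinh, dist_comm x p]
  rw [h1, volume_preimage_rotated_gans x hc hA, lintegral_gansDensity_polar hA (a := a) (b := b)
    (by linarith) (by linarith) (fun _ => Real.sinh R)]
  · rw [setLIntegral_const, Real.volume_Icc, mul_comm, mul_comm (Real.cosh R - 1),
      ENNReal.ofReal_mul (by linarith)]
    congr 3
    rw [← Real.cosh_sq', Real.sqrt_sq (Real.cosh_pos R).le]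
  · exact fun _ _ => Real.sinh_nonneg_iff.2 hR
  · intro r θ hr hθ hmem
    obtain ⟨h1, h2, h3⟩ := hmem
    rw [polarCoord_symm_re] at h2
    have hcos : 0 < Real.cos θ := pos_of_mul_pos_right h2 hr.le
    have hθ' := mem_Ioo_of_cos_pos hθ hcos
    rw [halfAngle_polar hr hθ'] at h3
    rw [Complex.norm_polarCoord_symm, abs_of_pos hr] at h1
    exact ⟨h3, h1.le⟩
  · intro r θ hr hθ hlt
    have hθ' : θ ∈ Set.Ioo (-(Real.pi / 2)) (Real.pi / 2) :=
      ⟨ha.trans_le hθ.1, hθ.2.trans_lt hb⟩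
    refine ⟨?_, ?_, ?_⟩
    · rwa [Complex.norm_polarCoord_symm, abs_of_pos hr]
    · rw [polarCoord_symm_re]
      exact mul_pos hr (Real.cos_pos_of_mem_Ioo hθ')
    · rwa [halfAngle_polar hr hθ']

end

section
open MeasureTheory

/-! ### The area of a triangle -/

/-- A two-by-two linear system, normalized. With `p0`, `q0` the hyperbolic cosines of two sides of a
triangle, `c` rotates the perpendicular from the vertex `x` to the line `y z` onto the positive real
axis, and `d` is the hyperbolic tangent of its length. -/
theorem exists_foot {P Q : ℂ} (h : P.re * Q.im - P.im * Q.re ≠ 0) {p0 q0 : ℝ} (hp : 0 < p0) :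
    ∃ (c : ℂ) (d : ℝ), ‖c‖ = 1 ∧ 0 < d ∧ (c * P).re = d * p0 ∧ (c * Q).re = d * q0 := by
  set D := P.re * Q.im - P.im * Q.re with hD
  let c' : ℂ := ⟨(p0 * Q.im - q0 * P.im) / D, (p0 * Q.re - q0 * P.re) / D⟩
  have h1 : (c' * P).re = p0 := by
    simp only [Complex.mul_re, c']; field_simp; rw [hD]; ring
  have h2 : (c' * Q).re = q0 := by
    simp only [Complex.mul_re, c']; field_simp; rw [hD]; ring
  have hc : c' ≠ 0 := fun h0 => by rw [h0] at h1; simp at h1; exact hp.ne h1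
  have hn : 0 < ‖c'‖ := norm_pos_iff.2 hc
  have hmul : ∀ Z : ℂ, (((‖c'‖⁻¹ : ℝ) : ℂ) * c' * Z).re = ‖c'‖⁻¹ * (c' * Z).re := fun Z => by
    rw [mul_assoc, Complex.re_ofReal_mul]
  refine ⟨((‖c'‖⁻¹ : ℝ) : ℂ) * c', ‖c'‖⁻¹, ?_, inv_pos.2 hn, ?_, ?_⟩
  · rw [norm_mul, Complex.norm_real, norm_inv, norm_norm, inv_mul_cancel₀ hn.ne']
  · rw [hmul, h1]
  · rw [hmul, h2]

theorem mem_geodesicHull_triple {x y z q : ℍ} (hxy : x ≠ y) (hxz : x ≠ z) (hyz : y ≠ z) :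
    q ∈ geodesicHull {x, y, z} ↔ ∃ s t r : ℝ, 0 ≤ s ∧ 0 ≤ t ∧ 0 ≤ r ∧
      lorentzVec q = s • lorentzVec x + t • lorentzVec y + r • lorentzVec z := by
  classical
  have h := mem_geodesicHull_finset (X := {x, y, z}) (q := q)
  have hsum : ∀ t : ℍ → ℝ, ∑ w ∈ ({x, y, z} : Finset ℍ), t w • lorentzVec w =
      t x • lorentzVec x + t y • lorentzVec y + t z • lorentzVec z := fun t => by
    rw [Finset.sum_insert (by simp [hxy, hxz]), Finset.sum_insert (by simp [hyz]),
      Finset.sum_singleton, add_assoc]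
  simp only [hsum, Finset.coe_insert, Finset.coe_singleton, Finset.mem_insert,
    Finset.mem_singleton, forall_eq_or_imp, forall_eq] at h
  rw [h]
  constructor
  · rintro ⟨t, ⟨h1, h2, h3⟩, h4⟩
    exact ⟨_, _, _, h1, h2, h3, h4⟩
  · rintro ⟨s, t, r, h1, h2, h3, h4⟩
    refine ⟨fun w => if w = x then s else if w = y then t else r, ?_, ?_⟩
    · simp [hxy.symm, hxz.symm, hyz.symm, h1, h2, h3]
    · simpa [hxy.symm, hxz.symm, hyz.symm] using h4

/-- Cramer's rule in the plane, for vectors of the hyperboloid. -/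
theorem lorentzVec_eq_combo {x y z : ℍ} {c : ℂ} (hc : c ≠ 0)
    (hD : (c * gans x y).re * (c * gans x z).im - (c * gans x y).im * (c * gans x z).re ≠ 0)
    (q : ℍ) : ∃ s t r : ℝ, lorentzVec q = s • lorentzVec x + t • lorentzVec y + r • lorentzVec z ∧
      t * ((c * gans x y).re * (c * gans x z).im - (c * gans x y).im * (c * gans x z).re) =
        (c * gans x q).re * (c * gans x z).im - (c * gans x q).im * (c * gans x z).re ∧
      r * ((c * gans x y).re * (c * gans x z).im - (c * gans x y).im * (c * gans x z).re) =
        (c * gans x y).re * (c * gans x q).im - (c * gans x y).im * (c * gans x q).re := by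
  set P := c * gans x y with hP
  set Q := c * gans x z with hQ
  set Z := c * gans x q with hZ
  set D := P.re * Q.im - P.im * Q.re with hDdef
  set t := (Z.re * Q.im - Z.im * Q.re) / D with ht
  set r := (P.re * Z.im - P.im * Z.re) / D with hr
  have hcomb : Z = t * P + r * Q := by
    apply Complex.ext
    · simp only [Complex.add_re, Complex.re_ofReal_mul, ht, hr]; field_simp; rw [hDdef]; ring
    · simp only [Complex.add_im, Complex.im_ofReal_mul, ht, hr]; field_simp; rw [hDdef]; ring
  have hcomb' : gans x q = t * gans x y + r * gans x z := by
    apply mul_left_cancel₀ hc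
    rw [← hZ, hcomb, hP, hQ]; ring
  refine ⟨lorentzForm (lorentzVec x) (lorentzVec q) - t * lorentzForm (lorentzVec x) (lorentzVec y)
    - r * lorentzForm (lorentzVec x) (lorentzVec z), t, r, ?_, ?_, ?_⟩
  · refine lorentzVec_ext x ?_ ?_
    · simp only [map_add, map_smul, lorentzForm_self, smul_eq_mul]; ring
    · change gans x q = _
      simp only [map_add, map_smul]
      have h0 : tangentProj x (lorentzVec x) = 0 := gans_self x
      rw [h0, hcomb']; simp [gans]
  · rw [ht, div_mul_cancel₀ _ hD]
  · rw [hr, div_mul_cancel₀ _ hD]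

/-- Each condition on the right is the sign of a coefficient. Those of `y` and `z` give the two
angle bounds; that of `x` gives the last inequality, because the linear form `d * cosh (dist x q) -
(c * gans x q).re` vanishes at `y` and `z` and equals `d` at `x`. -/
theorem mem_triangle_iff {x y z q : ℍ} {c : ℂ} (hc : ‖c‖ = 1) {d : ℝ} (hd : 0 < d)
    (hy : (c * gans x y).re = d * Real.cosh (dist x y))
    (hz : (c * gans x z).re = d * Real.cosh (dist x z))
    (hlt : halfAngle (c * gans x y) < halfAngle (c * gans x z)) :
    q ∈ geodesicHull {x, y, z} \ {x} ↔ 0 < (c * gans x q).re ∧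
      halfAngle (c * gans x q) ∈ Set.Icc (halfAngle (c * gans x y)) (halfAngle (c * gans x z)) ∧
      (c * gans x q).re ≤ d * Real.cosh (dist x q) := by
  have hy0 : 0 < (c * gans x y).re := by rw [hy]; positivity
  have hz0 : 0 < (c * gans x z).re := by rw [hz]; positivity
  have hD := (halfAngle_lt_iff hy0 hz0).1 hlt
  have hc0 : c ≠ 0 := fun h => by simp [h] at hc
  have hxy : x ≠ y := by rintro rfl; simp at hy0
  have hxz : x ≠ z := by rintro rfl; simp at hz0
  have hyz : y ≠ z := by rintro rfl; exact hlt.ne rfl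
  obtain ⟨s, t, r, hq, ht, hr⟩ := lorentzVec_eq_combo (x := x) (y := y) (z := z) hc0
    (by linarith) q
  have key : ∀ s t r : ℝ, lorentzVec q = s • lorentzVec x + t • lorentzVec y + r • lorentzVec z →
      gans x q = t • gans x y + r • gans x z ∧
      Real.cosh (dist x q) = s + t * Real.cosh (dist x y) + r * Real.cosh (dist x z) := by
    intro s t r h
    refine ⟨?_, ?_⟩
    · rw [gans, h]; simp only [map_add, map_smul]
      have h0 : tangentProj x (lorentzVec x) = 0 := gans_self x
      rw [h0, smul_zero, zero_add]; rfl
    · simp only [cosh_dist_eq, h, map_add, map_smul, lorentzForm_self, smul_eq_mul, mul_one]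
  have hre : ∀ t r : ℝ, gans x q = t • gans x y + r • gans x z →
      (c * gans x q).re = t * (c * gans x y).re + r * (c * gans x z).re ∧
      (c * gans x q).im = t * (c * gans x y).im + r * (c * gans x z).im := by
    intro t r h
    rw [h, show c * (t • gans x y + r • gans x z) = t * (c * gans x y) + r * (c * gans x z) by
      simp only [Complex.real_smul]; ring]
    simp only [Complex.add_re, Complex.add_im, Complex.re_ofReal_mul, Complex.im_ofReal_mul,
      and_self]
  constructor
  · rintro ⟨hmem, hne⟩
    obtain ⟨s, t, r, hs, ht, hr, h⟩ := (mem_geodesicHull_triple hxy hxz hyz).1 hmem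
    obtain ⟨h1, h2⟩ := key s t r h
    obtain ⟨h3, h4⟩ := hre t r h1
    have hpos : 0 < (c * gans x q).re := by
      rw [h3]
      rcases ht.eq_or_lt with rfl | ht
      · rcases hr.eq_or_lt with rfl | hr
        · exact absurd (gans_eq_zero_iff.1 (by rw [h1]; simp)) hne
        · have := mul_pos hr hz0; linarith
      · have := mul_pos ht hy0
        have := mul_nonneg hr hz0.le
        linarith
    refine ⟨hpos, ⟨?_, ?_⟩, ?_⟩
    · rw [halfAngle_le_iff hy0 hpos, h3, h4]; nlinarith
    · rw [halfAngle_le_iff hpos hz0, h3, h4]; nlinarith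
    · rw [h3, h2, hy, hz]; nlinarith
  · rintro ⟨hpos, ⟨ha, hb⟩, hle⟩
    rw [halfAngle_le_iff hy0 hpos] at ha
    rw [halfAngle_le_iff hpos hz0] at hb
    obtain ⟨h1, h2⟩ := key s t r hq
    obtain ⟨h3, h4⟩ := hre t r h1
    refine ⟨(mem_geodesicHull_triple hxy hxz hyz).2 ⟨s, t, r, ?_, ?_, ?_, hq⟩, ?_⟩
    · rw [h3, h2, hy, hz] at hle
      by_contra hs
      nlinarith
    · by_contra h; nlinarith
    · by_contra h; nlinarith
    · rintro rfl
      simp at hpos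

/-- The auxiliary side-angle relation in a triangle, in terms of the foot of the perpendicular. -/
theorem hypAngle_eq_arccos {x y z : ℍ} {c : ℂ} (hc : ‖c‖ = 1) {d : ℝ} (hd : 0 < d) (hd1 : d < 1)
    (hy : (c * gans x y).re = d * Real.cosh (dist x y))
    (hz : (c * gans x z).re = d * Real.cosh (dist x z))
    (hlt : halfAngle (c * gans x y) < halfAngle (c * gans x z)) :
    hypAngle y x z = Real.arccos (-(Real.sin (halfAngle (c * gans x y)) / √(1 - d ^ 2))) ∧
    hypAngle z x y = Real.arccos (Real.sin (halfAngle (c * gans x z)) / √(1 - d ^ 2)) := by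
  have hy0 : 0 < (c * gans x y).re := by rw [hy]; positivity
  have hz0 : 0 < (c * gans x z).re := by rw [hz]; positivity
  have hD := (halfAngle_lt_iff hy0 hz0).1 hlt
  have hs2 : √(1 - d ^ 2) ^ 2 = 1 - d ^ 2 := Real.sq_sqrt (by nlinarith)
  have hs0 : 0 < √(1 - d ^ 2) := Real.sqrt_pos.2 (by nlinarith)
  have hcc : c * (starRingEnd ℂ) c = 1 := by
    rw [Complex.mul_conj, Complex.normSq_eq_norm_sq, hc]; simp
  have hC := cosh_dist_gans x y z
  have h1 : (gans x y * (starRingEnd ℂ) (gans x z)).re =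
      ((c * gans x y) * (starRingEnd ℂ) (c * gans x z)).re := by
    rw [map_mul, show c * gans x y * ((starRingEnd ℂ) c * (starRingEnd ℂ) (gans x z)) =
      (c * (starRingEnd ℂ) c) * (gans x y * (starRingEnd ℂ) (gans x z)) by ring, hcc, one_mul]
  have hny : ‖c * gans x y‖ = Real.sinh (dist x y) := by rw [norm_mul, hc, one_mul, norm_gans]
  have hnz : ‖c * gans x z‖ = Real.sinh (dist x z) := by rw [norm_mul, hc, one_mul, norm_gans]
  have hy1 : 0 < ‖c * gans x y‖ := norm_pos_iff.2 fun h => by simp [h] at hy0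
  have hz1 : 0 < ‖c * gans x z‖ := norm_pos_iff.2 fun h => by simp [h] at hz0
  have ey := im_eq_sin_halfAngle hy0
  have ez := im_eq_sin_halfAngle hz0
  have ny : ‖c * gans x y‖ ^ 2 = (c * gans x y).re ^ 2 + (c * gans x y).im ^ 2 := by
    rw [Complex.sq_norm, Complex.normSq_apply]; ring
  have nz : ‖c * gans x z‖ ^ 2 = (c * gans x z).re ^ 2 + (c * gans x z).im ^ 2 := by
    rw [Complex.sq_norm, Complex.normSq_apply]; ring
  rw [h1, Complex.mul_re, Complex.conj_re, Complex.conj_im] at hC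
  have cy := Real.cosh_sq' (dist x y)
  have cz := Real.cosh_sq' (dist x z)
  have cD := Real.cosh_sq' (dist y z)
  rw [← hny, ny] at cy
  rw [← hnz, nz] at cz
  rw [hypAngle, hypAngle, dist_comm z y, dist_comm y x, dist_comm z x, ← hny, ← hnz]
  have hP0 := Real.cosh_pos (dist x y)
  have hQ0 := Real.cosh_pos (dist x z)
  have hS0 : 0 ≤ Real.sinh (dist y z) := Real.sinh_nonneg_iff.2 dist_nonneg
  rw [hy] at cy hC hD
  rw [hz] at cz hC hD
  set p := ‖c * gans x y‖
  set q := ‖c * gans x z‖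
  set a := (c * gans x y).im
  set b := (c * gans x z).im
  set P0 := Real.cosh (dist x y)
  set Q0 := Real.cosh (dist x z)
  set C := Real.cosh (dist y z)
  set σ := Real.sinh (dist y z)
  set s := √(1 - d ^ 2)
  set φ := halfAngle (c * gans x y)
  set ψ := halfAngle (c * gans x z)
  have ca : s ^ 2 * P0 ^ 2 = 1 + a ^ 2 := by rw [hs2]; linarith
  have cb : s ^ 2 * Q0 ^ 2 = 1 + b ^ 2 := by rw [hs2]; linarith
  have hC' : C = s ^ 2 * P0 * Q0 - a * b := by rw [hs2, hC]; ring
  have hpos : 0 < P0 * b - Q0 * a := by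
    by_contra h; nlinarith
  -- If `u` is signed arclength along the side measured from the foot, the imaginary part is `sinh
  -- u` and `s * cosh (dist x ·)` is `cosh u`, so this is the subtraction formula for `sinh`.
  have hσ : σ = s * (P0 * b - Q0 * a) := by
    rw [← sq_eq_sq₀ hS0 (by positivity)]
    rw [hC'] at cD
    linear_combination -cD + s ^ 2 * Q0 ^ 2 * ca + (1 + a ^ 2) * cb - b ^ 2 * ca - a ^ 2 * cb
  have hσ0 : 0 < σ := by rw [hσ]; positivity
  constructor
  · congr 1
    rw [div_eq_iff (by positivity), hC', hσ]
    field_simp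
    linear_combination Q0 * ca - (P0 * b - Q0 * a) * ey
  · congr 1
    rw [div_eq_iff (by positivity), hC', hσ]
    field_simp
    linear_combination P0 * cb + (P0 * b - Q0 * a) * ez

theorem volume_singleton_eq_zero (x : ℍ) : volume ({x} : Set ℍ) = 0 := by
  have : ({x} : Set ℍ) = gans x ⁻¹' {0} := by
    ext p; simp [gans_eq_zero_iff]
  rw [this, volume_preimage_gans x (measurableSet_singleton _)]
  simp

/-- In polar coordinates about `x` the far side is `ρ θ = d / √(cos θ ^ 2 - d ^ 2)`. The radial
integral leaves `cos θ / √(cos θ ^ 2 - d ^ 2) - 1`, with primitive `arcsin (sin θ / √(1 - d ^ 2)) -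
θ`, and `hypAngle_eq_arccos` recognizes the two base angles in its end values. -/
theorem volume_triangle_of_foot {x y z : ℍ} {c : ℂ} (hc : ‖c‖ = 1) {d : ℝ} (hd : 0 < d)
    (hy : (c * gans x y).re = d * Real.cosh (dist x y))
    (hz : (c * gans x z).re = d * Real.cosh (dist x z))
    (hlt : halfAngle (c * gans x y) < halfAngle (c * gans x z)) :
    0 ≤ Real.pi - hypAngle x y z - hypAngle y x z - hypAngle z x y ∧
    volume (geodesicHull {x, y, z}) =
      ENNReal.ofReal (Real.pi - hypAngle x y z - hypAngle y x z - hypAngle z x y) := by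
  have hy0 : 0 < (c * gans x y).re := by rw [hy]; positivity
  have hz0 : 0 < (c * gans x z).re := by rw [hz]; positivity
  have hcos : ∀ w : ℍ, (c * gans x w).re = d * Real.cosh (dist x w) →
      d < Real.cos (halfAngle (c * gans x w)) := by
    intro w hw
    have hw0 : 0 < (c * gans x w).re := by rw [hw]; positivity
    have h1 := re_eq_cos_halfAngle hw0
    have hn : ‖c * gans x w‖ = Real.sinh (dist x w) := by rw [norm_mul, hc, one_mul, norm_gans]
    have hn0 : 0 < ‖c * gans x w‖ := norm_pos_iff.2 fun h => by simp [h] at hw0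
    rw [hw] at h1
    have h2 := Real.sinh_lt_cosh (dist x w)
    rw [← hn] at h2
    by_contra hcon
    nlinarith
  have hdy := hcos y hy
  have hdz := hcos z hz
  have hd1 : d < 1 := hdy.trans_le (Real.cos_le_one _)
  obtain ⟨e1, e2⟩ := hypAngle_eq_arccos hc hd hd1 hy hz hlt
  have e0 := hypAngle_eq_halfAngle hc hy0 hz0
  have hmem : ∀ q, q ∈ geodesicHull {x, y, z} \ {x} ↔ _ := fun q => mem_triangle_iff hc hd hy hz hlt
  have hay := halfAngle_mem (c * gans x y)
  have haz := halfAngle_mem (c * gans x z)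
  set a := halfAngle (c * gans x y)
  set b := halfAngle (c * gans x z)
  have hs2 : √(1 - d ^ 2) ^ 2 = 1 - d ^ 2 := Real.sq_sqrt (by nlinarith)
  have hs0 : 0 < √(1 - d ^ 2) := Real.sqrt_pos.2 (by nlinarith)
  set s := √(1 - d ^ 2)
  have hcosθ : ∀ θ ∈ Set.Icc a b, d < Real.cos θ := by
    intro θ hθ
    rcases le_total 0 θ with h | h
    · exact hdz.trans_le (Real.cos_le_cos_of_nonneg_of_le_pi h (by linarith [haz.2, Real.pi_pos])
        hθ.2)
    · rw [← Real.cos_neg]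
      rw [← Real.cos_neg] at hdy
      exact hdy.trans_le (Real.cos_le_cos_of_nonneg_of_le_pi (by linarith)
        (by linarith [hay.1, Real.pi_pos]) (by linarith [hθ.1]))
  set ρ : ℝ → ℝ := fun θ => d / √(Real.cos θ ^ 2 - d ^ 2) with hρ
  set A : Set ℂ := {P | 0 < P.re ∧ halfAngle P ∈ Set.Icc a b ∧ P.re ≤ d * √(1 + ‖P‖ ^ 2)} with hAdef
  have hA : MeasurableSet A := by
    refine (measurableSet_lt measurable_const Complex.measurable_re).inter (.inter ?_
      (measurableSet_le Complex.measurable_re (by fun_prop)))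
    have : Measurable halfAngle := by unfold halfAngle; fun_prop
    exact this measurableSet_Icc
  have hset : geodesicHull {x, y, z} \ {x} = (fun p => c * gans x p) ⁻¹' A := by
    ext q
    rw [hmem q]
    simp only [hAdef, Set.mem_preimage, Set.mem_ofPred_eq, norm_mul, hc, one_mul,
      ← cosh_dist_eq_sqrt]
  have hnull := volume_singleton_eq_zero x
  have hsq : ∀ θ ∈ Set.Icc a b, 0 < Real.cos θ ^ 2 - d ^ 2 := fun θ hθ => by
    have := hcosθ θ hθ
    nlinarith
  rw [← measure_diff_null hnull, hset, volume_preimage_rotated_gans x hc hA,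
    lintegral_gansDensity_polar hA (a := a) (b := b) (by linarith [hay.1, Real.pi_pos])
      (by linarith [haz.2, Real.pi_pos]) ρ]
  · have hval : ∀ θ ∈ Set.Icc a b, √(1 + ρ θ ^ 2) - 1 =
        Real.cos θ / √(Real.cos θ ^ 2 - d ^ 2) - 1 := by
      intro θ hθ
      have h1 := hsq θ hθ
      have h2 : 0 < Real.cos θ := hd.trans (hcosθ θ hθ)
      congr 1
      rw [Real.sqrt_eq_iff_eq_sq (by positivity) (by positivity), hρ]
      simp only [div_pow, Real.sq_sqrt h1.le]
      field_simp
      ring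
    have hpos : ∀ θ ∈ Set.Icc a b, 0 ≤ Real.cos θ / √(Real.cos θ ^ 2 - d ^ 2) - 1 := by
      intro θ hθ
      rw [← hval θ hθ, sub_nonneg, Real.one_le_sqrt]
      nlinarith [sq_nonneg (ρ θ)]
    have hcont : ContinuousOn (fun θ => Real.cos θ / √(Real.cos θ ^ 2 - d ^ 2) - 1)
        (Set.Icc a b) := by
      refine ContinuousOn.sub (ContinuousOn.div (by fun_prop) (by fun_prop) ?_) (by fun_prop)
      exact fun θ hθ => (Real.sqrt_pos.2 (hsq θ hθ)).ne'
    have hae : 0 ≤ᵐ[volume.restrict (Set.Icc a b)]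
        fun θ => Real.cos θ / √(Real.cos θ ^ 2 - d ^ 2) - 1 := by
      filter_upwards [ae_restrict_mem measurableSet_Icc] with θ hθ using hpos θ hθ
    rw [setLIntegral_congr_fun measurableSet_Icc
      (fun θ hθ => congrArg ENNReal.ofReal (hval θ hθ)),
      ← ofReal_integral_eq_lintegral_ofReal (hcont.integrableOn_Icc) hae]
    suffices hint : ∫ θ in Set.Icc a b, (Real.cos θ / √(Real.cos θ ^ 2 - d ^ 2) - 1) =
        Real.pi - hypAngle x y z - hypAngle y x z - hypAngle z x y from
      ⟨hint ▸ integral_nonneg_of_ae hae, congrArg _ hint⟩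
    rw [integral_Icc_eq_integral_Ioc, ← intervalIntegral.integral_of_le hlt.le,
      intervalIntegral.integral_eq_sub_of_hasDerivAt
        (f := fun θ => Real.arcsin (Real.sin θ / s) - θ)]
    · rw [e0, e1, e2, abs_of_neg (sub_neg.2 hlt), Real.arccos_neg, Real.arccos, Real.arccos]
      ring
    · rw [Set.uIcc_of_le hlt.le]
      intro θ hθ
      have h1 := hsq θ hθ
      have h2 : 0 < Real.cos θ := hd.trans (hcosθ θ hθ)
      have h3 := Real.sin_sq_add_cos_sq θ
      have habs : |Real.sin θ / s| < 1 := by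
        rw [← sq_lt_one_iff_abs_lt_one, div_pow, hs2, div_lt_one (by nlinarith)]
        nlinarith
      have h4 : HasDerivAt (fun θ => Real.sin θ / s) (Real.cos θ / s) θ :=
        (Real.hasDerivAt_sin θ).div_const s
      have h5 := (Real.hasDerivAt_arcsin (x := Real.sin θ / s) (abs_lt.1 habs).1.ne'
        (abs_lt.1 habs).2.ne).comp θ h4
      refine (h5.sub (hasDerivAt_id θ)).congr_deriv ?_
      congr 1
      have h6 : √(1 - (Real.sin θ / s) ^ 2) = √(Real.cos θ ^ 2 - d ^ 2) / s := by
        rw [Real.sqrt_eq_iff_eq_sq (by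
          have := sq_lt_one_iff_abs_lt_one _ |>.2 habs
          linarith) (by positivity), div_pow, div_pow, Real.sq_sqrt h1.le]
        field_simp
        rw [hs2]; linarith
      rw [h6]
      have : √(Real.cos θ ^ 2 - d ^ 2) ≠ 0 := (Real.sqrt_pos.2 h1).ne'
      field_simp
    · refine ContinuousOn.intervalIntegrable ?_
      rwa [Set.uIcc_of_le hlt.le]
  · intro θ hθ
    have h1 := hsq θ hθ
    simp only [hρ]; positivity
  · intro r θ hr hθ hmem
    obtain ⟨h1, h2, h3⟩ := hmem
    rw [polarCoord_symm_re] at h1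
    have hcos : 0 < Real.cos θ := pos_of_mul_pos_right h1 hr.le
    have hθ' : θ ∈ Set.Ioo (-(Real.pi / 2)) (Real.pi / 2) :=
      mem_Ioo_of_cos_pos hθ hcos
    rw [halfAngle_polar hr hθ'] at h2
    refine ⟨h2, ?_⟩
    have h4 := hsq θ h2
    rw [polarCoord_symm_re, Complex.norm_polarCoord_symm, sq_abs] at h3
    have h5 : (r * Real.cos θ) ^ 2 ≤ d ^ 2 * (1 + r ^ 2) := by
      have := pow_le_pow_left₀ h1.le h3 2
      rwa [mul_pow d, Real.sq_sqrt (by positivity)] at this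
    simp only [hρ]
    rw [le_div_iff₀ (Real.sqrt_pos.2 h4)]
    refine abs_le_of_sq_le_sq' ?_ hd.le |>.2
    rw [mul_pow, Real.sq_sqrt h4.le]
    nlinarith
  · intro r θ hr hθ hlt
    have hθ' : θ ∈ Set.Ioo (-(Real.pi / 2)) (Real.pi / 2) :=
      ⟨hay.1.trans_le hθ.1, hθ.2.trans_lt haz.2⟩
    have hc0 := Real.cos_pos_of_mem_Ioo hθ'
    have h4 := hsq θ hθ
    refine ⟨?_, ?_, ?_⟩
    · rw [polarCoord_symm_re]
      exact mul_pos hr hc0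
    · rwa [halfAngle_polar hr hθ']
    · rw [polarCoord_symm_re, Complex.norm_polarCoord_symm, sq_abs]
      simp only [hρ] at hlt
      rw [lt_div_iff₀ (Real.sqrt_pos.2 h4)] at hlt
      have h6 := pow_le_pow_left₀ (by positivity) hlt.le 2
      rw [mul_pow, Real.sq_sqrt h4.le] at h6
      refine abs_le_of_sq_le_sq' ?_ (by positivity) |>.2
      rw [mul_pow d, Real.sq_sqrt (by positivity)]
      nlinarith

theorem hypAngle_comm (x y z : ℍ) : hypAngle x y z = hypAngle x z y := by
  rw [hypAngle, hypAngle, dist_comm y z, mul_comm (Real.cosh _), mul_comm (Real.sinh _)]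

/-- The area of a hyperbolic triangle. -/
theorem volume_triangle {x y z : ℍ}
    (h : (gans x y).re * (gans x z).im - (gans x y).im * (gans x z).re ≠ 0) :
    0 ≤ Real.pi - hypAngle x y z - hypAngle y x z - hypAngle z x y ∧
    volume (geodesicHull {x, y, z}) =
      ENNReal.ofReal (Real.pi - hypAngle x y z - hypAngle y x z - hypAngle z x y) := by
  obtain ⟨c, d, hc, hd, hy, hz⟩ := exists_foot h (Real.cosh_pos (dist x y))
    (q0 := Real.cosh (dist x z))
  have hy0 : 0 < (c * gans x y).re := by rw [hy]; positivity
  have hz0 : 0 < (c * gans x z).re := by rw [hz]; positivity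
  rcases lt_trichotomy (halfAngle (c * gans x y)) (halfAngle (c * gans x z)) with h1 | h1 | h1
  · exact volume_triangle_of_foot hc hd hy hz h1
  · exfalso
    have a1 := (halfAngle_le_iff hy0 hz0).1 h1.le
    have a2 := (halfAngle_le_iff hz0 hy0).1 h1.ge
    have hcc : c.re ^ 2 + c.im ^ 2 = 1 := by
      have := Complex.sq_norm c
      rw [hc, Complex.normSq_apply] at this; linarith
    apply h
    simp only [Complex.mul_re, Complex.mul_im] at a1 a2
    linear_combination (-((gans x y).re * (gans x z).im - (gans x y).im * (gans x z).re)) * hcc +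
      (le_antisymm a2 a1)
  · have := volume_triangle_of_foot hc hd hz hy h1
    rw [hypAngle_comm x z y, sub_right_comm] at this
    rwa [show ({x, y, z} : Set ℍ) = {x, z, y} by rw [Set.pair_comm]]

end

section
open MeasureTheory

/-! ### Geodesic lines -/

theorem tangentProj_surjective (x : ℍ) : Function.Surjective (tangentProj x) := fun P => by
  obtain ⟨p, hp⟩ := exists_gans_eq x P
  exact ⟨_, hp⟩

theorem eq_smul_of_tangentProj_eq_zero {x : ℍ} {u : ℝ × ℝ × ℝ} (h : tangentProj x u = 0) :
    u = lorentzForm (lorentzVec x) u • lorentzVec x := by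
  refine lorentzVec_ext x ?_ ?_
  · simp [lorentzForm_self]
  · have h0 : tangentProj x (lorentzVec x) = 0 := gans_self x
    rw [h, map_smul, h0, smul_zero]

/-- A geodesic line has area zero. -/
theorem volume_line {l : ℝ × ℝ × ℝ →ₗ[ℝ] ℝ} (hl : l ≠ 0) : volume {q | l (lorentzVec q) = 0} = 0 := by
  rcases Set.eq_empty_or_nonempty {q | l (lorentzVec q) = 0} with h | ⟨x, hx⟩
  · rw [h, measure_empty]
  have hx : l (lorentzVec x) = 0 := hx
  -- The kernel of `tangentProj x` is spanned by `lorentzVec x`, which lies in `ker l`. If `ker l`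
  -- projected onto the whole plane it would be everything, so `W` is a proper subspace and a null
  -- set.
  set W : Submodule ℝ ℂ := (LinearMap.ker l).map (tangentProj x) with hW
  have hsub : {q | l (lorentzVec q) = 0} ⊆ gans x ⁻¹' (W : Set ℂ) := fun q hq =>
    Submodule.mem_map_of_mem (f := tangentProj x) (show lorentzVec q ∈ LinearMap.ker l from hq)
  refine measure_mono_null hsub ?_
  rw [volume_preimage_gans x W.closed_of_finiteDimensional.measurableSet]
  refine setLIntegral_measure_zero _ _ (Measure.addHaar_submodule _ W fun htop => hl ?_)
  refine LinearMap.ext fun u => ?_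
  have hmem : tangentProj x u ∈ W := htop ▸ Submodule.mem_top
  obtain ⟨k, hk, hku⟩ := Submodule.mem_map.1 hmem
  have h1 : tangentProj x (u - k) = 0 := by rw [map_sub, hku, sub_self]
  have h2 := congrArg l (eq_smul_of_tangentProj_eq_zero h1)
  rw [map_smul, hx, smul_zero, map_sub, LinearMap.mem_ker.1 hk, sub_zero] at h2
  exact h2

/-! ### Orientation of triples of points -/

/-- The signed area form of the vectors pointing from `a` to `b` and to a third point. -/
def orientForm (a b : ℍ) : ℝ × ℝ × ℝ →ₗ[ℝ] ℝ where
  toFun u := (gans a b).re * (tangentProj a u).im - (gans a b).im * (tangentProj a u).re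
  map_add' u w := by simp; ring
  map_smul' t u := by simp; ring

/-- The orientation of a triangle. -/
def orient (a b p : ℍ) : ℝ := orientForm a b (lorentzVec p)

theorem orient_def (a b p : ℍ) :
    orient a b p = (gans a b).re * (gans a p).im - (gans a b).im * (gans a p).re := rfl

/-- In these coordinates the cyclic and alternating symmetries, hidden by the choice of a base
point, become polynomial identities. -/
theorem orient_eq (a b p : ℍ) : orient a b p = (2 * a.im * b.im * p.im)⁻¹ *
    ((b.re - a.re) * (p.re ^ 2 + p.im ^ 2 - a.re ^ 2 - a.im ^ 2) -
      (p.re - a.re) * (b.re ^ 2 + b.im ^ 2 - a.re ^ 2 - a.im ^ 2)) := by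
  have h1 := a.im_ne_zero
  have h2 := b.im_ne_zero
  have h3 := p.im_ne_zero
  rw [orient_def, gans_eq, gans_eq]
  field_simp
  ring

theorem orient_rotate (a b p : ℍ) : orient a b p = orient b p a := by
  rw [orient_eq, orient_eq]; ring

theorem orient_swap (a b p : ℍ) : orient b a p = -orient a b p := by
  rw [orient_eq, orient_eq]; ring

theorem orient_swap_right (a b p : ℍ) : orient a p b = -orient a b p := by
  rw [orient_eq, orient_eq]; ring

@[simp] theorem orient_self_left (a b : ℍ) : orient a b a = 0 := by simp [orient_def]

@[simp] theorem orient_self_right (a b : ℍ) : orient a b b = 0 := by rw [orient_def]; ring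

/-- Vanishing means that the tangential parts at `a` are parallel; the remaining component along
`lorentzVec a` goes into `s`. -/
theorem eq_combo_of_orientForm_eq_zero {a b : ℍ} (hab : a ≠ b) {u : ℝ × ℝ × ℝ}
    (h : orientForm a b u = 0) : ∃ s t : ℝ, u = s • lorentzVec a + t • lorentzVec b := by
  have h' : (gans a b).re * (tangentProj a u).im - (gans a b).im * (tangentProj a u).re = 0 := h
  have hb : gans a b ≠ 0 := fun h => hab (gans_eq_zero_iff.1 h).symm
  obtain ⟨t, ht⟩ : ∃ t : ℝ, tangentProj a u = t * gans a b := by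
    by_cases hre : (gans a b).re = 0
    · have him : (gans a b).im ≠ 0 := fun h => hb (Complex.ext hre h)
      refine ⟨(tangentProj a u).im / (gans a b).im, Complex.ext ?_ ?_⟩
      · rw [hre, zero_mul, zero_sub, neg_eq_zero, mul_eq_zero, or_iff_right him] at h'
        simp [hre, h']
      · rw [Complex.im_ofReal_mul]; field_simp
    · refine ⟨(tangentProj a u).re / (gans a b).re, Complex.ext ?_ ?_⟩
      · rw [Complex.re_ofReal_mul]; field_simp
      · rw [Complex.im_ofReal_mul]; field_simp; linarith
  refine ⟨lorentzForm (lorentzVec a) u - t * lorentzForm (lorentzVec a) (lorentzVec b), t,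
    lorentzVec_ext a ?_ ?_⟩
  · simp only [map_add, map_smul, lorentzForm_self, smul_eq_mul]; ring
  · have h0 : tangentProj a (lorentzVec a) = 0 := gans_self a
    simp only [map_add, map_smul, h0, ht, smul_zero, zero_add, Complex.real_smul]; rfl

/-! ### Cyclic polygons -/

/-- The unit complex number rotating the direction from `x` to `v` to the positive real axis. -/
def rotor (v x : ℍ) : ℂ := (starRingEnd ℂ) (gans x v) / ‖gans x v‖

theorem norm_rotor {v x : ℍ} (h : v ≠ x) : ‖rotor v x‖ = 1 := by
  have : ‖gans x v‖ ≠ 0 := by rwa [Ne, norm_eq_zero, gans_eq_zero_iff]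
  rw [rotor, norm_div, Complex.norm_conj, Complex.norm_real, norm_norm, div_self this]

/-- The angle at `x` between the directions of `v` and `y`. -/
def vertexAngle (v x y : ℍ) : ℝ := halfAngle (rotor v x * gans x y)

theorem rotor_mul_re (v x y : ℍ) : ‖gans x v‖ * (rotor v x * gans x y).re =
    Real.cosh (dist x v) * Real.cosh (dist x y) - Real.cosh (dist v y) := by
  have h1 := cosh_dist_gans x v y
  rcases eq_or_ne (gans x v) 0 with h | h
  · rw [h] at h1 ⊢
    simp at h1 ⊢; linarith
  have hn : (‖gans x v‖ : ℂ) ≠ 0 := by exact_mod_cast norm_ne_zero_iff.2 h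
  rw [← Complex.re_ofReal_mul, rotor, ← mul_assoc, mul_div_cancel₀ _ hn, h1]
  simp only [Complex.mul_re, Complex.conj_re, Complex.conj_im]
  ring

/-- The real part is a positive multiple of `cosh ρ * (cosh (dist x y) - 1)`, where `ρ` is the
common distance. Seen from a vertex of a cyclic polygon, all other vertices thus lie in the open
half-plane facing the center, where `halfAngle` orders them. -/
theorem rotor_mul_re_pos {v x y : ℍ} (h : dist v x = dist v y) (hxy : y ≠ x) :
    0 < (rotor v x * gans x y).re := by
  have h1 := rotor_mul_re v x y
  rw [dist_comm x v, h] at h1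
  have h2 := Real.one_lt_cosh.2 (dist_ne_zero.2 hxy.symm)
  have h3 := Real.cosh_pos (dist v y)
  have h4 : 0 < ‖gans x v‖ * (rotor v x * gans x y).re := by rw [h1]; nlinarith
  exact pos_of_mul_pos_right h4 (norm_nonneg _)

theorem cross_mul_left {c : ℂ} (hc : ‖c‖ = 1) (P Q : ℂ) :
    (c * P).re * (c * Q).im - (c * P).im * (c * Q).re = P.re * Q.im - P.im * Q.re := by
  have hcc : c.re ^ 2 + c.im ^ 2 = 1 := by
    have := Complex.sq_norm c
    rw [hc, Complex.normSq_apply] at this; linarith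
  simp only [Complex.mul_re, Complex.mul_im]
  linear_combination (P.re * Q.im - P.im * Q.re) * hcc

theorem vertexAngle_le_iff {v x y z : ℍ} (hvx : v ≠ x) (hy : 0 < (rotor v x * gans x y).re)
    (hz : 0 < (rotor v x * gans x z).re) :
    vertexAngle v x y ≤ vertexAngle v x z ↔ 0 ≤ orient x y z := by
  rw [vertexAngle, vertexAngle, halfAngle_le_iff hy hz, orient_def,
    ← cross_mul_left (norm_rotor hvx), sub_nonneg, mul_comm (_ : ℝ) (rotor v x * gans x z).im]

/-- Three distinct points of a circle are not collinear. -/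
theorem orient_ne_zero {v x y z : ℍ} (hy : dist v y = dist v x) (hz : dist v z = dist v x)
    (hxy : x ≠ y) (hxz : x ≠ z) (hyz : y ≠ z) : orient x y z ≠ 0 := by
  intro h
  obtain ⟨s, t, hu⟩ := eq_combo_of_orientForm_eq_zero hxy (u := lorentzVec z) h
  -- Pairing with the center makes the coefficients sum to one; norm one then forces one of them to
  -- vanish.
  have h1 := congrArg (lorentzForm (lorentzVec v)) hu
  rw [dist_eq_dist_iff_lorentzForm] at hy hz
  have hpos := lorentzForm_pos v x
  simp only [map_add, map_smul, smul_eq_mul, hy, hz] at h1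
  have hst : s + t = 1 := by
    have : (s + t - 1) * lorentzForm (lorentzVec v) (lorentzVec x) = 0 := by linarith
    rcases mul_eq_zero.1 this with h | h
    · linarith
    · exact absurd h hpos.ne'
  have h2 := lorentzForm_self z
  have hxy1 := one_lt_lorentzForm hxy
  rw [hu] at h2
  simp only [map_add, map_smul, LinearMap.add_apply, LinearMap.smul_apply, lorentzForm_self,
    smul_eq_mul, lorentzForm_comm (lorentzVec y) (lorentzVec x)] at h2
  have hs : s = 1 - t := by linarith
  subst hs
  have h3 : t * (1 - t) * (lorentzForm (lorentzVec x) (lorentzVec y) - 1) = 0 := by linarith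
  rcases mul_eq_zero.1 h3 with h | h
  · rcases mul_eq_zero.1 h with h | h
    · apply hxz
      apply lorentzVec_injective
      rw [hu, h]; simp
    · apply hyz
      apply lorentzVec_injective
      have : t = 1 := by linarith
      rw [hu, this]; simp
  · linarith

theorem exists_extremal_vertices {v x : ℍ} {X : Finset ℍ} (h : ∃ w ∈ X, w ≠ x) :
    ∃ y ∈ X, ∃ z ∈ X, y ≠ x ∧ z ≠ x ∧ ∀ w ∈ X, w ≠ x →
      vertexAngle v x y ≤ vertexAngle v x w ∧ vertexAngle v x w ≤ vertexAngle v x z := by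
  classical
  have hne : (X.filter (· ≠ x)).Nonempty := by
    obtain ⟨w, hw, hwx⟩ := h
    exact ⟨w, Finset.mem_filter.2 ⟨hw, hwx⟩⟩
  obtain ⟨y, hy, hy'⟩ := Finset.exists_min_image _ (vertexAngle v x) hne
  obtain ⟨z, hz, hz'⟩ := Finset.exists_max_image _ (vertexAngle v x) hne
  rw [Finset.mem_filter] at hy hz
  exact ⟨y, hy.1, z, hz.1, hy.2, hz.2, fun w hw hwx =>
    ⟨hy' w (Finset.mem_filter.2 ⟨hw, hwx⟩), hz' w (Finset.mem_filter.2 ⟨hw, hwx⟩)⟩⟩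

theorem interiorAngle_eq {v x y z : ℍ} {X : Finset ℍ} {ρ : ℝ} (hρ : 0 < ρ)
    (hX : ∀ w ∈ X, dist v w = ρ) (hx : x ∈ X) (hy : y ∈ X) (hz : z ∈ X) (hyx : y ≠ x) (hzx : z ≠ x)
    (h : ∀ w ∈ X, w ≠ x → vertexAngle v x y ≤ vertexAngle v x w ∧
      vertexAngle v x w ≤ vertexAngle v x z) :
    interiorAngle X x = vertexAngle v x z - vertexAngle v x y := by
  have hvx : v ≠ x := fun h => by
    have := hX x hx; rw [h, dist_self] at this; exact hρ.ne this
  have hre : ∀ w ∈ X, w ≠ x → 0 < (rotor v x * gans x w).re := fun w hw hwx =>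
    rotor_mul_re_pos (by rw [hX x hx, hX w hw]) hwx
  have hang : ∀ w ∈ X, ∀ w' ∈ X, w ≠ x → w' ≠ x →
      hypAngle x w w' = |vertexAngle v x w - vertexAngle v x w'| := fun w hw w' hw' hwx hwx' =>
    hypAngle_eq_halfAngle (norm_rotor hvx) (hre w hw hwx) (hre w' hw' hwx')
  refine IsGreatest.csSup_eq ⟨⟨y, hy, z, hz, hyx, hzx, ?_⟩, ?_⟩
  · rw [hang y hy z hz hyx hzx, abs_sub_comm, abs_of_nonneg]
    exact sub_nonneg.2 (h y hy hyx).2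
  · rintro _ ⟨w, hw, w', hw', hwx, hwx', rfl⟩
    rw [hang w hw w' hw' hwx hwx', abs_le]
    have h1 := h w hw hwx
    have h2 := h w' hw' hwx'
    constructor <;> linarith

end

/-! ### Cutting cyclic polygons along diagonals -/

section
open MeasureTheory

theorem lorentzForm_circle {v : ℍ} {ρ : ℝ} {X : Finset ℍ} (hX : ∀ w ∈ X, dist v w = ρ)
    {w : ℍ} (hw : w ∈ X) : lorentzForm (lorentzVec v) (lorentzVec w) = Real.cosh ρ := by
  rw [← cosh_dist_eq, hX w hw]

/-- A point of a chord of a cyclic polygon lies on the corresponding side or diagonal. -/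
theorem chord_coeff_nonneg {v : ℍ} {ρ : ℝ} {X : Finset ℍ} (hX : ∀ w ∈ X, dist v w = ρ)
    {a b : ℍ} (hab : a ≠ b) (ha : a ∈ X) (hb : b ∈ X) {t : ℍ → ℝ} (ht : ∀ x ∈ X, 0 ≤ t x)
    {α β : ℝ} (h : ∑ x ∈ X, t x • lorentzVec x = α • lorentzVec a + β • lorentzVec b) :
    0 ≤ α := by
  by_contra hα
  push Not at hα
  have hc := Real.cosh_pos ρ
  -- Pairing with the center gives `∑ t = α + β`. Pairing with `b` turns the left side into at least
  -- `∑ t` and the right side into `α * cosh (dist b a) + β`, so `α` cannot be negative.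
  have h1 := congrArg (lorentzForm (lorentzVec v)) h
  have h2 := congrArg (lorentzForm (lorentzVec b)) h
  simp only [map_sum, map_add, map_smul, smul_eq_mul, lorentzForm_self] at h1 h2
  rw [Finset.sum_congr rfl (fun w hw => by rw [lorentzForm_circle hX hw]), ← Finset.sum_mul,
    lorentzForm_circle hX ha, lorentzForm_circle hX hb, ← add_mul] at h1
  have h3 := mul_right_cancel₀ hc.ne' h1
  have h4 : ∑ x ∈ X, t x ≤ ∑ x ∈ X, t x * lorentzForm (lorentzVec b) (lorentzVec x) :=
    Finset.sum_le_sum fun x hx => le_mul_of_one_le_right (ht x hx) (one_le_lorentzForm _ _)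
  have h5 := one_lt_lorentzForm hab.symm
  nlinarith

theorem chord_coeffs {v : ℍ} {ρ : ℝ} {X : Finset ℍ} (hX : ∀ w ∈ X, dist v w = ρ)
    {a b : ℍ} (hab : a ≠ b) (ha : a ∈ X) (hb : b ∈ X) {t : ℍ → ℝ} (ht : ∀ x ∈ X, 0 ≤ t x)
    (h : orientForm a b (∑ x ∈ X, t x • lorentzVec x) = 0) : ∃ α β : ℝ, 0 ≤ α ∧ 0 ≤ β ∧
      ∑ x ∈ X, t x • lorentzVec x = α • lorentzVec a + β • lorentzVec b := by
  obtain ⟨α, β, h1⟩ := eq_combo_of_orientForm_eq_zero hab h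
  exact ⟨α, β, chord_coeff_nonneg hX hab ha hb ht h1,
    chord_coeff_nonneg hX hab.symm hb ha ht (h1.trans (add_comm _ _)), h1⟩

/-- The vertices of a polygon on one side of a diagonal. -/
def leftPart (X : Finset ℍ) (a b : ℍ) : Finset ℍ := by
  classical exact X.filter (fun x => 0 ≤ orient a b x)

theorem mem_leftPart {X : Finset ℍ} {a b x : ℍ} :
    x ∈ leftPart X a b ↔ x ∈ X ∧ 0 ≤ orient a b x := by
  classical
  simp [leftPart]

theorem leftPart_subset (X : Finset ℍ) (a b : ℍ) : leftPart X a b ⊆ X := fun _ h =>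
  (mem_leftPart.1 h).1

/-- The vertices on the wrong side are removed by balancing them against a fraction `μ` of the left
ones. The balanced part lies on the line `a b`, hence by `chord_coeffs` is a nonnegative combination
of `a` and `b` alone. -/
theorem mem_hull_leftPart {v : ℍ} {ρ : ℝ} {X : Finset ℍ} (hX : ∀ w ∈ X, dist v w = ρ)
    {a b : ℍ} (hab : a ≠ b) (ha : a ∈ X) (hb : b ∈ X) {q : ℍ} (hq : q ∈ geodesicHull (X : Set ℍ))
    (hq0 : 0 ≤ orient a b q) : q ∈ geodesicHull (leftPart X a b : Set ℍ) := by
  classical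
  obtain ⟨t, ht, hqt⟩ := mem_geodesicHull_finset.1 hq
  set Y := leftPart X a b with hY
  have haY : a ∈ Y := mem_leftPart.2 ⟨ha, by simp⟩
  have hbY : b ∈ Y := mem_leftPart.2 ⟨hb, by simp⟩
  set A := ∑ x ∈ Y, t x * orient a b x with hA
  set B := ∑ x ∈ X \ Y, t x * orient a b x with hB
  have hsum : orient a b q = A + B := by
    rw [orient, hqt, map_sum, ← Finset.sum_sdiff (leftPart_subset X a b), add_comm]
    simp only [map_smul, smul_eq_mul]; rfl
  have hA0 : 0 ≤ A := Finset.sum_nonneg fun x hx =>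
    mul_nonneg (ht x (leftPart_subset _ _ _ hx)) (mem_leftPart.1 hx).2
  have hneg : ∀ x ∈ X \ Y, orient a b x < 0 := fun x hx => by
    rw [Finset.mem_sdiff] at hx
    by_contra h
    exact hx.2 (mem_leftPart.2 ⟨hx.1, not_lt.1 h⟩)
  have hB0 : ∀ x ∈ X \ Y, t x * orient a b x ≤ 0 := fun x hx =>
    mul_nonpos_of_nonneg_of_nonpos (ht x (Finset.mem_sdiff.1 hx).1) (hneg x hx).le
  -- the portion `μ` of the left part balances the right part
  obtain ⟨μ, hμ0, hμ1, hμ⟩ : ∃ μ : ℝ, 0 ≤ μ ∧ μ ≤ 1 ∧ μ * A + B = 0 := by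
    have hBle : B ≤ 0 := Finset.sum_nonpos hB0
    rcases hA0.eq_or_lt with h | h
    · exact ⟨0, le_rfl, zero_le_one, by linarith⟩
    · refine ⟨-B / A, div_nonneg (by linarith) h.le, (div_le_one h).2 (by linarith), ?_⟩
      field_simp; ring
  have ht' : ∀ x ∈ X, 0 ≤ (if x ∈ Y then μ * t x else t x) := fun x hx => by
    split_ifs
    · exact mul_nonneg hμ0 (ht x hx)
    · exact ht x hx
  have hsplit : ∑ x ∈ X, (if x ∈ Y then μ * t x else t x) • lorentzVec x =
      μ • ∑ x ∈ Y, t x • lorentzVec x + ∑ x ∈ X \ Y, t x • lorentzVec x := by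
    rw [← Finset.sum_sdiff (leftPart_subset X a b), add_comm, Finset.smul_sum]
    congr 1
    · exact Finset.sum_congr rfl fun x hx => by rw [if_pos hx, mul_smul]
    · exact Finset.sum_congr rfl fun x hx => by rw [if_neg (Finset.mem_sdiff.1 hx).2]
  obtain ⟨α, β, hα, hβ, hαβ⟩ := chord_coeffs hX hab ha hb ht' (by
    rw [hsplit, map_add, map_smul, map_sum, map_sum]
    simp only [map_smul, smul_eq_mul]
    exact hμ)
  have hfin : lorentzVec q = ∑ x ∈ Y, ((1 - μ) * t x + (if x = a then α else 0) +
      (if x = b then β else 0)) • lorentzVec x := by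
    simp only [add_smul, Finset.sum_add_distrib, ite_smul, zero_smul, Finset.sum_ite_eq', haY,
      hbY, if_true]
    rw [add_assoc, ← hαβ, hsplit, hqt, ← Finset.sum_sdiff (leftPart_subset X a b)]
    simp only [mul_smul, ← Finset.smul_sum]
    rw [← hY]
    module
  refine mem_geodesicHull_finset.2 ⟨_, fun x hx => ?_, hfin⟩
  have h1 := ht x (leftPart_subset _ _ _ hx)
  have h2 : 0 ≤ 1 - μ := by linarith
  have h3 : 0 ≤ if x = a then α else 0 := by split_ifs <;> [exact hα; exact le_rfl]
  have h4 : 0 ≤ if x = b then β else 0 := by split_ifs <;> [exact hβ; exact le_rfl]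
  positivity

theorem orient_nonneg_of_mem_hull {X : Finset ℍ} {a b q : ℍ} (h : ∀ x ∈ X, 0 ≤ orient a b x)
    (hq : q ∈ geodesicHull (X : Set ℍ)) : 0 ≤ orient a b q := by
  obtain ⟨t, ht, hqt⟩ := mem_geodesicHull_finset.1 hq
  rw [orient, hqt, map_sum]
  refine Finset.sum_nonneg fun x hx => ?_
  rw [map_smul]
  exact mul_nonneg (ht x hx) (h x hx)

theorem isCompact_geodesicHull {X : Set ℍ} (hX : X.Finite) : IsCompact (geodesicHull X) := by
  rw [geodesicHull_eq]
  refine isOpenEmbedding_klein.isInducing.isCompact_preimage' ?_ ?_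
  · exact Set.Finite.isCompact_convexHull (𝕜 := ℝ) (hX.image klein)
  · rw [range_klein]
    refine convexHull_min ?_ convex_kleinRegion
    rintro _ ⟨x, -, rfl⟩
    exact klein_mem x

/-- The two parts overlap only in the line through `a` and `b`, which is a null set. -/
theorem volume_hull_eq_add {v : ℍ} {ρ : ℝ} {X : Finset ℍ} (hX : ∀ w ∈ X, dist v w = ρ)
    {a b : ℍ} (hab : a ≠ b) (ha : a ∈ X) (hb : b ∈ X) :
    volume (geodesicHull (X : Set ℍ)) = volume (geodesicHull (leftPart X a b : Set ℍ)) +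
      volume (geodesicHull (leftPart X b a : Set ℍ)) := by
  have hU : geodesicHull (X : Set ℍ) = geodesicHull (leftPart X a b : Set ℍ) ∪
      geodesicHull (leftPart X b a : Set ℍ) := by
    apply Set.Subset.antisymm
    · intro q hq
      rcases le_total 0 (orient a b q) with h | h
      · exact Or.inl (mem_hull_leftPart hX hab ha hb hq h)
      · refine Or.inr (mem_hull_leftPart hX hab.symm hb ha hq ?_)
        rw [orient_swap]; linarith
    · exact Set.union_subset (geodesicHull_mono (leftPart_subset _ _ _))
        (geodesicHull_mono (leftPart_subset _ _ _))
  rw [hU]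
  refine measure_union₀ (isCompact_geodesicHull (Finset.finite_toSet _)).isClosed.measurableSet.nullMeasurableSet ?_
  have hne : orientForm a b ≠ 0 := by
    intro h
    have hb0 : gans a b ≠ 0 := fun h => hab (gans_eq_zero_iff.1 h).symm
    obtain ⟨u, hu⟩ := tangentProj_surjective a (Complex.I * gans a b)
    have h1 : (gans a b).re * (tangentProj a u).im - (gans a b).im * (tangentProj a u).re = 0 :=
      LinearMap.congr_fun h u
    rw [hu] at h1
    apply hb0
    rw [← norm_eq_zero, ← sq_eq_zero_iff, Complex.sq_norm, Complex.normSq_apply]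
    simp at h1
    linarith
  refine measure_mono_null ?_ (volume_line hne)
  rintro q ⟨h1, h2⟩
  have h3 := orient_nonneg_of_mem_hull (a := a) (b := b) (fun x hx => (mem_leftPart.1 hx).2) h1
  have h4 := orient_nonneg_of_mem_hull (a := b) (b := a) (fun x hx => (mem_leftPart.1 hx).2) h2
  rw [orient_swap] at h4
  exact le_antisymm (neg_nonneg.1 h4) h3

/-- At the end of a diagonal, the interior angle is split by the diagonal. -/
theorem interiorAngle_split_end {v : ℍ} {ρ : ℝ} (hρ : 0 < ρ) {X : Finset ℍ}
    (hX : ∀ w ∈ X, dist v w = ρ) {a b : ℍ} (hab : a ≠ b) (ha : a ∈ X) (hb : b ∈ X) :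
    interiorAngle X a = interiorAngle (leftPart X a b) a + interiorAngle (leftPart X b a) a := by
  have hva : v ≠ a := fun h => by
    have := hX a ha; rw [h, dist_self] at this; exact hρ.ne this
  have hre : ∀ w ∈ X, w ≠ a → 0 < (rotor v a * gans a w).re := fun w hw hwx =>
    rotor_mul_re_pos (by rw [hX a ha, hX w hw]) hwx
  obtain ⟨y, hy, z, hz, hya, hza, hext⟩ := exists_extremal_vertices (v := v) (x := a) (X := X)
    ⟨b, hb, hab.symm⟩
  have hL : ∀ w ∈ X, w ≠ a → (w ∈ leftPart X a b ↔ vertexAngle v a b ≤ vertexAngle v a w) :=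
    fun w hw hwa => by
      rw [vertexAngle_le_iff hva (hre b hb hab.symm) (hre w hw hwa), mem_leftPart, and_iff_right hw]
  have hR : ∀ w ∈ X, w ≠ a → (w ∈ leftPart X b a ↔ vertexAngle v a w ≤ vertexAngle v a b) :=
    fun w hw hwa => by
      rw [vertexAngle_le_iff hva (hre w hw hwa) (hre b hb hab.symm), mem_leftPart, and_iff_right hw,
        orient_swap, orient_swap_right a b w]
  have hbe := hext b hb hab.symm
  rw [interiorAngle_eq hρ hX ha hy hz hya hza hext,
    interiorAngle_eq (y := b) (z := z) (X := leftPart X a b) hρ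
      (fun w hw => hX w (leftPart_subset _ _ _ hw)) (mem_leftPart.2 ⟨ha, by simp⟩)
      ((hL b hb hab.symm).2 le_rfl) ((hL z hz hza).2 hbe.2) hab.symm hza
      (fun w hw hwa => ⟨(hL w (leftPart_subset _ _ _ hw) hwa).1 hw,
        (hext w (leftPart_subset _ _ _ hw) hwa).2⟩),
    interiorAngle_eq (y := y) (z := b) (X := leftPart X b a) hρ
      (fun w hw => hX w (leftPart_subset _ _ _ hw)) (mem_leftPart.2 ⟨ha, by simp⟩)
      ((hR y hy hya).2 hbe.1) ((hR b hb hab.symm).2 le_rfl) hya hab.symm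
      (fun w hw hwa => ⟨(hext w (leftPart_subset _ _ _ hw) hwa).1,
        (hR w (leftPart_subset _ _ _ hw) hwa).1 hw⟩)]
  ring

theorem halfAngle_combo {P Q W : ℂ} (hP : 0 < P.re) (hQ : 0 < Q.re) (hW : 0 < W.re) {α β δ : ℝ}
    (hα : 0 ≤ α) (hβ : 0 ≤ β) (hδ : 0 < δ) (h : δ * W = α * P + β * Q) :
    min (halfAngle P) (halfAngle Q) ≤ halfAngle W ∧
      halfAngle W ≤ max (halfAngle P) (halfAngle Q) := by
  have h1 := congrArg Complex.re h
  have h2 := congrArg Complex.im h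
  simp only [Complex.re_ofReal_mul, Complex.im_ofReal_mul, Complex.add_re, Complex.add_im] at h1 h2
  have key : ∀ P Q : ℂ, 0 < P.re → 0 < Q.re → ∀ α β : ℝ, 0 ≤ α → 0 ≤ β →
      δ * W.re = α * P.re + β * Q.re → δ * W.im = α * P.im + β * Q.im →
      halfAngle P ≤ halfAngle Q → halfAngle P ≤ halfAngle W ∧ halfAngle W ≤ halfAngle Q := by
    intro P Q hP hQ α β hα hβ h1 h2 hPQ
    rw [halfAngle_le_iff hP hQ] at hPQ
    rw [halfAngle_le_iff hP hW, halfAngle_le_iff hW hQ]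
    have e1 := mul_le_mul_of_nonneg_left hPQ hβ
    have e2 := mul_le_mul_of_nonneg_left hPQ hα
    constructor
    · refine le_of_mul_le_mul_left ?_ hδ
      linear_combination e1 + P.im * h1 - P.re * h2
    · refine le_of_mul_le_mul_left ?_ hδ
      linear_combination e2 - Q.im * h1 + Q.re * h2
  rcases le_total (halfAngle P) (halfAngle Q) with hle | hle
  · rw [min_eq_left hle, max_eq_right hle]
    exact key P Q hP hQ α β hα hβ h1 h2 hle
  · rw [min_eq_right hle, max_eq_left hle]
    exact key Q P hQ hP β α hβ hα (by linarith) (by linarith) hle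

/-- A vertex `w` beyond the diagonal is seen from `x` between `a` and `b`, because the segment `x w`
crosses the chord `a b`. Dropping it does not change the extremal directions. -/
theorem interiorAngle_split_side {v : ℍ} {ρ : ℝ} (hρ : 0 < ρ) {X : Finset ℍ}
    (hX : ∀ w ∈ X, dist v w = ρ) {a b x : ℍ} (hab : a ≠ b) (ha : a ∈ X) (hb : b ∈ X) (hx : x ∈ X)
    (hpos : 0 < orient a b x) : interiorAngle X x = interiorAngle (leftPart X a b) x := by
  classical
  have hvx : v ≠ x := fun h => by
    have := hX x hx; rw [h, dist_self] at this; exact hρ.ne this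
  have hre : ∀ w ∈ X, w ≠ x → 0 < (rotor v x * gans x w).re := fun w hw hwx =>
    rotor_mul_re_pos (by rw [hX x hx, hX w hw]) hwx
  have hax : a ≠ x := by rintro rfl; simp at hpos
  have hbx : b ≠ x := by rintro rfl; simp at hpos
  have haL : a ∈ leftPart X a b := mem_leftPart.2 ⟨ha, by simp⟩
  have hbL : b ∈ leftPart X a b := mem_leftPart.2 ⟨hb, by simp⟩
  have hxL : x ∈ leftPart X a b := mem_leftPart.2 ⟨hx, hpos.le⟩
  obtain ⟨y, hy, z, hz, hyx, hzx, hext⟩ := exists_extremal_vertices (v := v) (x := x)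
    (X := leftPart X a b) ⟨a, haL, hax⟩
  rw [interiorAngle_eq hρ (fun w hw => hX w (leftPart_subset _ _ _ hw)) hxL hy hz hyx hzx hext]
  refine interiorAngle_eq hρ hX hx (leftPart_subset _ _ _ hy) (leftPart_subset _ _ _ hz) hyx hzx
    fun w hw hwx => ?_
  by_cases hwL : w ∈ leftPart X a b
  · exact hext w hwL hwx
  have hwneg : orient a b w < 0 := by
    by_contra h
    exact hwL (mem_leftPart.2 ⟨hw, not_lt.1 h⟩)
  -- These weights cancel the orientations of `x` and `w`, so they select the crossing point of `x
  -- w` with the line `a b`.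
  obtain ⟨α, β, hα, hβ, hαβ⟩ := chord_coeffs hX hab ha hb
    (t := fun p => (if p = x then -orient a b w else 0) + (if p = w then orient a b x else 0))
    (fun p _ => add_nonneg (by split_ifs <;> linarith) (by split_ifs <;> linarith)) (by
      simp only [add_smul, Finset.sum_add_distrib, ite_smul, zero_smul, Finset.sum_ite_eq', hx, hw,
        if_true, map_add, map_smul, smul_eq_mul]
      change -orient a b w * orient a b x + orient a b x * orient a b w = 0
      ring)
  simp only [add_smul, Finset.sum_add_distrib, ite_smul, zero_smul, Finset.sum_ite_eq', hx, hw,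
    if_true] at hαβ
  have h1 := congrArg (fun u => rotor v x * tangentProj x u) hαβ
  have h0 : tangentProj x (lorentzVec x) = 0 := gans_self x
  simp only [map_add, map_smul, h0, smul_zero, zero_add, Complex.real_smul] at h1
  obtain ⟨h2, h3⟩ := halfAngle_combo (hre a ha hax) (hre b hb hbx) (hre w hw hwx) hα hβ hpos
    (by rw [gans, gans, gans]; linear_combination h1)
  have e1 := hext a haL hax
  have e2 := hext b hbL hbx
  exact ⟨(le_min e1.1 e2.1).trans h2, h3.trans (max_le e1.2 e2.2)⟩

/-- The Gauss-Bonnet formula for cyclic polygons. -/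
theorem volume_cyclic_polygon {v : ℍ} {ρ : ℝ} (hρ : 0 < ρ) {X : Finset ℍ} (h3 : 3 ≤ X.card)
    (hX : ∀ w ∈ X, dist v w = ρ) :
    0 ≤ (X.card - 2) * Real.pi - ∑ x ∈ X, interiorAngle X x ∧
    volume (geodesicHull (X : Set ℍ)) =
      ENNReal.ofReal ((X.card - 2) * Real.pi - ∑ x ∈ X, interiorAngle X x) := by
  classical
  induction hn : X.card using Nat.strong_induction_on generalizing X with
  | _ n ih =>
  subst hn
  have hdis : ∀ a ∈ X, v ≠ a := fun a ha h => by
    have := hX a ha; rw [h, dist_self] at this; exact hρ.ne this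
  have hre : ∀ a ∈ X, ∀ w ∈ X, w ≠ a → 0 < (rotor v a * gans a w).re := fun a ha w hw hwx =>
    rotor_mul_re_pos (by rw [hX a ha, hX w hw]) hwx
  rcases h3.eq_or_lt with h3 | h4
  · obtain ⟨x, y, z, hxy, hxz, hyz, rfl⟩ := Finset.card_eq_three.1 h3.symm
    have hx := hX x (by simp)
    have hy := hX y (by simp)
    have hz := hX z (by simp)
    have ang : ∀ x y z : ℍ, x ≠ y → x ≠ z → y ≠ z → dist v x = ρ → dist v y = ρ → dist v z = ρ →
        interiorAngle ({x, y, z} : Finset ℍ) x = hypAngle x y z := by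
      intro x y z hxy hxz hyz hx hy hz
      have hvx : v ≠ x := fun h => by rw [h, dist_self] at hx; exact hρ.ne hx
      have hX' : ∀ w ∈ ({x, y, z} : Finset ℍ), dist v w = ρ := by simp [hx, hy, hz]
      rw [hypAngle_eq_halfAngle (norm_rotor hvx) (rotor_mul_re_pos (by rw [hx, hy]) hxy.symm)
        (rotor_mul_re_pos (by rw [hx, hz]) hxz.symm)]
      change _ = |vertexAngle v x y - vertexAngle v x z|
      rcases le_total (vertexAngle v x y) (vertexAngle v x z) with h | h
      · rw [abs_sub_comm, abs_of_nonneg (sub_nonneg.2 h)]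
        refine interiorAngle_eq hρ hX' (by simp) (by simp) (by simp) hxy.symm hxz.symm ?_
        intro w hw hwx
        simp only [Finset.mem_insert, Finset.mem_singleton] at hw
        rcases hw with rfl | rfl | rfl
        · exact absurd rfl hwx
        · exact ⟨le_rfl, h⟩
        · exact ⟨h, le_rfl⟩
      · rw [abs_of_nonneg (sub_nonneg.2 h)]
        refine interiorAngle_eq hρ hX' (by simp) (by simp) (by simp) hxz.symm hxy.symm ?_
        intro w hw hwx
        simp only [Finset.mem_insert, Finset.mem_singleton] at hw
        rcases hw with rfl | rfl | rfl
        · exact absurd rfl hwx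
        · exact ⟨h, le_rfl⟩
        · exact ⟨le_rfl, h⟩
    have key := volume_triangle (x := x) (y := y) (z := z)
      (orient_ne_zero (v := v) (by rw [hx, hy]) (by rw [hx, hz]) hxy hxz hyz)
    have e1 := ang x y z hxy hxz hyz hx hy hz
    have e2 := ang y x z hxy.symm hyz hxz hy hx hz
    have e3 := ang z x y hxz.symm hyz.symm hxy hz hx hy
    rw [show ({y, x, z} : Finset ℍ) = {x, y, z} by ext; simp; tauto] at e2
    rw [show ({z, x, y} : Finset ℍ) = {x, y, z} by ext; simp; tauto] at e3
    have hT : (((({x, y, z} : Finset ℍ).card : ℝ)) - 2) * Real.pi -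
        ∑ w ∈ ({x, y, z} : Finset ℍ), interiorAngle ({x, y, z} : Finset ℍ) w =
        Real.pi - hypAngle x y z - hypAngle y x z - hypAngle z x y := by
      rw [Finset.sum_insert (by simp [hxy, hxz]), Finset.sum_insert (by simp [hyz]),
        Finset.sum_singleton, e1, e2, e3, ← h3]
      push_cast; ring
    rw [hT]
    simpa using key
  · obtain ⟨a, ha⟩ : X.Nonempty := Finset.card_pos.1 (by omega)
    obtain ⟨w0, hw0, hw0a⟩ : ∃ w ∈ X, w ≠ a := Finset.exists_mem_ne (by omega) a
    obtain ⟨y, hy, z, hz, hya, hza, hext⟩ := exists_extremal_vertices (v := v) ⟨w0, hw0, hw0a⟩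
    -- Four vertices allow a `b` different from both extremal vertices `y`, `z` seen from `a`. The
    -- diagonal `a b` then has one of these strictly on each side, so both parts are smaller and
    -- still have three vertices.
    obtain ⟨b, hb, hbn⟩ : ∃ b ∈ X, b ∉ ({a, y, z} : Finset ℍ) := by
      by_contra! hcon
      have := Finset.card_le_card (show X ⊆ {a, y, z} from hcon)
      have := Finset.card_le_three (a := a) (b := y) (c := z)
      omega
    simp only [Finset.mem_insert, Finset.mem_singleton, not_or] at hbn
    obtain ⟨hba, hby, hbz⟩ := hbn
    have hab : a ≠ b := Ne.symm hba
    have hcol : ∀ w ∈ X, w ≠ a → w ≠ b → orient a b w ≠ 0 := fun w hw hwa hwb =>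
      orient_ne_zero (v := v) (by rw [hX a ha, hX b hb]) (by rw [hX a ha, hX w hw]) hab
        (Ne.symm hwa) (Ne.symm hwb)
    have hzpos : 0 < orient a b z := lt_of_le_of_ne
      ((vertexAngle_le_iff (hdis a ha) (hre a ha b hb hba) (hre a ha z hz hza)).1 (hext b hb hba).2)
      (hcol z hz hza (Ne.symm hbz)).symm
    have hypos : orient a b y < 0 := by
      have := (vertexAngle_le_iff (hdis a ha) (hre a ha y hy hya) (hre a ha b hb hba)).1
        (hext b hb hba).1
      rw [orient_swap_right] at this
      exact lt_of_le_of_ne (by linarith) (hcol y hy hya (Ne.symm hby))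
    have hL3 : 3 ≤ (leftPart X a b).card := by
      have : ({a, b, z} : Finset ℍ) ⊆ leftPart X a b := by
        intro w hw
        simp only [Finset.mem_insert, Finset.mem_singleton] at hw
        rcases hw with rfl | rfl | rfl
        · exact mem_leftPart.2 ⟨ha, by simp⟩
        · exact mem_leftPart.2 ⟨hb, by simp⟩
        · exact mem_leftPart.2 ⟨hz, hzpos.le⟩
      have h := Finset.card_le_card this
      rwa [Finset.card_eq_three.2 ⟨a, b, z, hab, Ne.symm hza, hbz, rfl⟩] at h
    have hR3 : 3 ≤ (leftPart X b a).card := by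
      have : ({a, b, y} : Finset ℍ) ⊆ leftPart X b a := by
        intro w hw
        simp only [Finset.mem_insert, Finset.mem_singleton] at hw
        rcases hw with rfl | rfl | rfl
        · exact mem_leftPart.2 ⟨ha, by simp⟩
        · exact mem_leftPart.2 ⟨hb, by simp⟩
        · exact mem_leftPart.2 ⟨hy, by rw [orient_swap]; linarith⟩
      have h := Finset.card_le_card this
      rwa [Finset.card_eq_three.2 ⟨a, b, y, hab, Ne.symm hya, hby, rfl⟩] at h
    have hunion : leftPart X a b ∪ leftPart X b a = X := by
      ext w
      simp only [Finset.mem_union, mem_leftPart, orient_swap a b]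
      constructor
      · rintro (h | h) <;> exact h.1
      · intro h
        rcases le_total 0 (orient a b w) with h' | h'
        · exact Or.inl ⟨h, h'⟩
        · exact Or.inr ⟨h, by linarith⟩
    have hinter : leftPart X a b ∩ leftPart X b a = {a, b} := by
      ext w
      simp only [Finset.mem_inter, mem_leftPart, orient_swap a b, Finset.mem_insert,
        Finset.mem_singleton]
      constructor
      · rintro ⟨⟨hw, h1⟩, -, h2⟩
        by_contra! hcon
        exact hcol w hw hcon.1 hcon.2 (by linarith)
      · rintro (rfl | rfl)
        · simp [ha]
        · simp [hb]
    -- The ends of the diagonal are counted twice, so the vertex numbers of the parts add up to `n +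
    -- 2`, as additivity of `(n - 2) π` requires.
    have hcard := Finset.card_union_add_card_inter (leftPart X a b) (leftPart X b a)
    rw [hunion, hinter, Finset.card_pair hab] at hcard
    obtain ⟨i1, j1⟩ := ih (leftPart X a b).card (by omega) hL3
      (fun w hw => hX w (leftPart_subset _ _ _ hw)) rfl
    obtain ⟨i2, j2⟩ := ih (leftPart X b a).card (by omega) hR3
      (fun w hw => hX w (leftPart_subset _ _ _ hw)) rfl
    have hang : ∀ x ∈ X, interiorAngle X x =
        (if x ∈ leftPart X a b then interiorAngle (leftPart X a b) x else 0) +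
        (if x ∈ leftPart X b a then interiorAngle (leftPart X b a) x else 0) := by
      intro x hx
      rcases eq_or_ne x a with rfl | hxa
      · rw [if_pos (mem_leftPart.2 ⟨ha, by simp⟩), if_pos (mem_leftPart.2 ⟨ha, by simp⟩)]
        exact interiorAngle_split_end hρ hX hab ha hb
      rcases eq_or_ne x b with rfl | hxb
      · rw [if_pos (mem_leftPart.2 ⟨hb, by simp⟩), if_pos (mem_leftPart.2 ⟨hb, by simp⟩), add_comm]
        exact interiorAngle_split_end hρ hX hba hb ha
      rcases lt_or_gt_of_ne (hcol x hx hxa hxb) with h | h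
      · rw [if_neg (fun h' => absurd (mem_leftPart.1 h').2 (not_le.2 h)), zero_add,
          if_pos (mem_leftPart.2 ⟨hx, by rw [orient_swap]; linarith⟩)]
        exact interiorAngle_split_side hρ hX hba hb ha hx (by rw [orient_swap]; linarith)
      · rw [if_pos (mem_leftPart.2 ⟨hx, h.le⟩), if_neg, add_zero]
        · exact interiorAngle_split_side hρ hX hab ha hb hx h
        · intro h'
          have := (mem_leftPart.1 h').2
          rw [orient_swap] at this
          linarith
    have hsum : ∑ x ∈ X, interiorAngle X x = ∑ x ∈ leftPart X a b, interiorAngle (leftPart X a b) x +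
        ∑ x ∈ leftPart X b a, interiorAngle (leftPart X b a) x := by
      rw [Finset.sum_congr rfl hang, Finset.sum_add_distrib]
      simp only [Finset.sum_ite_mem]
      rw [Finset.inter_eq_right.2 (leftPart_subset X a b),
        Finset.inter_eq_right.2 (leftPart_subset X b a)]
    have hT : ((X.card : ℝ) - 2) * Real.pi - ∑ x ∈ X, interiorAngle X x =
        (((leftPart X a b).card : ℝ) - 2) * Real.pi -
          ∑ x ∈ leftPart X a b, interiorAngle (leftPart X a b) x +
        ((((leftPart X b a).card : ℝ) - 2) * Real.pi -
          ∑ x ∈ leftPart X b a, interiorAngle (leftPart X b a) x) := by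
      have : (X.card : ℝ) + 2 = (leftPart X a b).card + (leftPart X b a).card := by
        exact_mod_cast hcard
      rw [hsum]
      linear_combination Real.pi * this
    rw [hT]
    exact ⟨add_nonneg i1 i2, by rw [volume_hull_eq_add hX hab ha hb, j1, j2,
      ENNReal.ofReal_add i1 i2]⟩

end

section
open MeasureTheory

/-! ### Rays and sectors -/

theorem gans_combo {x p a b : ℍ} {s t : ℝ}
    (h : lorentzVec p = s • lorentzVec a + t • lorentzVec b) :
    gans x p = s • gans x a + t • gans x b := by
  rw [gans, h, map_add, map_smul, map_smul]; rfl

theorem lorentzVec_eq_of_gans {x p q : ℍ} {l : ℝ} (h : gans x p = l • gans x q) :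
    lorentzVec p = (Real.cosh (dist x p) - l * Real.cosh (dist x q)) • lorentzVec x +
      l • lorentzVec q := by
  have h0 : tangentProj x (lorentzVec x) = 0 := gans_self x
  refine lorentzVec_ext x ?_ ?_
  · simp only [map_add, map_smul, lorentzForm_self, smul_eq_mul, ← cosh_dist_eq]; ring
  · rw [map_add, map_smul, h0, map_smul, smul_zero, zero_add]; exact h

/-- The chart at `x` turns geodesic rays from `x` into linear rays; the sign of the coefficient of
`lorentzVec x` tells which of the two points is reached first. -/
theorem mem_ray_iff {x p q : ℍ} (hq : q ≠ x) :
    (p ∈ geodesicArc x q ∨ q ∈ geodesicArc x p) ↔ ∃ l : ℝ, 0 ≤ l ∧ gans x p = l • gans x q := by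
  constructor
  · rintro (h | h)
    · obtain ⟨s, t, -, ht, h⟩ := mem_geodesicArc_iff_lorentzVec.1 h
      exact ⟨t, ht, by rw [gans_combo h, gans_self, smul_zero, zero_add]⟩
    · obtain ⟨s, t, -, ht, h⟩ := mem_geodesicArc_iff_lorentzVec.1 h
      have h1 : gans x q = t • gans x p := by rw [gans_combo h, gans_self, smul_zero, zero_add]
      have ht0 : t ≠ 0 := by
        rintro rfl
        rw [zero_smul, gans_eq_zero_iff] at h1
        exact hq h1
      exact ⟨t⁻¹, inv_nonneg.2 ht, by rw [h1, smul_smul, inv_mul_cancel₀ ht0, one_smul]⟩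
  · rintro ⟨l, hl, h⟩
    have h1 := lorentzVec_eq_of_gans h
    rcases le_or_gt 0 (Real.cosh (dist x p) - l * Real.cosh (dist x q)) with h2 | h2
    · exact Or.inl (mem_geodesicArc_iff_lorentzVec.2 ⟨_, _, h2, hl, h1⟩)
    · have hl0 : 0 < l := by
        rcases hl.eq_or_lt with rfl | h
        · have := Real.cosh_pos (dist x p); linarith
        · exact h
      refine Or.inr (mem_geodesicArc_iff_lorentzVec.2
        ⟨l⁻¹ * (l * Real.cosh (dist x q) - Real.cosh (dist x p)), l⁻¹, ?_, inv_nonneg.2 hl, ?_⟩)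
      · exact mul_nonneg (inv_nonneg.2 hl) (by linarith)
      · rw [h1, mul_smul, ← smul_add, ← add_assoc, ← add_smul]
        simp [smul_smul, hl0.ne']

/-- A hull point is a nonnegative combination and the chart is linear on it, so the bounds valid at
the vertices carry over. -/
theorem vertexAngle_mem_of_mem_hull {v x : ℍ} {ρ : ℝ} (hρ : 0 < ρ) {X : Finset ℍ}
    (hX : ∀ w ∈ X, dist v w = ρ) (hx : x ∈ X) {y z : ℍ} (hy : y ∈ X) (hz : z ∈ X)
    (hyx : y ≠ x) (hzx : z ≠ x)
    (hext : ∀ w ∈ X, w ≠ x → vertexAngle v x y ≤ vertexAngle v x w ∧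
      vertexAngle v x w ≤ vertexAngle v x z) {q : ℍ} (hq : q ∈ geodesicHull (X : Set ℍ))
    (hqx : q ≠ x) : 0 < (rotor v x * gans x q).re ∧
      vertexAngle v x q ∈ Set.Icc (vertexAngle v x y) (vertexAngle v x z) := by
  have hvx : v ≠ x := fun h => by
    have := hX x hx; rw [h, dist_self] at this; exact hρ.ne this
  have hre : ∀ w ∈ X, w ≠ x → 0 < (rotor v x * gans x w).re := fun w hw hwx =>
    rotor_mul_re_pos (by rw [hX x hx, hX w hw]) hwx
  obtain ⟨t, ht, hqt⟩ := mem_geodesicHull_finset.1 hq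
  have hsum : gans x q = ∑ w ∈ X, t w • gans x w := by
    rw [gans, hqt, map_sum]
    exact Finset.sum_congr rfl fun w _ => by rw [map_smul]; rfl
  have hmul : rotor v x * gans x q = ∑ w ∈ X, t w • (rotor v x * gans x w) := by
    rw [hsum, Finset.mul_sum]
    exact Finset.sum_congr rfl fun w _ => by simp only [Complex.real_smul]; ring
  have hre' : (rotor v x * gans x q).re = ∑ w ∈ X, t w * (rotor v x * gans x w).re := by
    rw [hmul, Complex.re_sum]
    exact Finset.sum_congr rfl fun w _ => by rw [Complex.real_smul, Complex.re_ofReal_mul]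
  have him' : (rotor v x * gans x q).im = ∑ w ∈ X, t w * (rotor v x * gans x w).im := by
    rw [hmul, Complex.im_sum]
    exact Finset.sum_congr rfl fun w _ => by rw [Complex.real_smul, Complex.im_ofReal_mul]
  have hnn : ∀ w ∈ X, 0 ≤ t w * (rotor v x * gans x w).re := fun w hw => by
    rcases eq_or_ne w x with rfl | h
    · simp
    · exact mul_nonneg (ht w hw) (hre w hw h).le
  have hpos : 0 < (rotor v x * gans x q).re := by
    rw [hre']
    refine (Finset.sum_nonneg hnn).lt_of_ne fun h0 => hqx (gans_eq_zero_iff.1 ?_)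
    rw [hsum]
    refine Finset.sum_eq_zero fun w hw => ?_
    have h1 := (Finset.sum_eq_zero_iff_of_nonneg hnn).1 h0.symm w hw
    rcases eq_or_ne w x with rfl | h
    · simp
    · rw [(mul_eq_zero.1 h1).resolve_right (hre w hw h).ne', zero_smul]
  refine ⟨hpos, ?_, ?_⟩
  · rw [vertexAngle, vertexAngle, halfAngle_le_iff (hre y hy hyx) hpos, hre', him',
      Finset.mul_sum, Finset.sum_mul]
    refine Finset.sum_le_sum fun w hw => ?_
    rcases eq_or_ne w x with rfl | h
    · simp
    · have := (halfAngle_le_iff (hre y hy hyx) (hre w hw h)).1 (hext w hw h).1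
      nlinarith [ht w hw]
  · rw [vertexAngle, vertexAngle, halfAngle_le_iff hpos (hre z hz hzx), hre', him',
      Finset.mul_sum, Finset.sum_mul]
    refine Finset.sum_le_sum fun w hw => ?_
    rcases eq_or_ne w x with rfl | h
    · simp
    · have := (halfAngle_le_iff (hre w hw h) (hre z hz hzx)).1 (hext w hw h).2
      nlinarith [ht w hw]

theorem exists_combo_of_halfAngle_mem {P Q Z : ℂ} (hP : 0 < P.re) (hQ : 0 < Q.re) (hZ : 0 < Z.re)
    (h1 : halfAngle P ≤ halfAngle Z) (h2 : halfAngle Z ≤ halfAngle Q) :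
    ∃ α β : ℝ, 0 ≤ α ∧ 0 ≤ β ∧ Z = α • P + β • Q := by
  rw [halfAngle_le_iff hP hZ] at h1
  rw [halfAngle_le_iff hZ hQ] at h2
  rcases (by nlinarith : P.im * Q.re ≤ Q.im * P.re).eq_or_lt with h | h
  · refine ⟨Z.re / P.re, 0, by positivity, le_rfl, ?_⟩
    have h3 : Z.im * P.re = P.im * Z.re := by
      apply le_antisymm _ h1
      by_contra hcon
      push Not at hcon
      nlinarith
    apply Complex.ext
    · simp; field_simp
    · simp; field_simp; linarith
  · have hD : 0 < P.re * Q.im - P.im * Q.re := by linarith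
    have hD' := hD.ne'
    refine ⟨(Z.re * Q.im - Z.im * Q.re) / (P.re * Q.im - P.im * Q.re),
      (P.re * Z.im - P.im * Z.re) / (P.re * Q.im - P.im * Q.re),
      div_nonneg (by linarith) hD.le, div_nonneg (by linarith) hD.le, ?_⟩
    apply Complex.ext
    · rw [Complex.add_re, Complex.real_smul, Complex.real_smul, Complex.re_ofReal_mul,
        Complex.re_ofReal_mul, div_mul_eq_mul_div, div_mul_eq_mul_div, ← add_div, eq_div_iff hD']
      ring
    · rw [Complex.add_im, Complex.real_smul, Complex.real_smul, Complex.im_ofReal_mul,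
        Complex.im_ofReal_mul, div_mul_eq_mul_div, div_mul_eq_mul_div, ← add_div, eq_div_iff hD']
      ring

/-- A direction between those of the extremal vertices is a nonnegative combination of them, so its
ray meets the arc `y z`, which lies in the hull. The point `x` has no direction and is left out. -/
theorem sector_eq {v x : ℍ} {ρ : ℝ} (hρ : 0 < ρ) {X : Finset ℍ}
    (hX : ∀ w ∈ X, dist v w = ρ) (hx : x ∈ X) {y z : ℍ} (hy : y ∈ X) (hz : z ∈ X)
    (hyx : y ≠ x) (hzx : z ≠ x)
    (hext : ∀ w ∈ X, w ≠ x → vertexAngle v x y ≤ vertexAngle v x w ∧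
      vertexAngle v x w ≤ vertexAngle v x z) (R : ℝ) :
    sector R x (geodesicHull (X : Set ℍ)) \ {x} = {p | dist p x < R ∧ 0 < (rotor v x * gans x p).re ∧
      halfAngle (rotor v x * gans x p) ∈ Set.Icc (vertexAngle v x y) (vertexAngle v x z)} := by
  have hvx : v ≠ x := fun h => by
    have := hX x hx; rw [h, dist_self] at this; exact hρ.ne this
  have hre : ∀ w ∈ X, w ≠ x → 0 < (rotor v x * gans x w).re := fun w hw hwx =>
    rotor_mul_re_pos (by rw [hX x hx, hX w hw]) hwx
  have hr0 : rotor v x ≠ 0 := fun h => by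
    have := norm_rotor hvx; rw [h, norm_zero] at this; exact zero_ne_one this
  ext p
  constructor
  · rintro ⟨⟨hR, q, hq, hqx, hray⟩, hpx⟩
    obtain ⟨l, hl, h⟩ := (mem_ray_iff hqx).1 hray
    have hl0 : 0 < l := hl.lt_of_ne fun h0 => hpx (gans_eq_zero_iff.1 (by rw [h, ← h0, zero_smul]))
    obtain ⟨h1, h2⟩ := vertexAngle_mem_of_mem_hull hρ hX hx hy hz hyx hzx hext hq hqx
    have h3 : rotor v x * gans x p = l * (rotor v x * gans x q) := by
      rw [h, Complex.real_smul]; ring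
    refine ⟨hR, ?_, ?_⟩
    · rw [h3, Complex.re_ofReal_mul]; positivity
    · have : halfAngle (rotor v x * gans x p) = vertexAngle v x q := by
        rw [vertexAngle, h3, halfAngle, halfAngle, Complex.re_ofReal_mul, Complex.im_ofReal_mul,
          mul_div_mul_left _ _ hl0.ne']
      rwa [this]
  · rintro ⟨hR, hpos, ha, hb⟩
    have hpx : p ≠ x := by rintro rfl; simp at hpos
    refine ⟨⟨hR, ?_⟩, hpx⟩
    obtain ⟨α, β, hα, hβ, h⟩ := exists_combo_of_halfAngle_mem (hre y hy hyx) (hre z hz hzx) hpos ha hb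
    have h' : gans x p = α • gans x y + β • gans x z := by
      apply mul_left_cancel₀ hr0
      rw [h]; simp only [Complex.real_smul]; ring
    have hαβ : 0 < α + β := by
      refine (add_nonneg hα hβ).lt_of_ne fun h0 => hpx (gans_eq_zero_iff.1 ?_)
      have e1 : α = 0 := by linarith
      have e2 : β = 0 := by linarith
      rw [h', e1, e2]; simp
    obtain ⟨l, hl, q, hq⟩ := exists_smul_lorentzVec (combo_mem_timelikeCone y z hα hβ hαβ)
    have hg : gans x p = l • gans x q := by
      rw [h']
      have := congrArg (tangentProj x) hq
      rw [map_add, map_smul, map_smul, map_smul] at this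
      exact this
    have hqx : q ≠ x := by
      rintro rfl
      rw [gans_self, smul_zero, gans_eq_zero_iff] at hg
      exact hpx hg
    refine ⟨q, ?_, hqx, (mem_ray_iff hqx).2 ⟨l, hl.le, hg⟩⟩
    have hqa : q ∈ geodesicArc y z := by
      refine mem_geodesicArc_iff_lorentzVec.2 ⟨l⁻¹ * α, l⁻¹ * β, by positivity, by positivity, ?_⟩
      rw [mul_smul, mul_smul, ← smul_add, hq, smul_smul, inv_mul_cancel₀ hl.ne', one_smul]
    exact geodesicallyConvex_geodesicHull _ y (subset_geodesicHull _ hy) z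
      (subset_geodesicHull _ hz) hqa

theorem volume_sector {v x : ℍ} {ρ : ℝ} (hρ : 0 < ρ) {X : Finset ℍ} (h2 : 2 ≤ X.card)
    (hX : ∀ w ∈ X, dist v w = ρ) (hx : x ∈ X) {R : ℝ} (hR : 0 ≤ R) :
    0 ≤ interiorAngle X x ∧ volume (sector R x (geodesicHull (X : Set ℍ))) =
      ENNReal.ofReal ((Real.cosh R - 1) * interiorAngle X x) := by
  have hvx : v ≠ x := fun h => by
    have := hX x hx; rw [h, dist_self] at this; exact hρ.ne this
  obtain ⟨w0, hw0, hw0x⟩ : ∃ w ∈ X, w ≠ x := Finset.exists_mem_ne (by omega) x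
  obtain ⟨y, hy, z, hz, hyx, hzx, hext⟩ := exists_extremal_vertices (v := v) ⟨w0, hw0, hw0x⟩
  have hle := (hext y hy hyx).2
  rw [← measure_sdiff_null (volume_singleton_eq_zero x), sector_eq hρ hX hx hy hz hyx hzx hext,
    volume_sector_region x (norm_rotor hvx) hR hle (halfAngle_mem _).1 (halfAngle_mem _).2,
    interiorAngle_eq hρ hX hx hy hz hyx hzx hext]
  exact ⟨sub_nonneg.2 hle, rfl⟩

/-- Near a vertex, a cyclic polygon coincides with its sector. -/
theorem exists_ball_sector_subset_hull {v x : ℍ} {ρ : ℝ} {X : Finset ℍ}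
    (hX : ∀ w ∈ X, dist v w = ρ) (hx : x ∈ X) :
    ∃ ε > (0 : ℝ), ∀ R : ℝ, ∀ q ∈ sector R x (geodesicHull (X : Set ℍ)), ‖gans x q‖ < ε →
      q ∈ geodesicHull (X : Set ℍ) := by
  classical
  have hre : ∀ w ∈ X, w ≠ x → 0 < ‖gans x v‖ * (rotor v x * gans x w).re := fun w hw hwx => by
    rw [rotor_mul_re, dist_comm x v, hX x hx, hX w hw]
    have h1 := Real.cosh_pos ρ
    have h2 := Real.one_lt_cosh.2 (dist_ne_zero.2 hwx.symm)
    nlinarith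
  -- a linear functional which is large on all other vertices
  obtain ⟨κ, hκ0, hκ⟩ : ∃ κ : ℝ, 0 < κ ∧ ∀ w ∈ X, w ≠ x →
      Real.cosh (dist x w) ≤ κ * (rotor v x * gans x w).re := by
    have hre' : ∀ w ∈ X, w ≠ x → 0 < (rotor v x * gans x w).re := fun w hw hwx =>
      pos_of_mul_pos_right (hre w hw hwx) (norm_nonneg _)
    refine ⟨1 + ∑ w ∈ X, |Real.cosh (dist x w) / (rotor v x * gans x w).re|,
      by have := Finset.sum_nonneg (s := X) (fun w _ => abs_nonneg
          (Real.cosh (dist x w) / (rotor v x * gans x w).re)); linarith, fun w hw hwx => ?_⟩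
    have h1 := hre' w hw hwx
    rw [← div_le_iff₀ h1]
    have h2 := Finset.single_le_sum (f := fun w => |Real.cosh (dist x w) /
      (rotor v x * gans x w).re|) (fun w _ => abs_nonneg _) hw
    have h3 := le_abs_self (Real.cosh (dist x w) / (rotor v x * gans x w).re)
    linarith
  refine ⟨κ⁻¹, inv_pos.2 hκ0, fun R p hp hsmall => ?_⟩
  obtain ⟨-, q, hq, hqx, hray⟩ := hp
  obtain ⟨l, hl, h⟩ := (mem_ray_iff hqx).1 hray
  obtain ⟨t, ht, hqt⟩ := mem_geodesicHull_finset.1 hq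
  have hrot1 : ‖rotor v x‖ ≤ 1 := by
    rcases eq_or_ne v x with rfl | hvx
    · simp [rotor]
    · exact (norm_rotor hvx).le
  have hgsum : gans x q = ∑ w ∈ X, t w • gans x w := by
    rw [gans, hqt, map_sum]
    exact Finset.sum_congr rfl fun w _ => by rw [map_smul]; rfl
  have hsum : gans x p = ∑ w ∈ X.erase x, (l * t w) • gans x w := by
    rw [h, hgsum, Finset.smul_sum, ← Finset.sum_erase_add _ _ hx, gans_self, smul_zero, smul_zero,
      add_zero]
    exact Finset.sum_congr rfl fun w _ => by rw [smul_smul]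
  have hbound : ∑ w ∈ X.erase x, (l * t w) * Real.cosh (dist x w) ≤ 1 := by
    have h1 : ∑ w ∈ X.erase x, (l * t w) * Real.cosh (dist x w) ≤
        ∑ w ∈ X.erase x, (l * t w) * (κ * (rotor v x * gans x w).re) := by
      refine Finset.sum_le_sum fun w hw => ?_
      rw [Finset.mem_erase] at hw
      exact mul_le_mul_of_nonneg_left (hκ w hw.2 hw.1) (mul_nonneg hl (ht w hw.2))
    have h2 : ∑ w ∈ X.erase x, (l * t w) * (κ * (rotor v x * gans x w).re) =
        κ * (rotor v x * gans x p).re := by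
      rw [hsum, Finset.mul_sum, Complex.re_sum, Finset.mul_sum]
      refine Finset.sum_congr rfl fun w _ => ?_
      rw [Complex.real_smul, mul_left_comm (rotor v x), Complex.re_ofReal_mul]; ring
    have h3 : (rotor v x * gans x p).re ≤ κ⁻¹ := by
      refine (Complex.re_le_norm _).trans ?_
      rw [norm_mul]
      exact (mul_le_of_le_one_left (norm_nonneg _) hrot1).trans hsmall.le
    rw [h2] at h1
    refine h1.trans ((mul_le_mul_of_nonneg_left h3 hκ0.le).trans ?_)
    rw [mul_inv_cancel₀ hκ0.ne']
  -- The bound `hbound` makes the coefficient of `lorentzVec x` nonnegative, as `cosh` is at least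
  -- one.
  have hp : lorentzVec p = (Real.cosh (dist x p) -
      ∑ w ∈ X.erase x, (l * t w) * Real.cosh (dist x w)) • lorentzVec x +
      ∑ w ∈ X.erase x, (l * t w) • lorentzVec w := by
    have h0 : tangentProj x (lorentzVec x) = 0 := gans_self x
    refine lorentzVec_ext x ?_ ?_
    · simp only [map_add, map_smul, map_sum, lorentzForm_self, smul_eq_mul, ← cosh_dist_eq]; ring
    · rw [map_add, map_smul, h0, smul_zero, zero_add, map_sum]
      simp only [map_smul]
      exact hsum
  refine mem_geodesicHull_finset.2 ⟨fun w => if w = x then Real.cosh (dist x p) -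
      ∑ w ∈ X.erase x, (l * t w) * Real.cosh (dist x w) else l * t w, fun w hw => ?_, ?_⟩
  · simp only
    split_ifs with hwx
    · linarith [Real.one_le_cosh (dist x p)]
    · exact mul_nonneg hl (ht w hw)
  · rw [← Finset.sum_erase_add _ _ hx]
    simp only [if_true]
    rw [add_comm, hp]
    congr 1
    refine Finset.sum_congr rfl fun w hw => ?_
    rw [if_neg (Finset.mem_erase.1 hw).1]

/-! ### Dilations -/

/-- The inverse of the projection chart. -/
def gansInv (x : ℍ) (P : ℂ) : ℍ := (exists_gans_eq x P).choose

@[simp] theorem gans_gansInv (x : ℍ) (P : ℂ) : gans x (gansInv x P) = P :=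
  (exists_gans_eq x P).choose_spec

@[simp] theorem gansInv_gans (x p : ℍ) : gansInv x (gans x p) = p :=
  gans_injective x (gans_gansInv _ _)

theorem continuous_gansInv (x : ℍ) : Continuous (gansInv x) := by
  have hx := x.im_pos
  have h0 : ∀ P : ℂ, 0 < √(1 + ‖P‖ ^ 2) - P.im := fun P => by
    rw [sub_pos]
    refine (le_abs_self _).trans_lt (Real.lt_sqrt_of_sq_lt ?_)
    rw [sq_abs, Complex.sq_norm, Complex.normSq_apply]
    nlinarith [mul_self_nonneg P.re]
  have heq : gansInv x = fun P => ⟨⟨x.re + P.re * (x.im / (√(1 + ‖P‖ ^ 2) - P.im)),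
      x.im / (√(1 + ‖P‖ ^ 2) - P.im)⟩, div_pos hx (h0 P)⟩ := by
    funext P
    apply gans_injective x
    have h2 := (h0 P).ne'
    have hs : √(1 + ‖P‖ ^ 2) ^ 2 = 1 + (P.re ^ 2 + P.im ^ 2) := by
      rw [Real.sq_sqrt (by positivity), Complex.sq_norm, Complex.normSq_apply]; ring
    rw [gans_gansInv, gans_eq]
    simp only [UpperHalfPlane.mk_re, UpperHalfPlane.mk_im]
    set s := √(1 + ‖P‖ ^ 2)
    apply Complex.ext
    · simp only; field_simp; ring
    · simp only; field_simp
      linear_combination (x.im ^ 2) * hs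
  rw [heq]
  refine Continuous.upperHalfPlaneMk ?_ _
  have : (fun P : ℂ => (⟨x.re + P.re * (x.im / (√(1 + ‖P‖ ^ 2) - P.im)),
      x.im / (√(1 + ‖P‖ ^ 2) - P.im)⟩ : ℂ)) = fun P => Complex.equivRealProdCLM.symm
      (x.re + P.re * (x.im / (√(1 + ‖P‖ ^ 2) - P.im)), x.im / (√(1 + ‖P‖ ^ 2) - P.im)) := by
    funext P; rfl
  rw [this]
  refine Complex.equivRealProdCLM.symm.continuous.comp ?_
  have h1 : ∀ P : ℂ, √(1 + ‖P‖ ^ 2) - P.im ≠ 0 := fun P => (h0 P).ne'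
  fun_prop (disch := exact h1 _)

/-- The dilation with center `x` in the projection chart. -/
def dilate (x : ℍ) (τ : ℝ) (p : ℍ) : ℍ := gansInv x (τ • gans x p)

@[simp] theorem gans_dilate (x p : ℍ) (τ : ℝ) : gans x (dilate x τ p) = τ • gans x p :=
  gans_gansInv _ _

theorem continuous_dilate (x : ℍ) (τ : ℝ) : Continuous (dilate x τ) :=
  (continuous_gansInv x).comp ((continuous_gans x).const_smul τ)

theorem continuous_dilate_left (x p : ℍ) : Continuous fun τ => dilate x τ p :=
  (continuous_gansInv x).comp (continuous_id.smul continuous_const)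

@[simp] theorem dilate_one (x p : ℍ) : dilate x 1 p = p := by
  rw [dilate, one_smul, gansInv_gans]

theorem dilate_dilate (x p : ℍ) (σ τ : ℝ) : dilate x σ (dilate x τ p) = dilate x (σ * τ) p := by
  rw [dilate, gans_dilate, smul_smul]; rfl

@[simp] theorem dilate_self (x : ℍ) (τ : ℝ) : dilate x τ x = x := by
  apply gans_injective x; simp

theorem dilate_eq_iff {x p : ℍ} {τ : ℝ} (hτ : τ ≠ 0) : dilate x τ p = x ↔ p = x := by
  rw [← gans_eq_zero_iff, gans_dilate, smul_eq_zero, or_iff_right hτ, gans_eq_zero_iff]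

theorem dilate_mem_geodesicArc (x p : ℍ) {τ : ℝ} (h0 : 0 ≤ τ) (h1 : τ ≤ 1) :
    dilate x τ p ∈ geodesicArc x p := by
  have h := lorentzVec_eq_of_gans (gans_dilate x p τ)
  refine mem_geodesicArc_iff_lorentzVec.2 ⟨_, _, ?_, h0, h⟩
  rw [cosh_dist_eq_sqrt, cosh_dist_eq_sqrt, gans_dilate, norm_smul, Real.norm_eq_abs, mul_pow,
    sq_abs, sub_nonneg]
  apply Real.le_sqrt_of_sq_le
  rw [mul_pow, Real.sq_sqrt (by positivity)]
  have : τ ^ 2 ≤ 1 := pow_le_one₀ h0 h1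
  nlinarith [sq_nonneg ‖gans x p‖]

theorem exists_dilate_of_mem_geodesicArc {x p q : ℍ} (h : q ∈ geodesicArc x p) :
    ∃ τ : ℝ, 0 ≤ τ ∧ τ ≤ 1 ∧ q = dilate x τ p := by
  obtain ⟨s, t, hs, ht, h1⟩ := mem_geodesicArc_iff_lorentzVec.1 h
  have hg : gans x q = t • gans x p := by rw [gans_combo h1, gans_self, smul_zero, zero_add]
  have hq : q = dilate x t p := gans_injective x (by rw [hg, gans_dilate])
  rcases eq_or_ne p x with rfl | hpx
  · exact ⟨0, le_rfl, zero_le_one, by rw [hq]; simp⟩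
  refine ⟨t, ht, ?_, hq⟩
  have h2 : dist x q ≤ dist x p := by
    have h : dist x q + dist q p = dist x p := h
    have := dist_nonneg (x := q) (y := p)
    linarith
  rw [← Real.sinh_le_sinh, ← norm_gans, ← norm_gans, hg, norm_smul, Real.norm_eq_abs,
    abs_of_nonneg ht] at h2
  have : 0 < ‖gans x p‖ := norm_pos_iff.2 fun h => hpx (gans_eq_zero_iff.1 h)
  by_contra hcon
  nlinarith

end

section
open MeasureTheory Filter Topology

/-! ### Perturbations in Minkowski space -/

theorem isOpen_timelikeCone : IsOpen timelikeCone := by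
  have h1 : Continuous fun u : ℝ × ℝ × ℝ => u.2.1 ^ 2 := by fun_prop
  have h2 : Continuous fun u : ℝ × ℝ × ℝ => u.1 * u.2.2 := by fun_prop
  exact (isOpen_lt continuous_const continuous_fst).inter (isOpen_lt h1 h2)

/-- The point of the hyperbolic plane in the direction of a timelike vector. -/
def ofVec (u : ℝ × ℝ × ℝ) : ℍ := kleinInv (u.2.1 / u.1, u.2.2 / u.1)

theorem ofVec_smul_lorentzVec {l : ℝ} (hl : l ≠ 0) (p : ℍ) : ofVec (l • lorentzVec p) = p := by
  have hp := p.im_ne_zero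
  rw [ofVec]
  convert! kleinInv_klein p using 2
  ext
  · simp [lorentzVec, klein]; field_simp
  · simp [lorentzVec, klein]; field_simp

theorem continuousAt_ofVec (p : ℍ) : ContinuousAt ofVec (lorentzVec p) := by
  have h1 : (lorentzVec p).1 ≠ 0 := (lorentzVec_mem_timelikeCone p).1.ne'
  have h2 : ((lorentzVec p).2.1 / (lorentzVec p).1, (lorentzVec p).2.2 / (lorentzVec p).1) ∈
      kleinRegion := by
    have hp := p.im_ne_zero
    convert! klein_mem p using 1
    ext
    · simp [lorentzVec, klein]; field_simp
    · simp [lorentzVec, klein]; field_simp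
  have h3 : ContinuousAt (fun u : ℝ × ℝ × ℝ => (u.2.1 / u.1, u.2.2 / u.1)) (lorentzVec p) := by
    refine ContinuousAt.prodMk (ContinuousAt.div (by fun_prop) (by fun_prop) h1)
      (ContinuousAt.div (by fun_prop) (by fun_prop) h1)
  exact ContinuousAt.comp (g := kleinInv) (f := fun u : ℝ × ℝ × ℝ => (u.2.1 / u.1, u.2.2 / u.1))
    (continuousOn_kleinInv.continuousAt (isOpen_kleinRegion.mem_nhds h2)) h3

/-- Since the timelike cone is open, `u` may be any vector, not only a tangent one; the factor `l`
restores the norm. -/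
theorem eventually_perturb (p : ℍ) (u : ℝ × ℝ × ℝ) {U : Set ℍ} (hU : U ∈ 𝓝 p) :
    ∀ᶠ ε : ℝ in 𝓝[>] 0, ∃ l : ℝ, 0 < l ∧ ∃ p' ∈ U, lorentzVec p + ε • u = l • lorentzVec p' := by
  have hc : Continuous fun ε : ℝ => lorentzVec p + ε • u := by fun_prop
  have ht : Tendsto (fun ε : ℝ => lorentzVec p + ε • u) (𝓝[>] 0) (𝓝 (lorentzVec p)) := by
    have := hc.tendsto 0
    rw [zero_smul, add_zero] at this
    exact this.mono_left nhdsWithin_le_nhds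
  have h1 := ht.eventually (isOpen_timelikeCone.mem_nhds (lorentzVec_mem_timelikeCone p))
  have h2 : ∀ᶠ ε : ℝ in 𝓝[>] 0, ofVec (lorentzVec p + ε • u) ∈ U := by
    have h3 := (continuousAt_ofVec p).tendsto.comp ht
    have h4 : ofVec (lorentzVec p) = p := by simpa using ofVec_smul_lorentzVec one_ne_zero p
    rw [h4] at h3
    exact h3.eventually hU
  filter_upwards [h1, h2] with ε h1 h2
  obtain ⟨l, hl, p', hp'⟩ := exists_smul_lorentzVec h1
  refine ⟨l, hl, p', ?_, hp'⟩
  rwa [hp', ofVec_smul_lorentzVec hl.ne'] at h2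

/-- A linear form which is nonnegative near a zero on the hyperboloid is zero. -/
theorem linearForm_eq_zero {l : ℝ × ℝ × ℝ →ₗ[ℝ] ℝ} {p : ℍ} (h0 : l (lorentzVec p) = 0)
    (h : ∀ᶠ q in 𝓝 p, 0 ≤ l (lorentzVec q)) : l = 0 := by
  have key : ∀ u, 0 ≤ l u := fun u => by
    obtain ⟨ε, ⟨t, ht, p', hp', hu⟩, hε⟩ :=
      ((eventually_perturb p u h).and self_mem_nhdsWithin).exists
    have h1 := congrArg l hu
    rw [map_add, map_smul, map_smul, h0, zero_add, smul_eq_mul, smul_eq_mul] at h1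
    have h2 : 0 ≤ ε * l u := h1 ▸ mul_nonneg ht.le hp'
    exact nonneg_of_mul_nonneg_right h2 hε
  refine LinearMap.ext fun u => le_antisymm ?_ (key u)
  have := key (-u)
  rw [map_neg] at this
  simpa using this

theorem exists_eq_lorentzForm (l : ℝ × ℝ × ℝ →ₗ[ℝ] ℝ) : ∃ u, l = lorentzForm u := by
  refine ⟨(2 * l (0, 0, 1), -l (0, 1, 0), 2 * l (1, 0, 0)), LinearMap.ext fun w => ?_⟩
  have hw : w = w.1 • (1, 0, 0) + w.2.1 • (0, 1, 0) + w.2.2 • ((0, 0, 1) : ℝ × ℝ × ℝ) := by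
    ext <;> simp
  conv_lhs => rw [hw]
  simp only [map_add, map_smul, smul_eq_mul, lorentzForm_apply]
  ring

theorem lorentzForm_injective {u w : ℝ × ℝ × ℝ} (h : lorentzForm u = lorentzForm w) : u = w := by
  have h1 := LinearMap.congr_fun h (1, 0, 0)
  have h2 := LinearMap.congr_fun h (0, 1, 0)
  have h3 := LinearMap.congr_fun h (0, 0, 1)
  simp only [lorentzForm_apply] at h1 h2 h3
  ext <;> linarith

theorem eq_of_smul_lorentzVec_eq {p q : ℍ} {s t : ℝ} (hs : 0 < s) (ht : 0 < t)
    (h : s • lorentzVec p = t • lorentzVec q) : p = q := by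
  rw [← ofVec_smul_lorentzVec hs.ne' p, h, ofVec_smul_lorentzVec ht.ne' q]

/-- Cramer's rule in three-dimensional Minkowski space, where `orient` is a fixed multiple of the
determinant. -/
theorem orient_smul_lorentzVec (x y z q : ℍ) : orient x y z • lorentzVec q =
    orient q y z • lorentzVec x + orient x q z • lorentzVec y + orient x y q • lorentzVec z := by
  have hx := x.im_ne_zero
  have hy := y.im_ne_zero
  have hz := z.im_ne_zero
  have hq := q.im_ne_zero
  simp only [orient_eq]
  ext
  · simp [lorentzVec]; field_simp; ring
  · simp [lorentzVec]; field_simp; ring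
  · simp [lorentzVec]; field_simp; ring

theorem eq_zero_of_orient_ne_zero {l : ℝ × ℝ × ℝ →ₗ[ℝ] ℝ} {x y z : ℍ} (h : orient x y z ≠ 0)
    (hx : l (lorentzVec x) = 0) (hy : l (lorentzVec y) = 0) (hz : l (lorentzVec z) = 0) :
    l = 0 := by
  refine linearForm_eq_zero (p := x) hx (.of_forall fun q => ?_)
  have := congrArg l (orient_smul_lorentzVec x y z q)
  simp only [map_add, map_smul, hx, hy, hz, smul_eq_mul, mul_zero, add_zero] at this
  exact ((mul_eq_zero.1 this).resolve_left h).ge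

/-- A point of the hyperbolic plane is determined by three points at equal distance from it. -/
theorem circumcenter_unique {a b c p q : ℍ} (hab : a ≠ b) (hac : a ≠ c) (hbc : b ≠ c)
    (hp1 : dist p b = dist p a) (hp2 : dist p c = dist p a)
    (hq1 : dist q b = dist q a) (hq2 : dist q c = dist q a) : p = q := by
  have ho := orient_ne_zero hp1 hp2 hab hac hbc
  rw [dist_eq_dist_iff_lorentzForm] at hp1 hp2 hq1 hq2
  have hP := lorentzForm_pos p a
  have hQ := lorentzForm_pos q a
  -- The form attached to `⟨q, a⟩ p - ⟨p, a⟩ q` vanishes at three independent vectors, so `p` and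
  -- `q` are proportional.
  have h := eq_zero_of_orient_ne_zero ho
    (l := lorentzForm (lorentzForm (lorentzVec q) (lorentzVec a) • lorentzVec p -
      lorentzForm (lorentzVec p) (lorentzVec a) • lorentzVec q))
    (by simp only [map_sub, map_smul, LinearMap.sub_apply, LinearMap.smul_apply, smul_eq_mul]; ring)
    (by simp only [map_sub, map_smul, LinearMap.sub_apply, LinearMap.smul_apply, smul_eq_mul,
          hp1, hq1]; ring)
    (by simp only [map_sub, map_smul, LinearMap.sub_apply, LinearMap.smul_apply, smul_eq_mul,
          hp2, hq2]; ring)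
  have h2 := lorentzForm_injective (w := 0) (by rw [h, map_zero])
  exact eq_of_smul_lorentzVec_eq hQ hP (sub_eq_zero.1 h2)

/-! ### Nets and nearest points -/

/-- A locally finite and relatively dense set. -/
structure IsNet (S : Set ℍ) : Prop where
  finite_inter : ∀ (p : ℍ) (r : ℝ), (S ∩ Metric.closedBall p r).Finite
  exists_dist_le : ∃ D : ℝ, ∀ p : ℍ, ∃ x ∈ S, dist p x ≤ D

variable {S : Set ℍ}

theorem IsNet.nonempty (hS : IsNet S) : S.Nonempty := by
  obtain ⟨D, hD⟩ := hS.exists_dist_le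
  obtain ⟨x, hx, -⟩ := hD UpperHalfPlane.I
  exact ⟨x, hx⟩

theorem IsNet.countable (hS : IsNet S) : S.Countable := by
  have : S = ⋃ n : ℕ, S ∩ Metric.closedBall UpperHalfPlane.I n := by
    ext x
    simp only [Set.mem_iUnion, Set.mem_inter_iff, Metric.mem_closedBall, exists_and_left]
    exact ⟨fun h => ⟨h, exists_nat_ge _⟩, fun h => h.1⟩
  rw [this]
  exact Set.countable_iUnion fun n => (hS.finite_inter _ _).countable

theorem IsNet.exists_infDist_eq (hS : IsNet S) (p : ℍ) : ∃ x ∈ S, Metric.infDist p S = dist p x := by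
  obtain ⟨y, hy⟩ := hS.nonempty
  have hfin := hS.finite_inter p (dist p y)
  have hy' : y ∈ S ∩ Metric.closedBall p (dist p y) := ⟨hy, by rw [Metric.mem_closedBall, dist_comm]⟩
  obtain ⟨x, hx, hmin⟩ := Set.exists_min_image _ (fun x => dist p x) hfin ⟨y, hy'⟩
  refine ⟨x, hx.1, le_antisymm (Metric.infDist_le_dist_of_mem hx.1) ?_⟩
  rw [Metric.le_infDist ⟨y, hy⟩]
  intro z hz
  by_cases h : dist p z ≤ dist p y
  · exact hmin z ⟨hz, by rwa [Metric.mem_closedBall, dist_comm]⟩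
  · exact (hmin y hy').trans (not_le.1 h).le

theorem IsNet.mem_delaunayVertices (hS : IsNet S) {p x : ℍ} :
    x ∈ delaunayVertices S p ↔ x ∈ S ∧ dist p x = Metric.infDist p S := by
  constructor
  · rintro ⟨hx, h⟩
    refine ⟨hx, le_antisymm ?_ (Metric.infDist_le_dist_of_mem hx)⟩
    rw [Metric.le_infDist ⟨x, hx⟩]
    exact fun y hy => h y hy
  · rintro ⟨hx, h⟩
    exact ⟨hx, fun y hy => h ▸ Metric.infDist_le_dist_of_mem hy⟩

theorem IsNet.delaunayVertices_subset (hS : IsNet S) (p : ℍ) :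
    delaunayVertices S p ⊆ S ∩ Metric.closedBall p (Metric.infDist p S) := fun x hx => by
  rw [hS.mem_delaunayVertices] at hx
  exact ⟨hx.1, by rw [Metric.mem_closedBall, dist_comm, hx.2]⟩

theorem IsNet.finite_delaunayVertices (hS : IsNet S) (p : ℍ) : (delaunayVertices S p).Finite :=
  (hS.finite_inter p _).subset (hS.delaunayVertices_subset p)

theorem IsNet.delaunayVertices_nonempty (hS : IsNet S) (p : ℍ) :
    (delaunayVertices S p).Nonempty := by
  obtain ⟨x, hx, h⟩ := hS.exists_infDist_eq p
  exact ⟨x, hS.mem_delaunayVertices.2 ⟨hx, h.symm⟩⟩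

theorem IsNet.mem_voronoiVertices (hS : IsNet S) {v : ℍ} :
    v ∈ voronoiVertices S ↔ ∃ x ∈ delaunayVertices S v, ∃ y ∈ delaunayVertices S v,
      ∃ z ∈ delaunayVertices S v, x ≠ y ∧ x ≠ z ∧ y ≠ z := by
  constructor
  · rintro ⟨x, hx, y, hy, z, hz, h1, h2, h3, ⟨h4, h5⟩, h6⟩
    exact ⟨x, ⟨hx, h4⟩, y, ⟨hy, h5⟩, z, ⟨hz, h6⟩, h1, h2, h3⟩
  · rintro ⟨x, ⟨hx, h4⟩, y, ⟨hy, h5⟩, z, ⟨hz, h6⟩, h1, h2, h3⟩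
    exact ⟨x, hx, y, hy, z, hz, h1, h2, h3, ⟨h4, h5⟩, h6⟩

/-- The vertices of a Delaunay polygon form a cyclic polygon. -/
theorem IsNet.exists_finset_vertices (hS : IsNet S) {v : ℍ} (hv : v ∈ voronoiVertices S) :
    ∃ X : Finset ℍ, (X : Set ℍ) = delaunayVertices S v ∧ 3 ≤ X.card ∧ 0 < Metric.infDist v S ∧
      ∀ w ∈ X, dist v w = Metric.infDist v S := by
  classical
  obtain ⟨x, hx, y, hy, z, hz, h1, h2, h3⟩ := hS.mem_voronoiVertices.1 hv
  have hfin := hS.finite_delaunayVertices v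
  refine ⟨hfin.toFinset, hfin.coe_toFinset, ?_, ?_, ?_⟩
  · have : ({x, y, z} : Finset ℍ) ⊆ hfin.toFinset := by
      intro w hw
      simp only [Finset.mem_insert, Finset.mem_singleton] at hw
      rw [hfin.mem_toFinset]
      rcases hw with rfl | rfl | rfl <;> assumption
    have h := Finset.card_le_card this
    rwa [Finset.card_eq_three.2 ⟨x, y, z, h1, h2, h3, rfl⟩] at h
  · refine Metric.infDist_nonneg.lt_of_ne fun h0 => h1 ?_
    have hx' := (hS.mem_delaunayVertices.1 hx).2
    have hy' := (hS.mem_delaunayVertices.1 hy).2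
    rw [← h0, dist_eq_zero] at hx' hy'
    rw [← hx', ← hy']
  · intro w hw
    exact (hS.mem_delaunayVertices.1 (hfin.mem_toFinset.1 hw)).2

theorem IsNet.lorentzForm_eq (hS : IsNet S) {p x : ℍ} (hx : x ∈ delaunayVertices S p) :
    lorentzForm (lorentzVec p) (lorentzVec x) = Real.cosh (Metric.infDist p S) := by
  rw [← cosh_dist_eq, (hS.mem_delaunayVertices.1 hx).2]

theorem IsNet.le_lorentzForm (_ : IsNet S) (p : ℍ) {x : ℍ} (hx : x ∈ S) :
    Real.cosh (Metric.infDist p S) ≤ lorentzForm (lorentzVec p) (lorentzVec x) := by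
  rw [← cosh_dist_eq, Real.cosh_le_cosh, abs_of_nonneg Metric.infDist_nonneg,
    abs_of_nonneg dist_nonneg]
  exact Metric.infDist_le_dist_of_mem hx

/-- Only finitely many net points compete near `p`, and each one that is not nearest to `p` stays so
nearby. -/
theorem IsNet.eventually_delaunayVertices_subset (hS : IsNet S) (p : ℍ) :
    ∀ᶠ q in 𝓝 p, delaunayVertices S q ⊆ delaunayVertices S p := by
  set r := Metric.infDist p S + 2
  have hfin := hS.finite_inter p r
  have hcd : ∀ x : ℍ, Continuous fun q : ℍ => dist q x - Metric.infDist q S := fun x =>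
    (continuous_id.dist continuous_const).sub (Metric.continuous_infDist_pt S)
  have h1 : ∀ x ∈ S ∩ Metric.closedBall p r, ∀ᶠ q in 𝓝 p,
      x ∈ delaunayVertices S q → x ∈ delaunayVertices S p := by
    intro x hx
    by_cases hxp : x ∈ delaunayVertices S p
    · exact .of_forall fun _ _ => hxp
    · have : 0 < dist p x - Metric.infDist p S := by
        refine (sub_nonneg.2 (Metric.infDist_le_dist_of_mem hx.1)).lt_of_ne fun h => hxp ?_
        exact hS.mem_delaunayVertices.2 ⟨hx.1, by linarith⟩
      filter_upwards [(hcd x).continuousAt.eventually (lt_mem_nhds this)] with q hq hxq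
      rw [(hS.mem_delaunayVertices.1 hxq).2] at hq
      simp at hq
  have h2 := (eventually_all_finite hfin).2 h1
  filter_upwards [h2, Metric.ball_mem_nhds p one_pos] with q hq hball x hx
  refine hq x ⟨hx.1, ?_⟩ hx
  have h3 := (hS.mem_delaunayVertices.1 hx).2
  have h4 := Metric.infDist_le_infDist_add_dist (s := S) (x := q) (y := p)
  rw [Metric.mem_ball] at hball
  rw [Metric.mem_closedBall, dist_comm]
  have h5 := dist_triangle p q x
  rw [dist_comm p q] at h5
  simp only [r]
  linarith

/-! ### Delaunay polygons -/

theorem IsNet.mem_delaunayPolygon (hS : IsNet S) {v q : ℍ} : q ∈ delaunayPolygon S v ↔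
    ∃ t : ℍ → ℝ, (∀ x ∈ (hS.finite_delaunayVertices v).toFinset, 0 ≤ t x) ∧
      lorentzVec q = ∑ x ∈ (hS.finite_delaunayVertices v).toFinset, t x • lorentzVec x := by
  rw [← mem_geodesicHull_finset, Set.Finite.coe_toFinset]; rfl

/-- On a Delaunay polygon, the normalized distance function of its center is minimal. -/
theorem IsNet.delaunay_le (hS : IsNet S) {v q : ℍ} (hq : q ∈ delaunayPolygon S v) (p : ℍ) :
    lorentzForm (lorentzVec v) (lorentzVec q) * Real.cosh (Metric.infDist p S) ≤
      lorentzForm (lorentzVec p) (lorentzVec q) * Real.cosh (Metric.infDist v S) := by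
  obtain ⟨t, ht, hqt⟩ := hS.mem_delaunayPolygon.1 hq
  have hv : ∀ x ∈ (hS.finite_delaunayVertices v).toFinset, x ∈ delaunayVertices S v :=
    fun x hx => (Set.Finite.mem_toFinset _).1 hx
  have h1 : lorentzForm (lorentzVec v) (lorentzVec q) =
      (∑ x ∈ (hS.finite_delaunayVertices v).toFinset, t x) * Real.cosh (Metric.infDist v S) := by
    rw [hqt, map_sum, Finset.sum_mul]
    exact Finset.sum_congr rfl fun x hx => by
      rw [map_smul, smul_eq_mul, hS.lorentzForm_eq (hv x hx)]
  have h2 : (∑ x ∈ (hS.finite_delaunayVertices v).toFinset, t x) *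
      Real.cosh (Metric.infDist p S) ≤ lorentzForm (lorentzVec p) (lorentzVec q) := by
    rw [hqt, map_sum, Finset.sum_mul]
    refine Finset.sum_le_sum fun x hx => ?_
    rw [map_smul, smul_eq_mul]
    exact mul_le_mul_of_nonneg_left (hS.le_lorentzForm p (hv x hx).1) (ht x hx)
  rw [h1]
  nlinarith [Real.cosh_pos (Metric.infDist v S)]

/-- Equality at an interior point gives a linear form that is nonnegative nearby and zero at the
point. It vanishes identically, which makes the vectors of `p` and `v` proportional. -/
theorem IsNet.delaunay_lt (hS : IsNet S) {v q p : ℍ} (hq : q ∈ interior (delaunayPolygon S v))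
    (hpv : p ≠ v) : lorentzForm (lorentzVec v) (lorentzVec q) * Real.cosh (Metric.infDist p S) <
      lorentzForm (lorentzVec p) (lorentzVec q) * Real.cosh (Metric.infDist v S) := by
  refine (hS.delaunay_le (interior_subset hq) p).lt_of_ne fun h => hpv ?_
  have h1 := linearForm_eq_zero (p := q) (l := lorentzForm
    (Real.cosh (Metric.infDist v S) • lorentzVec p -
      Real.cosh (Metric.infDist p S) • lorentzVec v)) (by
      simp only [map_sub, map_smul, LinearMap.sub_apply, LinearMap.smul_apply, smul_eq_mul]
      linarith) (by
      filter_upwards [mem_interior_iff_mem_nhds.1 hq] with q' hq'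
      have := hS.delaunay_le hq' p
      simp only [map_sub, map_smul, LinearMap.sub_apply, LinearMap.smul_apply, smul_eq_mul]
      linarith)
  have h2 := lorentzForm_injective (w := 0) (by rw [h1, map_zero])
  exact eq_of_smul_lorentzVec_eq (Real.cosh_pos _) (Real.cosh_pos _) (sub_eq_zero.1 h2)

/-- At a common point both centers would minimize the normalized distance, one of them strictly.
Neither point has to be a Voronoi vertex, which allows degenerate polygons for `w`. -/
theorem IsNet.disjoint_interior (hS : IsNet S) {v w : ℍ} (h : v ≠ w) :
    Disjoint (interior (delaunayPolygon S v)) (delaunayPolygon S w) := by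
  rw [Set.disjoint_left]
  intro q hv hw
  have h1 := hS.delaunay_lt hv h.symm
  have h2 := hS.delaunay_le hw v
  linarith

theorem IsNet.dist_le_of_mem_delaunayPolygon (hS : IsNet S) {v q : ℍ}
    (hq : q ∈ delaunayPolygon S v) : dist v q ≤ Metric.infDist v S := by
  have h := hS.delaunay_le hq q
  rw [lorentzForm_self, one_mul, ← cosh_dist_eq] at h
  have h1 := Real.one_le_cosh (Metric.infDist q S)
  have h2 := Real.cosh_pos (dist v q)
  have : Real.cosh (dist v q) ≤ Real.cosh (Metric.infDist v S) := by nlinarith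
  rwa [Real.cosh_le_cosh, abs_of_nonneg dist_nonneg, abs_of_nonneg Metric.infDist_nonneg] at this

theorem IsNet.isCompact_delaunayPolygon (hS : IsNet S) (v : ℍ) :
    IsCompact (delaunayPolygon S v) := isCompact_geodesicHull (hS.finite_delaunayVertices v)

/-- A point of the net on a Delaunay polygon is a vertex of it. -/
theorem IsNet.mem_delaunayVertices_of_mem_polygon (hS : IsNet S) {v x : ℍ} (hx : x ∈ S)
    (h : x ∈ delaunayPolygon S v) : x ∈ delaunayVertices S v := by
  have h1 := hS.delaunay_le h x
  have h2 : Metric.infDist x S = 0 := Metric.infDist_zero_of_mem hx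
  rw [h2, Real.cosh_zero, mul_one, lorentzForm_self, one_mul, ← cosh_dist_eq, Real.cosh_le_cosh,
    abs_of_nonneg dist_nonneg, abs_of_nonneg Metric.infDist_nonneg] at h1
  exact hS.mem_delaunayVertices.2 ⟨hx, le_antisymm h1 (Metric.infDist_le_dist_of_mem hx)⟩

/-- A Voronoi vertex is the circumcenter of its nearest net points, hence is determined by that set,
and the sets that occur are subsets of one finite set. -/
theorem IsNet.finite_voronoiVertices_inter (hS : IsNet S) (p : ℍ) (r : ℝ) :
    (voronoiVertices S ∩ Metric.closedBall p r).Finite := by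
  obtain ⟨D, hD⟩ := hS.exists_dist_le
  refine Set.Finite.of_finite_image (f := delaunayVertices S)
    ((hS.finite_inter p (r + D)).finite_subsets.subset ?_) ?_
  · rintro _ ⟨v, ⟨-, hv⟩, rfl⟩ x hx
    refine ⟨hx.1, ?_⟩
    have h1 := (hS.mem_delaunayVertices.1 hx).2
    obtain ⟨y, hy, hyD⟩ := hD v
    have h2 := Metric.infDist_le_dist_of_mem (x := v) hy
    rw [Metric.mem_closedBall] at hv ⊢
    have := dist_triangle x v p
    rw [dist_comm x v] at this
    linarith
  · rintro v ⟨hv, -⟩ w - (h : delaunayVertices S v = delaunayVertices S w)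
    obtain ⟨x, hx, y, hy, z, hz, h1, h2, h3⟩ := hS.mem_voronoiVertices.1 hv
    have hx' := h ▸ hx
    have hy' := h ▸ hy
    have hz' := h ▸ hz
    rw [hS.mem_delaunayVertices] at hx hy hz hx' hy' hz'
    exact circumcenter_unique h1 h2 h3 (by rw [hy.2, hx.2]) (by rw [hz.2, hx.2])
      (by rw [hy'.2, hx'.2]) (by rw [hz'.2, hx'.2])

end

section
open MeasureTheory Filter Topology

variable {S : Set ℍ}

/-! ### Interiors of polygons -/

theorem continuous_linearForm (l : ℝ × ℝ × ℝ →ₗ[ℝ] ℝ) : Continuous fun q => l (lorentzVec q) :=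
  l.continuous_of_finiteDimensional.comp continuous_lorentzVec

theorem continuous_orient (a b : ℍ) : Continuous (orient a b) :=
  continuous_linearForm (orientForm a b)

theorem orient_rotate' (x y q : ℍ) : orient x q y = orient y x q := by
  rw [orient_rotate, orient_rotate]

theorem ne_of_orient_ne_zero {x y z : ℍ} (h : orient x y z ≠ 0) : x ≠ y ∧ x ≠ z ∧ y ≠ z := by
  refine ⟨?_, ?_, ?_⟩ <;> rintro rfl
  · rw [orient_rotate, orient_self_left] at h; exact h rfl
  · rw [orient_self_left] at h; exact h rfl
  · rw [orient_self_right] at h; exact h rfl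

theorem mem_interior_geodesicHull {X : Set ℍ} {x y z q : ℍ} (hx : x ∈ X) (hy : y ∈ X) (hz : z ∈ X)
    (h : 0 < orient x y z) (h1 : 0 < orient q y z) (h2 : 0 < orient x q z)
    (h3 : 0 < orient x y q) : q ∈ interior (geodesicHull X) := by
  rw [mem_interior_iff_mem_nhds]
  rw [orient_rotate] at h1
  rw [orient_rotate'] at h2
  obtain ⟨hxy, hxz, hyz⟩ := ne_of_orient_ne_zero h.ne'
  filter_upwards [(continuous_orient y z).continuousAt.eventually (lt_mem_nhds h1),
    (continuous_orient z x).continuousAt.eventually (lt_mem_nhds h2),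
    (continuous_orient x y).continuousAt.eventually (lt_mem_nhds h3)] with q' h1 h2 h3
  have hsub : geodesicHull {x, y, z} ⊆ geodesicHull X := geodesicHull_mono (by
    rintro w (rfl | rfl | rfl) <;> assumption)
  refine hsub ((mem_geodesicHull_triple hxy hxz hyz).2 ⟨_, _, _, (div_pos h1 h).le,
    (div_pos h2 h).le, (div_pos h3 h).le, ?_⟩)
  have key := orient_smul_lorentzVec x y z q'
  rw [orient_rotate q', orient_rotate' x z q'] at key
  rw [div_eq_inv_mul, div_eq_inv_mul, div_eq_inv_mul, mul_smul, mul_smul, mul_smul, ← smul_add,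
    ← smul_add, ← key, inv_smul_smul₀ h.ne']

/-- The witness is the barycenter, the normalized sum of the three vectors. -/
theorem interior_geodesicHull_nonempty {X : Set ℍ} {x y z : ℍ} (hx : x ∈ X) (hy : y ∈ X)
    (hz : z ∈ X) (h : orient x y z ≠ 0) : (interior (geodesicHull X)).Nonempty := by
  wlog h0 : 0 < orient x y z generalizing y z
  · refine this hz hy ?_ ?_
    · rwa [orient_swap_right, neg_ne_zero]
    · rw [orient_swap_right]
      have := lt_of_le_of_ne (not_lt.1 h0) h
      linarith
  have hmem : lorentzVec x + lorentzVec y + lorentzVec z ∈ timelikeCone := by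
    have h1 := add_mem_timelikeCone (lorentzVec_mem_timelikeCone x) (lorentzVec_mem_timelikeCone y)
    exact add_mem_timelikeCone h1 (lorentzVec_mem_timelikeCone z)
  obtain ⟨l, hl, q, hq⟩ := exists_smul_lorentzVec hmem
  have key : ∀ a b, orient a b x + orient a b y + orient a b z = l * orient a b q := fun a b => by
    have := congrArg (orientForm a b) hq
    rwa [map_add, map_add, map_smul] at this
  refine ⟨q, mem_interior_geodesicHull hx hy hz h0 ?_ ?_ ?_⟩
  · rw [orient_rotate]
    have := key y z
    rw [orient_self_left, orient_self_right, ← orient_rotate x y z] at this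
    exact pos_of_mul_pos_right (by linarith : 0 < l * orient y z q) hl.le
  · rw [orient_rotate']
    have := key z x
    rw [orient_self_left, orient_self_right, orient_rotate z x y] at this
    exact pos_of_mul_pos_right (by linarith : 0 < l * orient z x q) hl.le
  · have := key x y
    rw [orient_self_left, orient_self_right] at this
    exact pos_of_mul_pos_right (by linarith : 0 < l * orient x y q) hl.le

theorem interior_geodesicHull_eq (X : Set ℍ) :
    interior (geodesicHull X) = klein ⁻¹' interior (convexHull ℝ (klein '' X)) := by
  rw [geodesicHull_eq, isOpenEmbedding_klein.isOpenMap.preimage_interior_eq_interior_preimage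
    continuous_klein]

theorem convexHull_klein_subset (X : Set ℍ) : convexHull ℝ (klein '' X) ⊆ Set.range klein := by
  rw [range_klein]
  refine convexHull_min ?_ convex_kleinRegion
  rintro _ ⟨x, -, rfl⟩
  exact klein_mem x

theorem isPreconnected_interior_geodesicHull (X : Set ℍ) :
    IsPreconnected (interior (geodesicHull X)) := by
  rw [interior_geodesicHull_eq, ← isOpenEmbedding_klein.isInducing.isPreconnected_image,
    Set.image_preimage_eq_of_subset (interior_subset.trans (convexHull_klein_subset X))]
  exact (convex_convexHull ℝ _).interior.isPreconnected

/-- Transported from the Klein model, where it is a general fact about convex sets. -/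
theorem geodesicHull_subset_closure_interior {X : Set ℍ} (h : (interior (geodesicHull X)).Nonempty) :
    geodesicHull X ⊆ closure (interior (geodesicHull X)) := by
  have h1 : (interior (convexHull ℝ (klein '' X))).Nonempty := by
    rw [interior_geodesicHull_eq] at h
    obtain ⟨q, hq⟩ := h
    exact ⟨_, hq⟩
  rw [interior_geodesicHull_eq, ← isOpenEmbedding_klein.isOpenMap.preimage_closure_eq_closure_preimage
    continuous_klein, (convex_convexHull ℝ _).closure_interior_eq_closure_of_nonempty_interior h1,
    geodesicHull_eq]
  exact Set.preimage_mono subset_closure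

/-- The linear form on Minkowski space which corresponds to an affine form on the Klein model. -/
def affineForm (f : ℝ × ℝ →L[ℝ] ℝ) (u : ℝ) : ℝ × ℝ × ℝ →ₗ[ℝ] ℝ :=
  u • LinearMap.fst ℝ ℝ (ℝ × ℝ) - f.toLinearMap ∘ₗ LinearMap.snd ℝ ℝ (ℝ × ℝ)

theorem affineForm_lorentzVec (f : ℝ × ℝ →L[ℝ] ℝ) (u : ℝ) (p : ℍ) :
    affineForm f u (lorentzVec p) = (1 / p.im) * (u - f (klein p)) := by
  rw [lorentzVec_eq_smul, map_smul, smul_eq_mul]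
  simp [affineForm]

/-- A point of a cyclic polygon off all lines through two vertices is in the interior. -/
theorem mem_interior_of_orient_ne_zero {v : ℍ} {ρ : ℝ} {X : Finset ℍ}
    (hX : ∀ w ∈ X, dist v w = ρ) (h3 : 3 ≤ X.card) {q : ℍ} (hq : q ∈ geodesicHull (X : Set ℍ))
    (hgen : ∀ a ∈ X, ∀ b ∈ X, a ≠ b → orient a b q ≠ 0) :
    q ∈ interior (geodesicHull (X : Set ℍ)) := by
  classical
  by_contra hqi
  obtain ⟨x, hx, y, hy, z, hz, hxy, hxz, hyz⟩ := Finset.two_lt_card.1 h3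
  have hor : ∀ x ∈ X, ∀ y ∈ X, ∀ z ∈ X, x ≠ y → x ≠ z → y ≠ z → orient x y z ≠ 0 :=
    fun x hx y hy z hz => orient_ne_zero (by rw [hX x hx, hX y hy]) (by rw [hX x hx, hX z hz])
  have hne := interior_geodesicHull_nonempty (X := (X : Set ℍ)) hx hy hz
    (hor x hx y hy z hz hxy hxz hyz)
  rw [interior_geodesicHull_eq] at hqi hne
  have hconv := convex_convexHull ℝ (klein '' (X : Set ℍ))
  -- Otherwise there is a supporting line at `q`. Only vertices on that line enter the combination
  -- for `q`, and there are at most two, since three points of a circle are not collinear; then `q`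
  -- is on a line through two vertices.
  obtain ⟨f, hf⟩ := geometric_hahn_banach_open_point hconv.interior isOpen_interior hqi
  have hne' : (interior (convexHull ℝ (klein '' (X : Set ℍ)))).Nonempty := by
    obtain ⟨q, hq⟩ := hne
    exact ⟨_, hq⟩
  have hle : ∀ w ∈ X, f (klein w) ≤ f (klein q) := fun w hw => by
    have hcl : klein w ∈ closure (interior (convexHull ℝ (klein '' (X : Set ℍ)))) := by
      rw [hconv.closure_interior_eq_closure_of_nonempty_interior hne']
      exact subset_closure (subset_convexHull ℝ _ ⟨w, hw, rfl⟩)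
    exact closure_minimal (t := {k | f k ≤ f (klein q)}) (fun k hk => (hf k hk).le)
      (isClosed_le f.continuous continuous_const) hcl
  set l := affineForm f (f (klein q)) with hl
  have hl0 : l ≠ 0 := by
    obtain ⟨k, hk⟩ := hne
    intro h0
    have h1 := hf _ hk
    have h2 := affineForm_lorentzVec f (f (klein q)) k
    rw [← hl, h0, LinearMap.zero_apply] at h2
    have := mul_pos (one_div_pos.2 k.im_pos) (sub_pos.2 h1)
    linarith
  have hlX : ∀ w ∈ X, 0 ≤ l (lorentzVec w) := fun w hw => by
    rw [hl, affineForm_lorentzVec]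
    exact mul_nonneg (one_div_pos.2 w.im_pos).le (sub_nonneg.2 (hle w hw))
  have hlq : l (lorentzVec q) = 0 := by rw [hl, affineForm_lorentzVec, sub_self, mul_zero]
  obtain ⟨t, ht, hqt⟩ := mem_geodesicHull_finset.1 hq
  have hz0 : ∀ w ∈ X, t w ≠ 0 → l (lorentzVec w) = 0 := by
    rw [hqt, map_sum] at hlq
    simp only [map_smul, smul_eq_mul] at hlq
    intro w hw htw
    have := (Finset.sum_eq_zero_iff_of_nonneg fun w hw => mul_nonneg (ht w hw) (hlX w hw)).1 hlq w hw
    exact (mul_eq_zero.1 this).resolve_left htw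
  have hcard : (X.filter fun w => l (lorentzVec w) = 0).card ≤ 2 := by
    by_contra hcon
    obtain ⟨a, ha, b, hb, c, hc, h1, h2, h3⟩ := Finset.two_lt_card.1 (not_le.1 hcon)
    rw [Finset.mem_filter] at ha hb hc
    exact hl0 (eq_zero_of_orient_ne_zero (hor a ha.1 b hb.1 c hc.1 h1 h2 h3) ha.2 hb.2 hc.2)
  -- The supporting line may carry fewer than two vertices; padding to exactly two names a pair for
  -- `hgen`.
  obtain ⟨Y, hY1, hYX, hY⟩ := Finset.exists_subsuperset_card_eq
    (Finset.filter_subset (fun w => l (lorentzVec w) = 0) X) hcard (by omega)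
  obtain ⟨a, b, hab, rfl⟩ := Finset.card_eq_two.1 hY
  refine hgen a (hYX (by simp)) b (hYX (by simp)) hab ?_
  rw [orient, hqt, map_sum]
  refine Finset.sum_eq_zero fun w hw => ?_
  rw [map_smul, smul_eq_mul]
  by_cases htw : t w = 0
  · rw [htw, zero_mul]
  · have : w ∈ ({a, b} : Finset ℍ) := hY1 (Finset.mem_filter.2 ⟨hw, hz0 w hw htw⟩)
    simp only [Finset.mem_insert, Finset.mem_singleton] at this
    rcases this with rfl | rfl
    · rw [← orient, orient_self_left, mul_zero]
    · rw [← orient, orient_self_right, mul_zero]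

theorem orientForm_ne_zero {a b : ℍ} (hab : a ≠ b) : orientForm a b ≠ 0 := by
  intro h
  have hg : gans a b ≠ 0 := fun h0 => hab (gans_eq_zero_iff.1 h0).symm
  obtain ⟨p, hp⟩ := exists_gans_eq a (Complex.I * gans a b)
  have h1 : orient a b p = 0 := by rw [orient, h, LinearMap.zero_apply]
  rw [orient_def, hp] at h1
  simp only [Complex.mul_re, Complex.mul_im, Complex.I_re, Complex.I_im] at h1
  refine hg (Complex.ext ?_ ?_) <;> simp only [Complex.zero_re, Complex.zero_im] <;>
    nlinarith [sq_nonneg (gans a b).re, sq_nonneg (gans a b).im]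

theorem IsNet.interior_delaunayPolygon_nonempty (hS : IsNet S) {v : ℍ}
    (hv : v ∈ voronoiVertices S) : (interior (delaunayPolygon S v)).Nonempty := by
  obtain ⟨x, hx, y, hy, z, hz, h1, h2, h3⟩ := hS.mem_voronoiVertices.1 hv
  refine interior_geodesicHull_nonempty hx hy hz (orient_ne_zero (v := v) ?_ ?_ h1 h2 h3)
  · rw [(hS.mem_delaunayVertices.1 hx).2, (hS.mem_delaunayVertices.1 hy).2]
  · rw [(hS.mem_delaunayVertices.1 hx).2, (hS.mem_delaunayVertices.1 hz).2]

theorem IsNet.closure_interior_delaunayPolygon (hS : IsNet S) {v : ℍ}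
    (hv : v ∈ voronoiVertices S) : closure (interior (delaunayPolygon S v)) = delaunayPolygon S v :=
  ((hS.isCompact_delaunayPolygon v).isClosed.closure_interior_subset).antisymm
    (geodesicHull_subset_closure_interior (hS.interior_delaunayPolygon_nonempty hv))

theorem IsNet.volume_delaunayPolygon_diff_interior (hS : IsNet S) {v : ℍ}
    (hv : v ∈ voronoiVertices S) :
    volume (delaunayPolygon S v \ interior (delaunayPolygon S v)) = 0 := by
  obtain ⟨X, hX, h3, -, hd⟩ := hS.exists_finset_vertices hv
  have hsub : delaunayPolygon S v \ interior (delaunayPolygon S v) ⊆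
      ⋃ a ∈ X, ⋃ b ∈ X, ⋃ _ : a ≠ b, {q | orientForm a b (lorentzVec q) = 0} := by
    rintro q ⟨hq, hqi⟩
    by_contra hcon
    simp only [Set.mem_iUnion, not_exists] at hcon
    rw [delaunayPolygon, ← hX] at hq hqi
    exact hqi (mem_interior_of_orient_ne_zero hd h3 hq fun a ha b hb hab h =>
      hcon a ha b hb hab h)
  refine measure_mono_null hsub ?_
  refine (measure_biUnion_null_iff X.countable_toSet).2 fun a _ =>
    (measure_biUnion_null_iff X.countable_toSet).2 fun b _ => measure_iUnion_null fun hab => ?_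
  exact volume_line (orientForm_ne_zero hab)

/-! ### The Delaunay tessellation covers the plane -/

/-- The point `p` minimizes the normalized distance `F`; beyond distance `D` from `q` one has `F ≥ 1
≥ F q`, so the minimum over a compact ball is global. If `q` were outside `P_p`, a separating vector
`w` would be positive on the nearest points of `p` and negative on `q`, and pushing `p` along `w`
would lower `F`. -/
theorem IsNet.exists_mem_geodesicHull (hS : IsNet S) (q : ℍ) : ∃ p, q ∈ delaunayPolygon S p := by
  obtain ⟨D, hD⟩ := hS.exists_dist_le
  have hinf : ∀ p, Metric.infDist p S ≤ D := fun p => by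
    obtain ⟨x, hx, h⟩ := hD p
    exact (Metric.infDist_le_dist_of_mem hx).trans h
  have hD0 : 0 ≤ D := Metric.infDist_nonneg.trans (hinf q)
  have hc : ∀ p, 0 < Real.cosh (Metric.infDist p S) := fun p => Real.cosh_pos _
  set F : ℍ → ℝ := fun p =>
    lorentzForm (lorentzVec q) (lorentzVec p) / Real.cosh (Metric.infDist p S) with hF
  have hFc : Continuous F := (continuous_linearForm _).div
    (Real.continuous_cosh.comp (Metric.continuous_infDist_pt S)) fun p => (hc p).ne'
  obtain ⟨p, -, hp⟩ := (isCompact_closedBall q D).exists_isMinOn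
    ⟨q, Metric.mem_closedBall_self hD0⟩ hFc.continuousOn
  have hmin : ∀ p', F p ≤ F p' := fun p' => by
    by_cases h : p' ∈ Metric.closedBall q D
    · exact hp h
    · rw [Metric.mem_closedBall, not_le] at h
      have h1 : F p ≤ F q := hp (Metric.mem_closedBall_self hD0)
      have h2 : F q ≤ 1 := by
        simp only [hF]
        rw [lorentzForm_self, div_le_one (hc q)]
        exact Real.one_le_cosh _
      have h3 : 1 ≤ F p' := by
        simp only [hF]
        rw [one_le_div (hc p'), ← cosh_dist_eq, Real.cosh_le_cosh,
          abs_of_nonneg Metric.infDist_nonneg, abs_of_nonneg dist_nonneg, dist_comm]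
        exact (hinf p').trans h.le
      linarith
  refine ⟨p, ?_⟩
  by_contra hq
  rw [delaunayPolygon, geodesicHull_eq, Set.mem_preimage] at hq
  obtain ⟨f, u, hfu, huq⟩ := geometric_hahn_banach_closed_point (convex_convexHull ℝ _)
    (((hS.finite_delaunayVertices p).image klein).isCompact_convexHull (𝕜 := ℝ)).isClosed hq
  obtain ⟨w, hw⟩ := exists_eq_lorentzForm (affineForm f u)
  have hlq : lorentzForm w (lorentzVec q) < 0 := by
    rw [← hw, affineForm_lorentzVec]
    exact mul_neg_of_pos_of_neg (one_div_pos.2 q.im_pos) (sub_neg.2 huq)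
  have hlx : ∀ x ∈ delaunayVertices S p, 0 < lorentzForm w (lorentzVec x) := fun x hx => by
    rw [← hw, affineForm_lorentzVec]
    exact mul_pos (one_div_pos.2 x.im_pos)
      (sub_pos.2 (hfu _ (subset_convexHull ℝ _ ⟨x, hx, rfl⟩)))
  -- A small push creates no new nearest points, so `w` is positive on those of `p'` as well.
  obtain ⟨ε, ⟨l, hl, p', hp', hlp⟩, hε⟩ := ((eventually_perturb p w
    (hS.eventually_delaunayVertices_subset p)).and self_mem_nhdsWithin).exists
  replace hε : 0 < ε := hε
  obtain ⟨x, hx⟩ := hS.delaunayVertices_nonempty p'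
  have h1 := congrArg (fun u => lorentzForm u (lorentzVec x)) hlp
  have h2 := congrArg (fun u => lorentzForm u (lorentzVec q)) hlp
  simp only [map_add, map_smul, LinearMap.add_apply, LinearMap.smul_apply, smul_eq_mul] at h1 h2
  rw [hS.lorentzForm_eq hx, hS.lorentzForm_eq (hp' hx)] at h1
  have h3 := hmin p'
  simp only [hF] at h3
  rw [div_le_div_iff₀ (hc p) (hc p'), lorentzForm_comm (lorentzVec q),
    lorentzForm_comm (lorentzVec q)] at h3
  have h4 := mul_pos hε (hlx x (hp' hx))
  have h5 := mul_neg_of_pos_of_neg hε hlq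
  have h6 := lorentzForm_pos p q
  have h7 := hc p
  have h8 := mul_le_mul_of_nonneg_left h3 hl.le
  nlinarith

theorem IsNet.exists_ne (hS : IsNet S) (a : ℍ) : ∃ b ∈ S, b ≠ a := by
  obtain ⟨D, hD⟩ := hS.exists_dist_le
  -- A point at distance `D + 1` from `a` has a net point other than `a` within `D`.
  obtain ⟨p, hp⟩ := exists_gans_eq a ((Real.sinh (D + 1) : ℝ) : ℂ)
  obtain ⟨b, hb, hbD⟩ := hD p
  refine ⟨b, hb, ?_⟩
  rintro rfl
  have h := norm_gans b p
  rw [hp, Complex.norm_real, Real.norm_eq_abs] at h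
  have h1 := (le_abs_self _).trans_eq h
  rw [Real.sinh_le_sinh, dist_comm] at h1
  linarith

/-- If the polygon containing `q` had fewer than three vertices, `q` would lie on a line through two
net points. -/
theorem IsNet.exists_interior_of_generic (hS : IsNet S) {q : ℍ}
    (hq : ∀ a ∈ S, ∀ b ∈ S, a ≠ b → orient a b q ≠ 0) :
    ∃ v ∈ voronoiVertices S, q ∈ interior (delaunayPolygon S v) := by
  classical
  obtain ⟨p, hp⟩ := hS.exists_mem_geodesicHull q
  have hfin := hS.finite_delaunayVertices p
  have h3 : 3 ≤ hfin.toFinset.card := by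
    by_contra hcon
    obtain ⟨a, ha⟩ := hS.delaunayVertices_nonempty p
    obtain ⟨t, -, hqt⟩ := hS.mem_delaunayPolygon.1 hp
    obtain ⟨b, hb, hba, hsub⟩ : ∃ b ∈ S, b ≠ a ∧ hfin.toFinset ⊆ {a, b} := by
      by_cases h : ∃ b ∈ hfin.toFinset, b ≠ a
      · obtain ⟨b, hb, hba⟩ := h
        refine ⟨b, (hfin.mem_toFinset.1 hb).1, hba, ?_⟩
        refine (Finset.eq_of_subset_of_card_le ?_ ?_).ge
        · intro w hw
          simp only [Finset.mem_insert, Finset.mem_singleton] at hw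
          rcases hw with rfl | rfl
          · exact hfin.mem_toFinset.2 ha
          · exact hb
        · rw [Finset.card_pair hba.symm]; omega
      · push Not at h
        obtain ⟨b, hb, hba⟩ := hS.exists_ne a
        exact ⟨b, hb, hba, fun w hw => by simp [h w hw]⟩
    refine hq a ha.1 b hb hba.symm ?_
    rw [orient, hqt, map_sum]
    refine Finset.sum_eq_zero fun w hw => ?_
    have := hsub hw
    simp only [Finset.mem_insert, Finset.mem_singleton] at this
    rw [map_smul]
    rcases this with rfl | rfl
    · rw [← orient, orient_self_left, smul_zero]
    · rw [← orient, orient_self_right, smul_zero]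
  have hd : ∀ w ∈ hfin.toFinset, dist p w = Metric.infDist p S := fun w hw =>
    (hS.mem_delaunayVertices.1 (hfin.mem_toFinset.1 hw)).2
  refine ⟨p, ?_, ?_⟩
  · obtain ⟨x, hx, y, hy, z, hz, h⟩ := Finset.two_lt_card.1 h3
    rw [hfin.mem_toFinset] at hx hy hz
    exact hS.mem_voronoiVertices.2 ⟨x, hx, y, hy, z, hz, h⟩
  · rw [delaunayPolygon, ← hfin.coe_toFinset] at hp ⊢
    refine mem_interior_of_orient_ne_zero hd h3 hp fun a ha b hb => ?_
    exact hq a (hfin.mem_toFinset.1 ha).1 b (hfin.mem_toFinset.1 hb).1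

/-- Baire category: the net is countable, and the complement of each line is open and dense. -/
theorem IsNet.dense_generic (hS : IsNet S) :
    Dense {q | ∀ a ∈ S, ∀ b ∈ S, a ≠ b → orient a b q ≠ 0} := by
  have h1 : {q | ∀ a ∈ S, ∀ b ∈ S, a ≠ b → orient a b q ≠ 0} =
      ⋂ c ∈ S ×ˢ S ∩ {c | c.1 ≠ c.2}, {q | orient c.1 c.2 q ≠ 0} := by
    ext q
    simp only [Set.mem_iInter, Set.mem_ofPred_eq, Set.mem_inter_iff, Set.mem_prod, Prod.forall]
    exact ⟨fun h a b hab => h a hab.1.1 b hab.1.2 hab.2,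
      fun h a ha b hb hab => h a b ⟨⟨ha, hb⟩, hab⟩⟩
  rw [h1]
  refine dense_biInter_of_isOpen (fun c _ => isOpen_ne_fun (continuous_orient _ _) continuous_const)
    ((hS.countable.prod hS.countable).mono Set.inter_subset_left) ?_
  rintro c ⟨-, hc⟩
  intro q
  by_contra hq
  rw [mem_closure_iff_frequently, not_frequently] at hq
  refine orientForm_ne_zero hc (linearForm_eq_zero (p := q) (not_not.1 hq.self_of_nhds) ?_)
  filter_upwards [hq] with q' hq'
  exact (not_not.1 hq').ge

theorem IsNet.locallyFinite_delaunayPolygon (hS : IsNet S) :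
    LocallyFinite fun v : voronoiVertices S => delaunayPolygon S v := by
  obtain ⟨D, hD⟩ := hS.exists_dist_le
  intro q
  refine ⟨_, Metric.ball_mem_nhds q one_pos, ?_⟩
  refine Set.Finite.of_finite_image (f := Subtype.val)
    ((hS.finite_voronoiVertices_inter q (D + 1)).subset ?_) Subtype.val_injective.injOn
  rintro _ ⟨⟨v, hv⟩, ⟨p, hp, hpq⟩, rfl⟩
  refine ⟨hv, ?_⟩
  have h1 := hS.dist_le_of_mem_delaunayPolygon hp
  obtain ⟨x, hx, h2⟩ := hD v
  have h3 := Metric.infDist_le_dist_of_mem (x := v) hx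
  rw [Metric.mem_ball] at hpq
  have h4 := dist_triangle v p q
  simp only [Metric.mem_closedBall]
  linarith

theorem IsNet.isClosed_biUnion_delaunayPolygon (hS : IsNet S) {V : Set ℍ}
    (hV : V ⊆ voronoiVertices S) : IsClosed (⋃ v ∈ V, delaunayPolygon S v) := by
  have h1 : LocallyFinite fun v : V => delaunayPolygon S v := by
    have := hS.locallyFinite_delaunayPolygon.comp_injective (Set.inclusion_injective hV)
    exact this
  rw [Set.biUnion_eq_iUnion]
  exact h1.isClosed_iUnion fun v => (hS.isCompact_delaunayPolygon v).isClosed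

end

section
open MeasureTheory Filter Topology

variable {S : Set ℍ}

/-! ### Geodesic arcs -/

theorem mem_geodesicArc {x y p : ℍ} : p ∈ geodesicArc x y ↔ dist x p + dist p y = dist x y := Iff.rfl

theorem geodesicArc_comm (x y : ℍ) : geodesicArc x y = geodesicArc y x := by
  ext p
  rw [mem_geodesicArc, mem_geodesicArc, dist_comm x p, dist_comm p y, dist_comm x y, add_comm]

theorem left_mem_geodesicArc (x y : ℍ) : x ∈ geodesicArc x y := by simp [mem_geodesicArc]

theorem right_mem_geodesicArc (x y : ℍ) : y ∈ geodesicArc x y := by simp [mem_geodesicArc]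

theorem geodesicArc_subset_left {x y m : ℍ} (hm : m ∈ geodesicArc x y) :
    geodesicArc x m ⊆ geodesicArc x y := by
  intro q hq
  rw [mem_geodesicArc] at *
  have h1 := dist_triangle q m y
  have h2 := dist_triangle x q y
  linarith

theorem mem_geodesicArc_of_between {x y m q : ℍ} (hq : q ∈ geodesicArc x y)
    (hm : m ∈ geodesicArc x q) : q ∈ geodesicArc m y := by
  rw [mem_geodesicArc] at *
  have h1 := dist_triangle m q y
  have h2 := dist_triangle x m y
  linarith

theorem mem_arc_or_mem_arc {x q p p' : ℍ} (hqx : q ≠ x) (h : q ∈ geodesicArc x p)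
    (h' : q ∈ geodesicArc x p') : p ∈ geodesicArc x p' ∨ p' ∈ geodesicArc x p := by
  obtain ⟨l, hl0, e⟩ := (mem_ray_iff hqx).1 (Or.inr h)
  obtain ⟨l', hl0', e'⟩ := (mem_ray_iff hqx).1 (Or.inr h')
  have hx : ∀ y, q ∈ geodesicArc x y → y ≠ x := by
    rintro y hy rfl
    rw [mem_geodesicArc, dist_self, dist_comm q y] at hy
    exact hqx (dist_le_zero.1 (by have := dist_nonneg (x := y) (y := q); rw [dist_comm]; linarith))
  have hl : 0 < l := by
    refine lt_of_le_of_ne hl0 fun h0 => hx p h (gans_eq_zero_iff.1 ?_)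
    rw [e, ← h0, zero_smul]
  have hl' : 0 < l' := by
    refine lt_of_le_of_ne hl0' fun h0 => hx p' h' (gans_eq_zero_iff.1 ?_)
    rw [e', ← h0, zero_smul]
  refine (mem_ray_iff (hx p' h')).2 ⟨l / l', by positivity, ?_⟩
  rw [e, e', smul_smul, div_mul_cancel₀ _ hl'.ne']

theorem eq_of_mem_arc_of_dist_eq {p q x y : ℍ} (hq : q ≠ p) (hx : q ∈ geodesicArc p x)
    (hy : q ∈ geodesicArc p y) (h : dist p x = dist p y) : x = y := by
  rcases mem_arc_or_mem_arc hq hx hy with h1 | h1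
  · rw [mem_geodesicArc] at h1
    exact dist_le_zero.1 (by linarith)
  · rw [mem_geodesicArc] at h1
    exact (dist_le_zero.1 (by linarith : dist y x ≤ 0)).symm

theorem dilate_mem_geodesicArc_dilate (x p : ℍ) {σ τ : ℝ} (h0 : 0 ≤ σ) (h : σ ≤ τ) :
    dilate x σ p ∈ geodesicArc x (dilate x τ p) := by
  rcases (h0.trans h).eq_or_lt with h1 | h1
  · rw [← h1] at h ⊢
    rw [le_antisymm h h0]
    exact right_mem_geodesicArc _ _
  · have := dilate_mem_geodesicArc x (dilate x τ p) (τ := σ / τ) (by positivity)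
      ((div_le_one h1).2 h)
    rwa [dilate_dilate, div_mul_cancel₀ _ h1.ne'] at this

theorem isClosed_geodesicArc (x y : ℍ) : IsClosed (geodesicArc x y) :=
  isClosed_eq (by fun_prop) continuous_const

/-! ### The centered dual graph -/

/-- On the segment from `p` to a nearest point of the net, that point is the only nearest one. -/
theorem IsNet.delaunayVertices_eq_singleton (hS : IsNet S) {p q a : ℍ}
    (ha : a ∈ delaunayVertices S p) (hq : q ∈ geodesicArc a p) (hqp : q ≠ p) :
    delaunayVertices S q = {a} := by
  rw [geodesicArc_comm] at hq
  have hap := (hS.mem_delaunayVertices.1 ha).2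
  rw [mem_geodesicArc] at hq
  have hle : ∀ y ∈ S, dist q a ≤ dist q y := fun y hy => by
    have h1 := dist_triangle p q y
    have h2 := Metric.infDist_le_dist_of_mem (x := p) hy
    linarith
  ext y
  rw [Set.mem_singleton_iff]
  constructor
  · intro hy
    have h1 := hy.2 a ha.1
    have h2 := hle y hy.1
    have h3 := dist_triangle p q y
    have h4 := Metric.infDist_le_dist_of_mem (x := p) hy.1
    exact eq_of_mem_arc_of_dist_eq hqp (by rw [mem_geodesicArc]; linarith) hq (by linarith)
  · rintro rfl
    exact ⟨ha.1, hle⟩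

theorem IsNet.lorentzForm_sub_nonneg (hS : IsNet S) {p a c : ℍ} (ha : a ∈ delaunayVertices S p)
    (hc : c ∈ S) : 0 ≤ lorentzForm (lorentzVec p) (lorentzVec c) -
      lorentzForm (lorentzVec p) (lorentzVec a) := by
  rw [hS.lorentzForm_eq ha, sub_nonneg]
  exact hS.le_lorentzForm p hc

/-- Suppose a third net point `c` were nearest to `m`, which lies between `p` and `p'` on the edge.
The linear function `⟨·, c⟩ - ⟨·, a⟩` is nonnegative at `p` and `p'` and zero at `m`, hence zero at
`p`. Then `p` and `m` are both circumcenters of `a`, `b`, `c`. -/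
theorem IsCenteredEdge.exists_center (hS : IsNet S) {a b : ℍ} (h : IsCenteredEdge S a b) :
    ∃ m ∈ geodesicArc a b, delaunayVertices S m = {a, b} := by
  obtain ⟨⟨ha, hb, hab, -⟩, m, ⟨⟨hma, hmb⟩, p, hp, p', hp', hpm, hpm', hmem⟩, hm⟩ := h
  refine ⟨m, hm, ?_⟩
  have ha' : a ∈ delaunayVertices S m := ⟨ha, hma⟩
  have hb' : b ∈ delaunayVertices S m := ⟨hb, hmb⟩
  refine Set.Subset.antisymm (fun c hc => ?_) ?_
  swap
  · rintro c (rfl | rfl) <;> assumption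
  by_contra hcon
  simp only [Set.mem_insert_iff, Set.mem_singleton_iff, not_or] at hcon
  obtain ⟨s, t, hs, ht, e⟩ := mem_geodesicArc_iff_lorentzVec.1 hmem
  have hs' : 0 < s := hs.lt_of_ne fun h0 => by
    rw [← h0, zero_smul, zero_add] at e
    have h1 := congrArg (fun u => lorentzForm u u) e
    simp only [map_smul, LinearMap.smul_apply, lorentzForm_self, smul_eq_mul, mul_one] at h1
    have : t = 1 := by nlinarith
    rw [this, one_smul] at e
    exact hpm' (lorentzVec_injective e.symm)
  have hpa : a ∈ delaunayVertices S p := ⟨ha, hp.1⟩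
  have hpa' : a ∈ delaunayVertices S p' := ⟨ha, hp'.1⟩
  have h1 := hS.lorentzForm_sub_nonneg hpa hc.1
  have h2 := hS.lorentzForm_sub_nonneg hpa' hc.1
  have h3 : lorentzForm (lorentzVec m) (lorentzVec c) =
      lorentzForm (lorentzVec m) (lorentzVec a) := by
    rw [hS.lorentzForm_eq hc, hS.lorentzForm_eq ha']
  rw [e] at h3
  simp only [map_add, map_smul, LinearMap.add_apply, LinearMap.smul_apply, smul_eq_mul] at h3
  have h4 : lorentzForm (lorentzVec p) (lorentzVec c) =
      lorentzForm (lorentzVec p) (lorentzVec a) := by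
    refine le_antisymm ?_ (by linarith)
    have h5 := mul_nonneg ht h2
    have h6 : s * (lorentzForm (lorentzVec p) (lorentzVec c) -
      lorentzForm (lorentzVec p) (lorentzVec a)) ≤ 0 := by linarith
    exact sub_nonpos.1 (nonpos_of_mul_nonpos_right h6 hs')
  refine hpm (circumcenter_unique hab (Ne.symm hcon.1) (Ne.symm hcon.2) ?_
    (dist_eq_dist_iff_lorentzForm.2 h4) ?_ ?_)
  · exact le_antisymm (hp.2 a ha) (hp.1 b hb)
  · exact le_antisymm (hmb a ha) (hma b hb)
  · exact le_antisymm (hc.2 a ha) (hma c hc.1)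

theorem IsCenteredEdge.symm {a b : ℍ} (h : IsCenteredEdge S a b) : IsCenteredEdge S b a := by
  obtain ⟨⟨ha, hb, hab, hn⟩, hm⟩ := h
  exact ⟨⟨hb, ha, hab.symm, by rwa [Set.inter_comm]⟩, by rwa [geodesicArc_comm, Set.inter_comm (voronoiCell S b)]⟩

/-- Dual arcs are cut at the midpoint `m`. On the half from `a` to `m`, except at `m`, the point `a`
is the unique nearest one; this is how graph points are recognized later. -/
theorem IsNet.mem_centeredDualGraph (hS : IsNet S) {q : ℍ} (hq : q ∈ centeredDualGraph S) :
    ∃ a b m, a ≠ b ∧ delaunayVertices S m = {a, b} ∧ geodesicArc a m ⊆ centeredDualGraph S ∧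
      m ∈ geodesicArc a b ∧ q ∈ geodesicArc a m := by
  obtain ⟨a, b, hab, hq⟩ := hq
  obtain ⟨m, hm, hmab⟩ := hab.exists_center hS
  have hsub : ∀ {a b : ℍ}, IsCenteredEdge S a b → m ∈ geodesicArc a b →
      geodesicArc a m ⊆ centeredDualGraph S :=
    fun {a b} h hm p hp => ⟨a, b, h, geodesicArc_subset_left hm hp⟩
  obtain ⟨τ, hτ0, hτ1, rfl⟩ := exists_dilate_of_mem_geodesicArc hm
  obtain ⟨σ, hσ0, hσ1, rfl⟩ := exists_dilate_of_mem_geodesicArc hq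
  rcases le_total σ τ with h | h
  · exact ⟨a, b, _, hab.1.2.2.1, hmab, hsub hab hm, hm,
      dilate_mem_geodesicArc_dilate a b hσ0 h⟩
  · rw [geodesicArc_comm] at hm
    refine ⟨b, a, _, hab.1.2.2.1.symm, by rw [hmab, Set.pair_comm], hsub hab.symm hm, hm, ?_⟩
    rw [geodesicArc_comm]
    exact mem_geodesicArc_of_between hq (dilate_mem_geodesicArc_dilate a b hτ0 h)

theorem IsNet.voronoiVertices_disjoint (hS : IsNet S) {v : ℍ} (hv : v ∈ voronoiVertices S) :
    v ∉ centeredDualGraph S := by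
  intro hG
  obtain ⟨a, b, m, hab, hm, -, -, hq⟩ := hS.mem_centeredDualGraph hG
  obtain ⟨x, hx, y, hy, z, hz, h1, h2, h3⟩ := hS.mem_voronoiVertices.1 hv
  have hsub : delaunayVertices S v ⊆ {a, b} := by
    by_cases h : v = m
    · rw [h, hm]
    · rw [hS.delaunayVertices_eq_singleton (by rw [hm]; simp) hq h]; simp
  have hx' := hsub hx
  have hy' := hsub hy
  have hz' := hsub hz
  simp only [Set.mem_insert_iff, Set.mem_singleton_iff] at hx' hy' hz'
  grind

theorem IsNet.isClosed_centeredDualGraph (hS : IsNet S) : IsClosed (centeredDualGraph S) := by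
  have h1 : centeredDualGraph S =
      ⋃ c : {c : ℍ × ℍ // IsCenteredEdge S c.1 c.2}, geodesicArc c.1.1 c.1.2 := by
    ext q
    simp [centeredDualGraph]
  rw [h1]
  obtain ⟨D, hD⟩ := hS.exists_dist_le
  refine LocallyFinite.isClosed_iUnion ?_ fun c => isClosed_geodesicArc _ _
  intro q
  refine ⟨_, Metric.ball_mem_nhds q one_pos, ?_⟩
  refine Set.Finite.of_finite_image (f := Subtype.val)
    (((hS.finite_inter q (2 * D + 1)).prod (hS.finite_inter q (2 * D + 1))).subset ?_)
    Subtype.val_injective.injOn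
  rintro _ ⟨⟨⟨a, b⟩, hab⟩, ⟨p, hp, hpq⟩, rfl⟩
  simp only at hp hab
  obtain ⟨m, hm, hmab⟩ := hab.exists_center hS
  have ha := hS.mem_delaunayVertices.1 (hmab ▸ Set.mem_insert a {b} : a ∈ delaunayVertices S m)
  have hb := hS.mem_delaunayVertices.1 (hmab ▸ by simp : b ∈ delaunayVertices S m)
  obtain ⟨x, hx, h2⟩ := hD m
  have h3 := Metric.infDist_le_dist_of_mem (x := m) hx
  rw [mem_geodesicArc] at hp hm
  rw [Metric.mem_ball] at hpq
  rw [dist_comm a m] at hm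
  have h4 := dist_triangle a p q
  have h5 := dist_triangle b p q
  rw [dist_comm b p] at h5
  have h6 := dist_nonneg (x := a) (y := p)
  have h7 := dist_nonneg (x := p) (y := b)
  simp only [Set.mem_prod, Set.mem_inter_iff, Metric.mem_closedBall]
  exact ⟨⟨ha.1, by linarith⟩, hb.1, by linarith⟩

/-- The dual arc lies in the degenerate polygon of its midpoint `m`, and `IsNet.disjoint_interior`
applies to `v` and `m`. -/
theorem IsNet.interior_disjoint_centeredDualGraph (hS : IsNet S) {v : ℍ}
    (hv : v ∈ voronoiVertices S) :
    interior (delaunayPolygon S v) ⊆ (centeredDualGraph S)ᶜ := by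
  intro q hq hG
  obtain ⟨a, b, m, hab, hm, -, hmab, hqm⟩ := hS.mem_centeredDualGraph hG
  have hvm : v ≠ m := by
    rintro rfl
    obtain ⟨x, hx, y, hy, z, hz, h1, h2, h3⟩ := hS.mem_voronoiVertices.1 hv
    rw [hm] at hx hy hz
    simp only [Set.mem_insert_iff, Set.mem_singleton_iff] at hx hy hz
    grind
  refine Set.disjoint_left.1 (hS.disjoint_interior hvm) hq ?_
  have h1 : a ∈ delaunayPolygon S m := subset_geodesicHull _ (by rw [hm]; simp)
  have h2 : b ∈ delaunayPolygon S m := subset_geodesicHull _ (by rw [hm]; simp)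
  exact geodesicallyConvex_geodesicHull _ _ h1 _ h2 (geodesicArc_subset_left hmab hqm)

/-- A graph point `q` here would lie on a half-arc from the same `z`, its unique nearest point. Of
two arcs from `z` through `q` one contains the end of the other: either the midpoint `m`, with two
nearest points, lies between `z` and `v`, or `v` lies on the graph. -/
theorem IsNet.arc_disjoint_centeredDualGraph (hS : IsNet S) {v z q : ℍ}
    (hv : v ∈ voronoiVertices S) (hz : z ∈ delaunayVertices S v) (hq : q ∈ geodesicArc z v)
    (hqz : q ≠ z) : q ∉ centeredDualGraph S := by
  rcases eq_or_ne q v with rfl | hqv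
  · exact hS.voronoiVertices_disjoint hv
  intro hG
  have h1 := hS.delaunayVertices_eq_singleton hz hq hqv
  obtain ⟨a, b, m, hab, hm, hsub, hmab, hqm⟩ := hS.mem_centeredDualGraph hG
  have ham : a ∈ delaunayVertices S m := by rw [hm]; simp
  have hbm : b ∈ delaunayVertices S m := by rw [hm]; simp
  have hqm' : q ≠ m := by
    rintro rfl
    rw [h1, Set.mem_singleton_iff] at ham hbm
    exact hab (ham.trans hbm.symm)
  have haz : a = z := by
    have := hS.delaunayVertices_eq_singleton ham hqm hqm'
    rw [h1] at this
    exact (Set.singleton_injective this).symm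
  subst haz
  rcases mem_arc_or_mem_arc hqz hqm hq with h | h
  · by_cases hmv : m = v
    · exact hS.voronoiVertices_disjoint hv (hmv ▸ hsub (right_mem_geodesicArc _ _))
    · rw [hS.delaunayVertices_eq_singleton hz h hmv, Set.mem_singleton_iff] at hbm
      exact hab hbm.symm
  · exact hS.voronoiVertices_disjoint hv (hsub h)

/-- Three points of a circle can be labelled so that the ray from the first one to the center runs
between the other two. -/
theorem exists_orient_pos {v x y z : ℍ} {ρ : ℝ} (hx : dist v x = ρ) (hy : dist v y = ρ)
    (hz : dist v z = ρ) (h : 0 < orient x y z) :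
    (0 < orient x v z ∧ 0 < orient x y v) ∨ (0 < orient v y z ∧ 0 < orient x y v) ∨
      (0 < orient v y z ∧ 0 < orient x v z) := by
  -- Of any two barycentric coordinates of the center at least one is positive; applied to all pairs
  -- this leaves at least two positive ones. Two nonpositive coordinates are excluded by pairing
  -- Cramer's identity with `x` and with `v`.
  have key : ∀ x y z : ℍ, dist v x = ρ → dist v y = ρ → dist v z = ρ → 0 < orient x y z →
      0 < orient x v z ∨ 0 < orient x y v := by
    intro x y z hx hy hz h
    by_contra! hcon
    have e := orient_smul_lorentzVec x y z v
    have hne : v ≠ x := by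
      rintro rfl
      rw [orient_self_left] at hcon
      rw [dist_self] at hx
      have h1 : v = y := dist_eq_zero.1 (hy.trans hx.symm)
      rw [← h1, orient_rotate, orient_self_left] at h
      exact h.false
    have h1 := congrArg (fun u => lorentzForm u (lorentzVec x)) e
    have h2 := congrArg (fun u => lorentzForm u (lorentzVec v)) e
    simp only [map_add, map_smul, LinearMap.add_apply, LinearMap.smul_apply, smul_eq_mul,
      lorentzForm_self] at h1 h2
    have e1 : lorentzForm (lorentzVec v) (lorentzVec x) = Real.cosh ρ := by
      rw [← cosh_dist_eq, hx]
    have e2 : lorentzForm (lorentzVec y) (lorentzVec v) = Real.cosh ρ := by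
      rw [lorentzForm_comm, ← cosh_dist_eq, hy]
    have e3 : lorentzForm (lorentzVec z) (lorentzVec v) = Real.cosh ρ := by
      rw [lorentzForm_comm, ← cosh_dist_eq, hz]
    rw [e1] at h1
    rw [lorentzForm_comm (lorentzVec x), e1, e2, e3] at h2
    have hc : 1 < Real.cosh ρ := by rw [← e1]; exact one_lt_lorentzForm hne
    have hyx := one_le_lorentzForm y x
    have hzx := one_le_lorentzForm z x
    have i1 : orient x v z * lorentzForm (lorentzVec y) (lorentzVec x) ≤ orient x v z := by
      nlinarith
    have i2 : orient x y v * lorentzForm (lorentzVec z) (lorentzVec x) ≤ orient x y v := by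
      nlinarith
    have i3 : orient x y z * Real.cosh ρ ≤ orient v y z + orient x v z + orient x y v := by
      linarith
    have i4 := mul_le_mul_of_nonneg_right i3 (by linarith : (0 : ℝ) ≤ Real.cosh ρ)
    have i5 : orient x y z < orient x y z * Real.cosh ρ * Real.cosh ρ := by
      have : 1 < Real.cosh ρ * Real.cosh ρ := by nlinarith
      nlinarith
    nlinarith
  have k1 := key x y z hx hy hz h
  have k2 := key y z x hy hz hx (by rwa [orient_rotate] at h)
  have k3 := key z x y hz hx hy (by rwa [orient_rotate, orient_rotate] at h)
  rw [orient_rotate y v x, orient_rotate v x y, ← orient_rotate v y z] at k2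
  rw [orient_rotate z v y, orient_rotate z x v] at k3
  tauto

theorem IsNet.exists_vertices_around (hS : IsNet S) {v : ℍ} (hv : v ∈ voronoiVertices S) :
    ∃ z ∈ delaunayVertices S v, ∃ a ∈ delaunayVertices S v, ∃ b ∈ delaunayVertices S v,
      0 < orient z a b ∧ 0 < orient z v b ∧ 0 < orient z a v := by
  obtain ⟨x, hx, y, hy, z, hz, h1, h2, h3⟩ := hS.mem_voronoiVertices.1 hv
  have hx' := (hS.mem_delaunayVertices.1 hx).2
  have hy' := (hS.mem_delaunayVertices.1 hy).2
  have hz' := (hS.mem_delaunayVertices.1 hz).2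
  have hne := orient_ne_zero (hy'.trans hx'.symm) (hz'.trans hx'.symm) h1 h2 h3
  have key : ∀ x ∈ delaunayVertices S v, ∀ y ∈ delaunayVertices S v, ∀ z ∈ delaunayVertices S v,
      0 < orient x y z → ∃ z ∈ delaunayVertices S v, ∃ a ∈ delaunayVertices S v,
        ∃ b ∈ delaunayVertices S v, 0 < orient z a b ∧ 0 < orient z v b ∧ 0 < orient z a v := by
    intro x hx y hy z hz h
    have hd : ∀ {w}, w ∈ delaunayVertices S v → dist v w = Metric.infDist v S :=
      fun hw => (hS.mem_delaunayVertices.1 hw).2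
    rcases exists_orient_pos (hd hx) (hd hy) (hd hz) h with h1 | h1 | h1
    · exact ⟨x, hx, y, hy, z, hz, h, h1⟩
    · refine ⟨y, hy, z, hz, x, hx, by rwa [orient_rotate] at h, ?_, ?_⟩
      · rw [← orient_rotate]; exact h1.2
      · rw [← orient_rotate]; exact h1.1
    · refine ⟨z, hz, x, hx, y, hy, by rwa [orient_rotate, orient_rotate] at h, ?_, ?_⟩
      · rw [orient_rotate]; exact h1.1
      · rw [orient_rotate]; exact h1.2
  rcases hne.lt_or_gt with h | h
  · refine key x hx z hz y hy ?_
    rw [orient_swap_right]; linarith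
  · exact key x hx y hy z hz h

theorem lorentzVec_dilate (x p : ℍ) {τ : ℝ} (h0 : 0 < τ) (h1 : τ ≤ 1) :
    ∃ s : ℝ, 0 ≤ s ∧ lorentzVec (dilate x τ p) = s • lorentzVec x + τ • lorentzVec p := by
  have h := lorentzVec_eq_of_gans (gans_dilate x p τ)
  refine ⟨_, ?_, h⟩
  rw [cosh_dist_eq_sqrt, cosh_dist_eq_sqrt, gans_dilate, norm_smul, Real.norm_eq_abs, mul_pow,
    sq_abs, sub_nonneg]
  apply Real.le_sqrt_of_sq_le
  rw [mul_pow, Real.sq_sqrt (by positivity)]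
  have : τ ^ 2 ≤ 1 := pow_le_one₀ h0.le h1
  nlinarith [sq_nonneg ‖gans x p‖]

theorem tendsto_dilate_zero (x p : ℍ) : Tendsto (fun τ => dilate x τ p) (𝓝[>] 0) (𝓝 x) := by
  have h := (continuous_dilate_left x p).tendsto 0
  have h0 : dilate x 0 p = x := by apply gans_injective x; simp
  rw [h0] at h
  exact h.mono_left nhdsWithin_le_nhds

theorem isPreconnected_dilate (x p : ℍ) :
    IsPreconnected ((fun τ => dilate x τ p) '' Set.Ioc 0 1) :=
  isPreconnected_Ioc.image _ (continuous_dilate_left x p).continuousOn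

/-- The interior of a Delaunay polygon lies in the same component as its center. -/
theorem IsNet.connectedComponentIn_eq_of_mem_interior (hS : IsNet S) {v q : ℍ} (hv : v ∈ voronoiVertices S)
    (hq : q ∈ interior (delaunayPolygon S v)) :
    connectedComponentIn (centeredDualGraph S)ᶜ q =
      connectedComponentIn (centeredDualGraph S)ᶜ v := by
  obtain ⟨z, hz, a, ha, b, hb, h0, h1, h2⟩ := hS.exists_vertices_around hv
  have hzv : v ≠ z := by
    rintro rfl
    rw [orient_self_left] at h2
    exact h2.false
  have hmem : ∀ {τ : ℝ}, τ ∈ Set.Ioc (0 : ℝ) 1 → dilate z τ v ∈ (centeredDualGraph S)ᶜ :=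
    fun {τ} hτ => hS.arc_disjoint_centeredDualGraph hv hz
      (dilate_mem_geodesicArc z v hτ.1.le hτ.2) fun h => hzv ((dilate_eq_iff hτ.1.ne').1 h)
  -- The segment from `z` to `v` starts strictly between the sides `z a` and `z b`, so a short piece
  -- of it is interior to the triangle `z a b`.
  obtain ⟨τ, hτ, hτ'⟩ : ∃ τ ∈ Set.Ioc (0 : ℝ) 1,
      dilate z τ v ∈ interior (delaunayPolygon S v) := by
    have h3 : 0 < orient a b z := by rwa [orient_rotate] at h0
    have e1 := (tendsto_dilate_zero z v).eventually
      ((continuous_orient a b).continuousAt.eventually (lt_mem_nhds h3))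
    have e2 : ∀ᶠ τ : ℝ in 𝓝[>] 0, τ ∈ Set.Ioc (0 : ℝ) 1 := Ioc_mem_nhdsGT one_pos
    obtain ⟨τ, h4, hτ⟩ := (e1.and e2).exists
    refine ⟨τ, hτ, ?_⟩
    obtain ⟨s, -, hs⟩ := lorentzVec_dilate z v hτ.1 hτ.2
    refine mem_interior_geodesicHull hz ha hb h0 ?_ ?_ ?_
    · rwa [orient_rotate]
    · have h5 : orient b z (dilate z τ v) = τ * orient b z v := by
        rw [orient, hs, map_add, map_smul, map_smul, ← orient, ← orient, orient_self_right,
          smul_zero, zero_add, smul_eq_mul]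
      rw [orient_rotate', h5, ← orient_rotate']
      exact mul_pos hτ.1 h1
    · have h5 : orient z a (dilate z τ v) = τ * orient z a v := by
        rw [orient, hs, map_add, map_smul, map_smul, ← orient, ← orient, orient_self_left,
          smul_zero, zero_add, smul_eq_mul]
      rw [h5]
      exact mul_pos hτ.1 h2
  have c1 : connectedComponentIn (centeredDualGraph S)ᶜ (dilate z τ v) =
      connectedComponentIn (centeredDualGraph S)ᶜ v := by
    refine connectedComponentIn_eq ((isPreconnected_dilate z v).subset_connectedComponentIn
      ⟨τ, hτ, rfl⟩ ?_ ⟨1, by simp, dilate_one z v⟩)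
    rintro _ ⟨σ, hσ, rfl⟩
    exact hmem hσ
  rw [← c1]
  exact connectedComponentIn_eq ((isPreconnected_interior_geodesicHull _).subset_connectedComponentIn
    hq (hS.interior_disjoint_centeredDualGraph hv) hτ')

end

section
open MeasureTheory Filter Topology

variable {S : Set ℍ}

/-! ### Cells and sectors -/

/-- A union of connected components of the complement of the centered dual graph. -/
structure IsCellUnion (S C : Set ℍ) : Prop where
  subset : C ⊆ (centeredDualGraph S)ᶜ
  component_subset : ∀ q ∈ C, connectedComponentIn (centeredDualGraph S)ᶜ q ⊆ C

theorem isCellUnion_connectedComponentIn (S : Set ℍ) (p : ℍ) :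
    IsCellUnion S (connectedComponentIn (centeredDualGraph S)ᶜ p) :=
  ⟨connectedComponentIn_subset _ _, fun _ hq => (connectedComponentIn_eq hq).ge⟩

variable {C : Set ℍ}

theorem IsCellUnion.isOpen (hC : IsCellUnion S C) (hS : IsNet S) : IsOpen C := by
  refine isOpen_iff_mem_nhds.2 fun q hq => mem_of_superset ?_ (hC.component_subset q hq)
  exact hS.isClosed_centeredDualGraph.isOpen_compl.connectedComponentIn.mem_nhds
    (mem_connectedComponentIn (hC.subset hq))

theorem IsCellUnion.mem_of_mem_closure (hC : IsCellUnion S C) (hS : IsNet S) {q : ℍ}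
    (hq : q ∉ centeredDualGraph S) (h : q ∈ closure C) : q ∈ C := by
  obtain ⟨r, hr, hr'⟩ := mem_closure_iff.1 h _
    (hS.isClosed_centeredDualGraph.isOpen_compl.connectedComponentIn (x := q))
    (mem_connectedComponentIn hq)
  refine hC.component_subset r hr' ?_
  rw [← connectedComponentIn_eq hr]
  exact mem_connectedComponentIn hq

/-- The center is off the graph and so belongs to `C` itself; the interior of its polygon lies in
the same component, and the polygon is the closure of that interior. -/
theorem IsCellUnion.delaunayPolygon_subset (hC : IsCellUnion S C) (hS : IsNet S) {v : ℍ}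
    (hv : v ∈ voronoiVertices S) (h : v ∈ closure C) : delaunayPolygon S v ⊆ closure C := by
  have h1 := hC.mem_of_mem_closure hS (hS.voronoiVertices_disjoint hv) h
  rw [← hS.closure_interior_delaunayPolygon hv]
  refine closure_mono fun q hq => hC.component_subset v h1 ?_
  rw [← hS.connectedComponentIn_eq_of_mem_interior hv hq]
  exact mem_connectedComponentIn (hS.interior_disjoint_centeredDualGraph hv hq)

/-- Generic points of `C` are dense in it and lie in interiors of polygons whose centers belong to
`C`; local finiteness makes the union of these polygons closed. -/
theorem IsCellUnion.exists_mem_delaunayPolygon (hC : IsCellUnion S C) (hS : IsNet S) {q : ℍ}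
    (h : q ∈ closure C) : ∃ v ∈ voronoiVertices S, v ∈ closure C ∧ q ∈ delaunayPolygon S v := by
  have h1 : closure C ⊆ ⋃ v ∈ voronoiVertices S ∩ closure C, delaunayPolygon S v := by
    refine closure_minimal ?_ (hS.isClosed_biUnion_delaunayPolygon Set.inter_subset_left)
    refine (hS.dense_generic.open_subset_closure_inter (hC.isOpen hS)).trans (closure_minimal ?_
      (hS.isClosed_biUnion_delaunayPolygon Set.inter_subset_left))
    rintro q ⟨hqC, hq⟩
    obtain ⟨v, hv, hqv⟩ := hS.exists_interior_of_generic hq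
    refine Set.mem_biUnion ⟨hv, subset_closure (hC.component_subset q hqC ?_)⟩
      (interior_subset hqv)
    rw [hS.connectedComponentIn_eq_of_mem_interior hv hqv]
    exact mem_connectedComponentIn (hS.voronoiVertices_disjoint hv)
  have h2 := h1 h
  simp only [Set.mem_iUnion, exists_prop] at h2
  obtain ⟨v, hv, hq⟩ := h2
  exact ⟨v, hv.1, hv.2, hq⟩

theorem IsNet.two_mul_injRadius_le (hS : IsNet S) {x y : ℍ} (hx : x ∈ S) (hy : y ∈ S)
    (hxy : x ≠ y) : 2 * injRadius S ≤ dist x y := by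
  have h : injRadius S ≤ dist x y / 2 := by
    refine Real.sSup_le (fun r hr => ?_) (by positivity)
    have := hr.2 x hx y hy hxy
    linarith
  linarith

theorem IsNet.delaunayVertices_eq_of_mem_ball (hS : IsNet S) {R : ℝ} (hR : R ≤ injRadius S)
    {x p : ℍ} (hx : x ∈ S) (hp : dist p x < R) : delaunayVertices S p = {x} := by
  have h : ∀ y ∈ S, y ≠ x → dist p x < dist p y := fun y hy hyx => by
    have h1 := hS.two_mul_injRadius_le hx hy hyx.symm
    have h2 := dist_triangle x p y
    rw [dist_comm x p] at h2
    linarith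
  ext y
  rw [Set.mem_singleton_iff]
  constructor
  · intro hy
    by_contra hyx
    exact (h y hy.1 hyx).not_ge (hy.2 x hx)
  · rintro rfl
    refine ⟨hx, fun z hz => ?_⟩
    rcases eq_or_ne z y with rfl | hzy
    · exact le_rfl
    · exact (h z hz hzy).le

/-- Near a point of the net, the centered dual graph is radial. -/
theorem IsNet.dilate_mem_centeredDualGraph (hS : IsNet S) {R : ℝ} (hR : R ≤ injRadius S)
    {x p : ℍ} (hx : x ∈ S) (hp : dist p x < R) (hpx : p ≠ x) {τ : ℝ} (h0 : 0 < τ) (h1 : τ ≤ 1) :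
    dilate x τ p ∈ centeredDualGraph S ↔ p ∈ centeredDualGraph S := by
  have hτ := dilate_mem_geodesicArc x p h0.le h1
  have hd : dist x (dilate x τ p) ≤ dist x p := by
    rw [mem_geodesicArc] at hτ
    have := dist_nonneg (x := dilate x τ p) (y := p)
    linarith
  have hd' : dist (dilate x τ p) x < R := by
    rw [dist_comm]; rw [dist_comm] at hp; linarith
  -- The half-arc through `q` starts at `x`, the unique nearest point, and leaves the disk, since
  -- its midpoint end `m` has two nearest points.
  have key : ∀ q, dist q x < R → q ∈ centeredDualGraph S →
      ∃ m, geodesicArc x m ⊆ centeredDualGraph S ∧ q ∈ geodesicArc x m ∧ ¬ dist m x < R := by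
    intro q hq hqG
    have hqx := hS.delaunayVertices_eq_of_mem_ball hR hx hq
    obtain ⟨a, b, m, hab, hm, hsub, -, hqm⟩ := hS.mem_centeredDualGraph hqG
    have hm1 : ∀ c, delaunayVertices S m ≠ {c} := fun c h => by
      rw [hm] at h
      have ha : a ∈ ({c} : Set ℍ) := h ▸ Set.mem_insert a {b}
      have hb : b ∈ ({c} : Set ℍ) := h ▸ Set.mem_insert_of_mem a rfl
      exact hab (ha.trans hb.symm)
    have hqm' : q ≠ m := fun h => hm1 x (h ▸ hqx)
    have := hS.delaunayVertices_eq_singleton (by rw [hm]; simp) hqm hqm'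
    rw [hqx] at this
    obtain rfl := Set.singleton_injective this
    exact ⟨m, hsub, hqm, fun h => hm1 x (hS.delaunayVertices_eq_of_mem_ball hR hx h)⟩
  constructor
  · intro h
    obtain ⟨m, hsub, hqm, hmR⟩ := key _ hd' h
    rcases mem_arc_or_mem_arc (fun h => hpx ((dilate_eq_iff h0.ne').1 h)) hτ hqm with h2 | h2
    · exact hsub h2
    · refine absurd ?_ hmR
      rw [mem_geodesicArc] at h2
      have := dist_nonneg (x := m) (y := p)
      rw [dist_comm] at hp ⊢
      linarith
  · intro h
    obtain ⟨m, hsub, hqm, -⟩ := key _ hp h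
    exact hsub (geodesicArc_subset_left hqm hτ)

theorem dist_dilate_le (x p : ℍ) {τ : ℝ} (h0 : 0 ≤ τ) (h1 : τ ≤ 1) :
    dist (dilate x τ p) x ≤ dist p x := by
  have hτ := dilate_mem_geodesicArc x p h0 h1
  rw [mem_geodesicArc] at hτ
  have := dist_nonneg (x := dilate x τ p) (y := p)
  rw [dist_comm, dist_comm p]
  linarith

/-- Inside the disk a radial segment without its center is either in the graph or disjoint from it;
in the second case it stays in one component. -/
theorem IsCellUnion.dilate_mem_iff (hC : IsCellUnion S C) (hS : IsNet S) {R : ℝ} (hR : R ≤ injRadius S)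
    {x p : ℍ} (hx : x ∈ S) (hp : dist p x < R) (hpx : p ≠ x) {τ : ℝ} (h0 : 0 < τ) (h1 : τ ≤ 1) :
    dilate x τ p ∈ C ↔ p ∈ C := by
  by_cases hpG : p ∈ (centeredDualGraph S)ᶜ
  · have hmem : dilate x τ p ∈ connectedComponentIn (centeredDualGraph S)ᶜ p := by
      refine (isPreconnected_dilate x p).subset_connectedComponentIn ⟨1, by simp, dilate_one x p⟩ ?_
        ⟨τ, ⟨h0, h1⟩, rfl⟩
      rintro _ ⟨σ, hσ, rfl⟩
      exact fun h => hpG ((hS.dilate_mem_centeredDualGraph hR hx hp hpx hσ.1 hσ.2).1 h)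
    have e := connectedComponentIn_eq hmem
    constructor
    · intro h
      refine hC.component_subset _ h ?_
      rw [← e]
      exact mem_connectedComponentIn hpG
    · exact fun h => hC.component_subset _ h hmem
  · refine iff_of_false (fun h => ?_) fun h => hpG (hC.subset h)
    exact hpG fun h' => hC.subset h
      ((hS.dilate_mem_centeredDualGraph hR hx hp hpx h0 h1).2 h')

theorem IsCellUnion.dilate_mem_closure_iff (hC : IsCellUnion S C) (hS : IsNet S) {R : ℝ} (hR : R ≤ injRadius S)
    {x p : ℍ} (hx : x ∈ S) (hp : dist p x < R) (hpx : p ≠ x) {τ : ℝ} (h0 : 0 < τ) (h1 : τ ≤ 1) :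
    dilate x τ p ∈ closure C ↔ p ∈ closure C := by
  have hopen : IsOpen (Metric.ball x R ∩ {x}ᶜ) :=
    Metric.isOpen_ball.inter isOpen_compl_singleton
  have hd := dist_dilate_le x p h0.le h1
  constructor
  · intro h
    have e : dilate x τ⁻¹ (dilate x τ p) = p := by
      rw [dilate_dilate, inv_mul_cancel₀ h0.ne', dilate_one]
    have hc := (continuous_dilate x τ⁻¹).tendsto (dilate x τ p)
    rw [e] at hc
    rw [mem_closure_iff_frequently] at h ⊢
    refine hc.frequently ((h.and_eventually (hc.eventually (hopen.mem_nhds ⟨hp, hpx⟩))).mono ?_)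
    rintro r ⟨hr, hrR, hrx⟩
    rw [← hC.dilate_mem_iff hS hR hx hrR hrx h0 h1, dilate_dilate, mul_inv_cancel₀ h0.ne',
      dilate_one]
    exact hr
  · intro h
    rw [mem_closure_iff_frequently] at h ⊢
    refine ((continuous_dilate x τ).tendsto p).frequently
      ((h.and_eventually (hopen.mem_nhds ⟨hp, hpx⟩)).mono ?_)
    rintro r ⟨hr, hrR, hrx⟩
    exact (hC.dilate_mem_iff hS hR hx hrR hrx h0 h1).2 hr

/-- Polygons without the vertex `x` do not contain `x`, and their union is closed by local
finiteness. -/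
theorem IsNet.eventually_mem_delaunayVertices (hS : IsNet S) {x : ℍ} (hx : x ∈ S) :
    ∀ᶠ q in 𝓝 x, ∀ v ∈ voronoiVertices S, q ∈ delaunayPolygon S v → x ∈ delaunayVertices S v := by
  have hcl : IsClosed (⋃ v ∈ {v ∈ voronoiVertices S | x ∉ delaunayVertices S v},
      delaunayPolygon S v) := hS.isClosed_biUnion_delaunayPolygon fun v hv => hv.1
  have hxn : x ∉ ⋃ v ∈ {v ∈ voronoiVertices S | x ∉ delaunayVertices S v},
      delaunayPolygon S v := by
    simp only [Set.mem_iUnion, not_exists]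
    exact fun v hv h => hv.2 (hS.mem_delaunayVertices_of_mem_polygon hx h)
  filter_upwards [hcl.isOpen_compl.mem_nhds hxn] with q hq v hv hqv
  by_contra h
  exact hq (Set.mem_biUnion (⟨hv, h⟩ : v ∈ {v ∈ voronoiVertices S | x ∉ delaunayVertices S v}) hqv)

theorem IsNet.eventually_dilate_mem_polygon (hS : IsNet S) {R : ℝ} {x v p : ℍ}
    (hv : v ∈ voronoiVertices S) (hx : x ∈ delaunayVertices S v)
    (hp : p ∈ sector R x (delaunayPolygon S v)) :
    ∀ᶠ τ in 𝓝[>] (0 : ℝ), dilate x τ p ∈ delaunayPolygon S v := by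
  obtain ⟨X, hX, -, -, hd⟩ := hS.exists_finset_vertices hv
  rw [delaunayPolygon, ← hX] at hp ⊢
  obtain ⟨ε, hε, h⟩ := exists_ball_sector_subset_hull hd (hX.symm ▸ hx : x ∈ (X : Set ℍ))
  obtain ⟨hpR, q, hq, hqx, hray⟩ := hp
  have h1 : ∀ᶠ τ in 𝓝[>] (0 : ℝ), ‖gans x (dilate x τ p)‖ < ε := by
    have := ((continuous_gans x).norm.tendsto x).comp (tendsto_dilate_zero x p)
    rw [gans_self, norm_zero] at this
    exact this.eventually (gt_mem_nhds hε)
  filter_upwards [h1, Ioc_mem_nhdsGT one_pos] with τ h1 hτ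
  refine h R _ ⟨(dist_dilate_le x p hτ.1.le hτ.2).trans_lt hpR, q, hq, hqx, ?_⟩ h1
  obtain ⟨l, hl, e⟩ := (mem_ray_iff hqx).1 hray
  refine (mem_ray_iff hqx).2 ⟨τ * l, mul_nonneg hτ.1.le hl, ?_⟩
  rw [gans_dilate, e, smul_smul]

theorem IsNet.exists_ne_mem_polygon (hS : IsNet S) {v : ℍ} (hv : v ∈ voronoiVertices S) (x : ℍ) :
    ∃ q ∈ delaunayPolygon S v, q ≠ x := by
  obtain ⟨a, ha, b, hb, -, -, hab, -⟩ := hS.mem_voronoiVertices.1 hv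
  by_cases h : a = x
  · exact ⟨b, subset_geodesicHull _ hb, fun h' => hab (h.trans h'.symm)⟩
  · exact ⟨a, subset_geodesicHull _ ha, h⟩

/-- A disk about a point of the net meets the cells in full sectors. -/
theorem IsCellUnion.ball_inter_closure (hC : IsCellUnion S C) (hS : IsNet S) {R : ℝ}
    (hR : R ≤ injRadius S) {x : ℍ} (hx : x ∈ S) :
    Metric.ball x R ∩ closure C =
      ⋃ v ∈ {v ∈ closure C ∩ voronoiVertices S |
        x ∈ delaunayVertices S v}, sector R x (delaunayPolygon S v) := by
  ext q
  simp only [Set.mem_iUnion, exists_prop, Set.mem_ofPred_eq, Set.mem_inter_iff, Metric.mem_ball]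
  constructor
  · rintro ⟨hqR, hq⟩
    rcases eq_or_ne q x with rfl | hqx
    · obtain ⟨v, hv, hvC, hqv⟩ := hC.exists_mem_delaunayPolygon hS hq
      obtain ⟨a, ha, hax⟩ := hS.exists_ne_mem_polygon hv q
      exact ⟨v, ⟨⟨hvC, hv⟩, hS.mem_delaunayVertices_of_mem_polygon hx hqv⟩, hqR, a, ha, hax,
        Or.inl (left_mem_geodesicArc _ _)⟩
    -- Contract `q` until every polygon containing it has `x` as a vertex; the ray through the
    -- contracted point passes through `q`.
    · obtain ⟨τ, h1, hτ⟩ := (((tendsto_dilate_zero x q).eventually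
        (hS.eventually_mem_delaunayVertices hx)).and (Ioc_mem_nhdsGT one_pos)).exists
      obtain ⟨v, hv, hvC, hqv⟩ := hC.exists_mem_delaunayPolygon hS
        ((hC.dilate_mem_closure_iff hS hR hx hqR hqx hτ.1 hτ.2).2 hq)
      exact ⟨v, ⟨⟨hvC, hv⟩, h1 v hv hqv⟩, hqR, _, hqv,
        fun h => hqx ((dilate_eq_iff hτ.1.ne').1 h),
        Or.inr (dilate_mem_geodesicArc x q hτ.1.le hτ.2)⟩
  · rintro ⟨v, ⟨⟨hvC, hv⟩, hxv⟩, hq⟩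
    refine ⟨hq.1, ?_⟩
    rcases eq_or_ne q x with rfl | hqx
    · exact hC.delaunayPolygon_subset hS hv hvC (subset_geodesicHull _ hxv)
    -- Conversely, contract a sector point into the polygon and expand it back inside the closure of
    -- the cell.
    · obtain ⟨τ, h1, hτ⟩ := ((hS.eventually_dilate_mem_polygon hv hxv hq).and
        (Ioc_mem_nhdsGT one_pos)).exists
      exact (hC.dilate_mem_closure_iff hS hR hx hq.1 hqx hτ.1 hτ.2).1
        (hC.delaunayPolygon_subset hS hv hvC h1)

end

section
open MeasureTheory Filter Topology

/-! ### Equivariance -/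

section Equivariance

variable {S : Set ℍ} (e : ℍ ≃ᵢ ℍ)

theorem map_mem_geodesicArc {x y p : ℍ} : e p ∈ geodesicArc (e x) (e y) ↔ p ∈ geodesicArc x y := by
  rw [mem_geodesicArc, mem_geodesicArc, e.dist_eq, e.dist_eq, e.dist_eq]

theorem map_mem_arcInterior {A : Set ℍ} {p : ℍ} :
    e p ∈ arcInterior A ↔ p ∈ arcInterior (e ⁻¹' A) := by
  simp only [arcInterior, Set.mem_ofPred_eq, Set.mem_preimage]
  refine and_congr_right fun _ => ?_
  rw [e.surjective.exists]
  refine exists_congr fun a => and_congr_right fun _ => ?_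
  rw [e.surjective.exists]
  simp [map_mem_geodesicArc]

theorem preimage_geodesicHull (X : Set ℍ) : e ⁻¹' geodesicHull X = geodesicHull (e ⁻¹' X) := by
  have key : ∀ (e : ℍ ≃ᵢ ℍ) (X : Set ℍ), geodesicHull (e ⁻¹' X) ⊆ e ⁻¹' geodesicHull X := by
    intro e X q hq K ⟨hK, hXK⟩
    refine hq (e ⁻¹' K) ⟨fun a ha b hb p hp => hK _ ha _ hb ((map_mem_geodesicArc e).2 hp), ?_⟩
    exact Set.preimage_mono hXK
  refine Set.Subset.antisymm (fun q hq => ?_) (key e X)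
  have h1 : e.symm ⁻¹' (e ⁻¹' X) = X := by ext; simp
  have := key e.symm (e ⁻¹' X) (by rw [h1]; exact hq : e q ∈ geodesicHull (e.symm ⁻¹' (e ⁻¹' X)))
  simpa using this

variable {e} (he : ∀ x, e x ∈ S ↔ x ∈ S)
include he

theorem map_mem_voronoiCell {x p : ℍ} : e p ∈ voronoiCell S (e x) ↔ p ∈ voronoiCell S x := by
  simp only [voronoiCell, Set.mem_ofPred_eq]
  rw [e.surjective.forall]
  simp only [he, e.dist_eq]

theorem map_mem_delaunayVertices {x v : ℍ} :
    e x ∈ delaunayVertices S (e v) ↔ x ∈ delaunayVertices S v :=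
  and_congr (he x) (map_mem_voronoiCell he)

theorem map_mem_voronoiVertices {v : ℍ} : e v ∈ voronoiVertices S ↔ v ∈ voronoiVertices S := by
  simp only [voronoiVertices, Set.mem_ofPred_eq, Set.mem_inter_iff]
  rw [e.surjective.exists]
  refine exists_congr fun x => and_congr (he x) ?_
  rw [e.surjective.exists]
  refine exists_congr fun y => and_congr (he y) ?_
  rw [e.surjective.exists]
  refine exists_congr fun z => and_congr (he z) ?_
  simp [map_mem_voronoiCell he]

theorem map_mem_delaunayPolygon {q v : ℍ} :
    e q ∈ delaunayPolygon S (e v) ↔ q ∈ delaunayPolygon S v := by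
  have h : e ⁻¹' delaunayVertices S (e v) = delaunayVertices S v := by
    ext x; exact map_mem_delaunayVertices he
  rw [delaunayPolygon, delaunayPolygon, ← h, ← preimage_geodesicHull, Set.mem_preimage]

theorem map_mem_interior_delaunayPolygon {q v : ℍ} :
    e q ∈ interior (delaunayPolygon S (e v)) ↔ q ∈ interior (delaunayPolygon S v) := by
  have h : e ⁻¹' delaunayPolygon S (e v) = delaunayPolygon S v := by
    ext x; exact map_mem_delaunayPolygon he
  rw [← h]
  exact (Set.ext_iff.1 (e.toHomeomorph.preimage_interior (delaunayPolygon S (e v))) q)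

theorem map_isCenteredEdge {x y : ℍ} : IsCenteredEdge S (e x) (e y) ↔ IsCenteredEdge S x y := by
  have h : e ⁻¹' (voronoiCell S (e x) ∩ voronoiCell S (e y)) =
      voronoiCell S x ∩ voronoiCell S y := by
    ext p; exact and_congr (map_mem_voronoiCell he) (map_mem_voronoiCell he)
  refine and_congr (and_congr (he x) (and_congr (he y) (and_congr ?_ ?_))) ?_
  · simp
  · rw [← h]
    simp only [Set.Nontrivial, Set.mem_preimage]
    rw [e.surjective.exists]
    refine exists_congr fun p => and_congr_right fun _ => ?_
    rw [e.surjective.exists]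
    simp
  · rw [← h, Set.Nonempty, e.surjective.exists, Set.Nonempty]
    refine exists_congr fun p => ?_
    rw [Set.mem_inter_iff, map_mem_arcInterior, map_mem_geodesicArc]; rfl

theorem map_mem_centeredDualGraph {p : ℍ} :
    e p ∈ centeredDualGraph S ↔ p ∈ centeredDualGraph S := by
  simp only [centeredDualGraph, Set.mem_ofPred_eq]
  rw [e.surjective.exists]
  refine exists_congr fun x => ?_
  rw [e.surjective.exists]
  refine exists_congr fun y => ?_
  rw [map_isCenteredEdge he, map_mem_geodesicArc]

theorem map_mem_sector {R : ℝ} {x v p : ℍ} : e p ∈ sector R (e x) (delaunayPolygon S (e v)) ↔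
    p ∈ sector R x (delaunayPolygon S v) := by
  simp only [sector, Set.mem_ofPred_eq, e.dist_eq]
  rw [e.surjective.exists]
  simp [map_mem_geodesicArc, map_mem_delaunayPolygon he]

end Equivariance

/-! ### Deck transformations -/

/-- A local isometry of the hyperbolic plane does not increase distances. -/
theorem dist_le_of_locally_isometric {g : ℍ → ℍ}
    (hg : ∀ z, ∀ᶠ p in 𝓝 z, dist (g z) (g p) = dist z p) (p q : ℍ) :
    dist (g p) (g q) ≤ dist p q := by
  have hgc : Continuous g := continuous_iff_continuousAt.2 fun z => by
    rw [ContinuousAt, tendsto_iff_dist_tendsto_zero]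
    have h1 : Tendsto (fun p => dist z p) (𝓝 z) (𝓝 0) := by
      have : Continuous fun p => dist z p := by fun_prop
      simpa using this.tendsto z
    refine h1.congr' ?_
    filter_upwards [hg z] with p hp
    rw [← hp, dist_comm]
  have hγ := continuous_dilate_left p q
  -- Continuous induction along the arc from `p` to `q`: the set of good parameters is closed, and
  -- local isometry pushes it beyond each of its points.
  have hcl : IsClosed ({t : ℝ | dist (g p) (g (dilate p t q)) ≤ dist p (dilate p t q)} ∩
      Set.Icc 0 1) :=
    (isClosed_le (continuous_const.dist (hgc.comp hγ)) (continuous_const.dist hγ)).inter isClosed_Icc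
  have h0 : dilate p 0 q = p := by apply gans_injective p; simp
  have h := hcl.mem_of_ge_of_forall_exists_gt (by simp [h0]) zero_le_one (fun t ht => by
    have h1 := (hγ.tendsto t).eventually (hg (dilate p t q))
    have h2 : ∀ᶠ s in 𝓝[>] t, s ∈ Set.Ioc t 1 := Ioc_mem_nhdsGT ht.2.2
    obtain ⟨s, hs, hts⟩ := ((h1.filter_mono nhdsWithin_le_nhds).and h2).exists
    refine ⟨s, ?_, hts⟩
    have h3 := dilate_mem_geodesicArc_dilate p q ht.2.1 hts.1.le
    rw [mem_geodesicArc] at h3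
    have h4 := dist_triangle (g p) (g (dilate p t q)) (g (dilate p s q))
    have h5 : dist (g p) (g (dilate p t q)) ≤ dist p (dilate p t q) := ht.1
    simp only [Set.mem_ofPred_eq]
    linarith)
  simpa using h

variable {F : Type*} [MetricSpace F] {π : ℍ → F}

/-- The plane is simply connected, so `π` lifts through itself with a prescribed value, and the lift
is locally isometric because `π` is. -/
theorem IsLocallyIsometricCovering.exists_lift (hπ : IsLocallyIsometricCovering π) {p q : ℍ}
    (hpq : π p = π q) : ∃ g : ℍ → ℍ, Continuous g ∧ g p = q ∧ (∀ z, π (g z) = π z) ∧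
      ∀ a b, dist (g a) (g b) ≤ dist a b := by
  obtain ⟨g, ⟨hg1, hg2⟩, -⟩ := hπ.isCoveringMap.existsUnique_continuousMap_lifts
    ⟨π, hπ.isCoveringMap.continuous⟩ p q hpq.symm
  have hg3 : ∀ z, π (g z) = π z := fun z => congrFun hg2 z
  refine ⟨g, g.continuous, hg1, hg3, dist_le_of_locally_isometric fun z => ?_⟩
  obtain ⟨r, hr, h⟩ := hπ.locally_isometric z
  obtain ⟨r', hr', h'⟩ := hπ.locally_isometric (g z)
  filter_upwards [Metric.ball_mem_nhds z hr,
    g.continuous.continuousAt.preimage_mem_nhds (Metric.ball_mem_nhds (g z) hr')] with a ha hga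
  rw [← h z (Metric.mem_ball_self hr) a ha, ← h' _ (Metric.mem_ball_self hr') _ hga, hg3, hg3]

theorem IsLocallyIsometricCovering.eq_of_lift_eq (hπ : IsLocallyIsometricCovering π) {g h : ℍ → ℍ}
    (hg : Continuous g) (hh : Continuous h) (hg' : ∀ z, π (g z) = π z) (hh' : ∀ z, π (h z) = π z)
    {p : ℍ} (hp : g p = h p) : g = h :=
  hπ.isCoveringMap.eq_of_comp_eq hg hh (funext fun z => by simp [hg', hh']) p hp

/-- The deck transformations of `π`. -/
def Deck (π : ℍ → F) : Type := {e : ℍ ≃ᵢ ℍ // ∀ z, π (e z) = π z}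

/-- The lifts `p ↦ q` and `q ↦ p` are inverse to each other by uniqueness of lifts. Both do not
increase distances, hence both preserve them. -/
theorem IsLocallyIsometricCovering.exists_deck (hπ : IsLocallyIsometricCovering π) {p q : ℍ}
    (hpq : π p = π q) : ∃ e : Deck π, e.1 p = q := by
  obtain ⟨g, hg, hgp, hg', hgd⟩ := hπ.exists_lift hpq
  obtain ⟨h, hh, hhq, hh', hhd⟩ := hπ.exists_lift hpq.symm
  have h1 : h ∘ g = id := hπ.eq_of_lift_eq (hh.comp hg) continuous_id
    (fun z => by simp [hg', hh']) (fun z => rfl) (p := p) (by simp [hgp, hhq])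
  have h2 : g ∘ h = id := hπ.eq_of_lift_eq (hg.comp hh) continuous_id
    (fun z => by simp [hg', hh']) (fun z => rfl) (p := q) (by simp [hgp, hhq])
  refine ⟨⟨⟨⟨g, h, congrFun h1, congrFun h2⟩, Isometry.of_dist_eq fun a b => ?_⟩, hg'⟩, hgp⟩
  refine le_antisymm (hgd a b) ?_
  have := hhd (g a) (g b)
  rwa [show h (g a) = a from congrFun h1 a, show h (g b) = b from congrFun h1 b] at this

theorem IsLocallyIsometricCovering.deck_ext (hπ : IsLocallyIsometricCovering π) {e e' : Deck π}
    {p : ℍ} (h : e.1 p = e'.1 p) : e = e' := by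
  refine Subtype.ext (IsometryEquiv.ext fun z => ?_)
  exact congrFun (hπ.eq_of_lift_eq e.1.continuous e'.1.continuous e.2 e'.2 h) z

theorem Deck.mem_preimage (e : Deck π) (S : Set F) (x : ℍ) : e.1 x ∈ π ⁻¹' S ↔ x ∈ π ⁻¹' S := by
  rw [Set.mem_preimage, e.2, Set.mem_preimage]

theorem IsLocallyIsometricCovering.exists_closedBall [CompactSpace F]
    (hπ : IsLocallyIsometricCovering π) (p : ℍ) :
    ∃ N : ℝ, ∀ f : F, ∃ q ∈ Metric.closedBall p N, π q = f := by
  have hcov : (Set.univ : Set F) ⊆ ⋃ n : ℕ, π '' Metric.ball p n := fun f _ => by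
    obtain ⟨q, rfl⟩ := hπ.surjective f
    obtain ⟨n, hn⟩ := exists_nat_gt (dist q p)
    exact Set.mem_iUnion.2 ⟨n, q, hn, rfl⟩
  obtain ⟨t, ht⟩ := isCompact_univ.elim_finite_subcover _
    (fun n : ℕ => hπ.isCoveringMap.isOpenMap _ (Metric.isOpen_ball (x := p) (ε := n))) hcov
  refine ⟨(t.sup id : ℕ), fun f => ?_⟩
  obtain ⟨n, hn, q, hq, rfl⟩ := Set.mem_iUnion₂.1 (ht (Set.mem_univ f))
  refine ⟨q, ?_, rfl⟩
  have h1 : (n : ℝ) ≤ (t.sup id : ℕ) := by exact_mod_cast Finset.le_sup (f := id) hn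
  rw [Metric.mem_ball] at hq
  exact hq.le.trans h1

theorem IsLocallyIsometricCovering.finite_preimage_inter (hπ : IsLocallyIsometricCovering π)
    {S : Set F} (hS : S.Finite) {K : Set ℍ} (hK : IsCompact K) : (π ⁻¹' S ∩ K).Finite := by
  choose r hr h using hπ.locally_isometric
  obtain ⟨t, -, ht⟩ := hK.elim_nhds_subcover (fun z => Metric.ball z (r z))
    fun z _ => Metric.ball_mem_nhds z (hr z)
  refine Set.Finite.subset (s := ⋃ z ∈ t, π ⁻¹' S ∩ Metric.ball z (r z)) ?_ ?_
  · refine t.finite_toSet.biUnion fun z _ => ?_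
    refine Set.Finite.of_finite_image (f := π) (hS.subset ?_) ?_
    · rintro _ ⟨p, hp, rfl⟩; exact hp.1
    · intro p hp q hq hpq
      have := h z p hp.2 q hq.2
      rw [hpq, dist_self] at this
      exact dist_eq_zero.1 this.symm
  · rintro p ⟨hp, hpK⟩
    obtain ⟨z, hz, hpz⟩ := Set.mem_iUnion₂.1 (ht hpK)
    exact Set.mem_iUnion₂.2 ⟨z, hz, hp, hpz⟩

/-- Compactness gives a closed ball about one lift `x` that maps onto `F`; its radius bounds the
distance from any point to the deck translates of `x`. -/
theorem IsLocallyIsometricCovering.isNet [CompactSpace F] (hπ : IsLocallyIsometricCovering π)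
    {S : Set F} (hfin : S.Finite) (hne : S.Nonempty) : IsNet (π ⁻¹' S) := by
  refine ⟨fun p r => hπ.finite_preimage_inter hfin (isCompact_closedBall p r), ?_⟩
  obtain ⟨s, hs⟩ := hne
  obtain ⟨x, rfl⟩ := hπ.surjective s
  obtain ⟨N, hN⟩ := hπ.exists_closedBall x
  refine ⟨N, fun p => ?_⟩
  obtain ⟨q, hq, hqp⟩ := hN (π p)
  obtain ⟨e, rfl⟩ := hπ.exists_deck hqp
  exact ⟨e.1 x, (e.mem_preimage S x).2 hs, by rwa [e.1.dist_eq]⟩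

theorem IsLocallyIsometricCovering.countable_deck [CompactSpace F]
    (hπ : IsLocallyIsometricCovering π) : Countable (Deck π) := by
  set x := UpperHalfPlane.I
  have h := (hπ.isNet (Set.finite_singleton (π x)) ⟨_, rfl⟩).countable
  have : Countable (π ⁻¹' {π x}) := h
  exact Function.Injective.countable (f := fun e : Deck π =>
    (⟨e.1 x, by simp [e.2]⟩ : (π ⁻¹' {π x} : Set ℍ)))
    fun e e' h => hπ.deck_ext (p := x) (congrArg Subtype.val h)

/-- Comparison of the areas of two sets one of which projects injectively into the image of the
other. -/
theorem IsLocallyIsometricCovering.volume_le [CompactSpace F] (hπ : IsLocallyIsometricCovering π)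
    {A B : Set ℍ} (hA : MeasurableSet A) (hB : MeasurableSet B) (hinj : Set.InjOn π A)
    (hAB : π '' A ⊆ π '' B) : volume A ≤ volume B := by
  have := hπ.countable_deck
  -- Cut `A` into pieces that deck transformations carry into `B`. The carried pieces are disjoint
  -- because `π` is injective on `A` and deck transformations are determined by one value.
  have h1 : A ⊆ ⋃ e : Deck π, e.1 ⁻¹' (e.1.symm ⁻¹' A ∩ B) := by
    intro p hp
    obtain ⟨b, hb, hbp⟩ := hAB ⟨p, hp, rfl⟩
    obtain ⟨e, rfl⟩ := hπ.exists_deck hbp.symm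
    exact Set.mem_iUnion.2 ⟨e, by simpa using ⟨hp, hb⟩⟩
  have hm : ∀ e : Deck π, MeasurableSet (e.1.symm ⁻¹' A ∩ B) := fun e =>
    (hA.preimage e.1.symm.continuous.measurable).inter hB
  calc volume A ≤ volume (⋃ e : Deck π, e.1 ⁻¹' (e.1.symm ⁻¹' A ∩ B)) := measure_mono h1
    _ ≤ ∑' e : Deck π, volume (e.1 ⁻¹' (e.1.symm ⁻¹' A ∩ B)) := measure_iUnion_le _
    _ = ∑' e : Deck π, volume (e.1.symm ⁻¹' A ∩ B) := by
      refine tsum_congr fun e => volume_preimage_isometry e.1.isometry e.1.surjective (hm e)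
    _ = volume (⋃ e : Deck π, e.1.symm ⁻¹' A ∩ B) := by
      refine (measure_iUnion ?_ hm).symm
      intro e e' hee
      rw [Function.onFun, Set.disjoint_left]
      rintro p ⟨hp, -⟩ ⟨hp', -⟩
      refine hee ?_
      have h2 : ∀ e : Deck π, π (e.1.symm p) = π p := fun e => by
        rw [← e.2 (e.1.symm p), e.1.apply_symm_apply]
      have h3 := hinj hp hp' ((h2 e).trans (h2 e').symm)
      refine hπ.deck_ext (p := e.1.symm p) ?_
      rw [e.1.apply_symm_apply]
      conv_rhs => rw [h3, e'.1.apply_symm_apply]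
    _ ≤ volume B := measure_mono (Set.iUnion_subset fun e => Set.inter_subset_right)

end

section
open MeasureTheory Filter Topology

variable {S : Set ℍ}

/-! ### Areas of Delaunay polygons and of their sectors -/

theorem measurableSet_sector {v x : ℍ} {ρ : ℝ} (hρ : 0 < ρ) {X : Finset ℍ} (h2 : 2 ≤ X.card)
    (hX : ∀ w ∈ X, dist v w = ρ) (hx : x ∈ X) (R : ℝ) :
    MeasurableSet (sector R x (geodesicHull (X : Set ℍ))) := by
  obtain ⟨w0, hw0, hw0x⟩ : ∃ w ∈ X, w ≠ x := Finset.exists_mem_ne (by omega) x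
  obtain ⟨y, hy, z, hz, hyx, hzx, hext⟩ := exists_extremal_vertices (v := v) ⟨w0, hw0, hw0x⟩
  rw [← Set.sdiff_union_inter (sector R x (geodesicHull (X : Set ℍ))) {x},
    sector_eq hρ hX hx hy hz hyx hzx hext]
  refine MeasurableSet.union ?_
    ((Set.finite_singleton x).subset Set.inter_subset_right).measurableSet
  have hm : Measurable fun p => rotor v x * gans x p := (measurable_gans x).const_mul _
  have hh : Measurable halfAngle := by unfold halfAngle; fun_prop
  exact (measurableSet_lt (continuous_id.dist continuous_const).measurable measurable_const).inter
    ((measurableSet_lt measurable_const (Complex.measurable_re.comp hm)).inter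
      ((hh.comp hm) measurableSet_Icc))

theorem IsNet.volume_delaunayPolygon (hS : IsNet S) {v : ℍ} (hv : v ∈ voronoiVertices S) :
    0 ≤ (((delaunayVertices S v).ncard : ℝ) - 2) * Real.pi -
        ∑ x ∈ (hS.finite_delaunayVertices v).toFinset, interiorAngle (delaunayVertices S v) x ∧
      volume (delaunayPolygon S v) = ENNReal.ofReal ((((delaunayVertices S v).ncard : ℝ) - 2) *
        Real.pi - ∑ x ∈ (hS.finite_delaunayVertices v).toFinset,
          interiorAngle (delaunayVertices S v) x) := by
  obtain ⟨X, hX, h3, h0, hd⟩ := hS.exists_finset_vertices hv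
  have hX' : (hS.finite_delaunayVertices v).toFinset = X := by
    rw [← Finset.coe_inj, Set.Finite.coe_toFinset, hX]
  rw [hX', delaunayPolygon, ← hX, Set.ncard_coe_finset]
  exact volume_cyclic_polygon h0 h3 hd

theorem IsNet.volume_sector (hS : IsNet S) {v x : ℍ} (hv : v ∈ voronoiVertices S)
    (hx : x ∈ delaunayVertices S v) {R : ℝ} (hR : 0 ≤ R) :
    0 ≤ interiorAngle (delaunayVertices S v) x ∧ volume (sector R x (delaunayPolygon S v)) =
      ENNReal.ofReal ((Real.cosh R - 1) * interiorAngle (delaunayVertices S v) x) := by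
  obtain ⟨X, hX, h3, h0, hd⟩ := hS.exists_finset_vertices hv
  rw [delaunayPolygon]
  rw [← hX] at hx ⊢
  exact CenteredDual.volume_sector h0 (by omega) hd hx hR

theorem IsNet.measurableSet_sector (hS : IsNet S) {v x : ℍ} (hv : v ∈ voronoiVertices S)
    (hx : x ∈ delaunayVertices S v) (R : ℝ) :
    MeasurableSet (sector R x (delaunayPolygon S v)) := by
  obtain ⟨X, hX, h3, h0, hd⟩ := hS.exists_finset_vertices hv
  rw [delaunayPolygon]
  rw [← hX] at hx ⊢
  exact CenteredDual.measurableSet_sector h0 (by omega) hd hx R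

/-- The sector at `x` determined by `P_v`, without the rays through the vertices of `P_v`. -/
def openSector (S : Set ℍ) (R : ℝ) (v x : ℍ) : Set ℍ :=
  sector R x (delaunayPolygon S v) \ ⋃ b ∈ delaunayVertices S v \ {x}, {p | orient x b p = 0}

theorem IsNet.measurableSet_openSector (hS : IsNet S) {v x : ℍ} (hv : v ∈ voronoiVertices S)
    (hx : x ∈ delaunayVertices S v) (R : ℝ) : MeasurableSet (openSector S R v x) := by
  refine (hS.measurableSet_sector hv hx R).diff (MeasurableSet.biUnion
    ((hS.finite_delaunayVertices v).subset Set.sdiff_subset).countable fun b _ => ?_)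
  exact (isClosed_eq (continuous_orient x b) continuous_const).measurableSet

theorem IsNet.volume_openSector (hS : IsNet S) (R : ℝ) (v x : ℍ) :
    volume (openSector S R v x) = volume (sector R x (delaunayPolygon S v)) := by
  refine measure_sdiff_null ((measure_biUnion_null_iff
    ((hS.finite_delaunayVertices v).subset Set.sdiff_subset).countable).2 fun b hb => ?_)
  exact volume_line (orientForm_ne_zero (Ne.symm hb.2))

/-- Close to `x` no line through two vertices is met: lines through `x` were removed from the open
sector, and the others keep away from `x`. -/
theorem IsNet.eventually_dilate_mem_interior (hS : IsNet S) {R : ℝ} {v x p : ℍ}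
    (hv : v ∈ voronoiVertices S) (hx : x ∈ delaunayVertices S v) (hp : p ∈ openSector S R v x) :
    ∀ᶠ τ in 𝓝[>] (0 : ℝ), dilate x τ p ∈ interior (delaunayPolygon S v) := by
  have h1 := hS.eventually_dilate_mem_polygon hv hx hp.1
  obtain ⟨X, hX, h3, h0, hd⟩ := hS.exists_finset_vertices hv
  have hgen : ∀ b ∈ X, b ≠ x → orient x b p ≠ 0 := fun b hb hbx h =>
    hp.2 (Set.mem_biUnion (⟨hX ▸ hb, hbx⟩ : b ∈ delaunayVertices S v \ {x}) h)
  rw [delaunayPolygon, ← hX] at h1 ⊢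
  have hxX : x ∈ X := by rw [← Finset.mem_coe, hX]; exact hx
  have hor : ∀ a ∈ X, ∀ b ∈ X, ∀ᶠ τ in 𝓝[>] (0 : ℝ), a ≠ b → orient a b (dilate x τ p) ≠ 0 := by
    have key : ∀ b ∈ X, b ≠ x → ∀ᶠ τ in 𝓝[>] (0 : ℝ), orient x b (dilate x τ p) ≠ 0 := by
      intro b hb hbx
      filter_upwards [Ioc_mem_nhdsGT one_pos] with τ hτ
      obtain ⟨s, -, hs⟩ := lorentzVec_dilate x p hτ.1 hτ.2
      rw [orient, hs, map_add, map_smul, map_smul, ← orient, ← orient, orient_self_left, smul_zero,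
        zero_add]
      exact smul_ne_zero hτ.1.ne' (hgen b hb hbx)
    intro a ha b hb
    by_cases hab : a = b
    · exact .of_forall fun τ h => absurd hab h
    by_cases hax : a = x
    · subst hax
      filter_upwards [key b hb (Ne.symm hab)] with τ h _ using h
    by_cases hbx : b = x
    · subst hbx
      filter_upwards [key a ha hab] with τ h _
      rwa [orient_swap, neg_ne_zero]
    have hne : orient a b x ≠ 0 := orient_ne_zero (v := v) (by rw [hd a ha, hd b hb])
      (by rw [hd a ha, hd x hxX]) hab hax hbx
    filter_upwards [(tendsto_dilate_zero x p).eventually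
      ((continuous_orient a b).continuousAt.eventually_ne hne)] with τ h _ using h
  have h4 := (Finset.eventually_all X).2 fun a ha => (Finset.eventually_all X).2 (hor a ha)
  filter_upwards [h1, h4] with τ h5 h6
  exact mem_interior_of_orient_ne_zero hd h3 h5 h6

theorem map_dilate (e : ℍ ≃ᵢ ℍ) (x p : ℍ) {τ : ℝ} (h0 : 0 ≤ τ) (h1 : τ ≤ 1) :
    e (dilate x τ p) = dilate (e x) τ (e p) := by
  rcases eq_or_ne p x with rfl | hpx
  · simp
  obtain ⟨σ, hσ0, -, h⟩ := exists_dilate_of_mem_geodesicArc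
    ((map_mem_geodesicArc e).2 (dilate_mem_geodesicArc x p h0 h1))
  have h2 : dist x (dilate x τ p) = dist (e x) (dilate (e x) σ (e p)) := by rw [← h, e.dist_eq]
  have h3 : ‖gans x p‖ = ‖gans (e x) (e p)‖ := by rw [norm_gans, norm_gans, e.dist_eq]
  have h4 := norm_gans x (dilate x τ p)
  rw [h2, ← norm_gans, gans_dilate, gans_dilate, norm_smul, norm_smul, ← h3, Real.norm_eq_abs,
    Real.norm_eq_abs, abs_of_nonneg h0, abs_of_nonneg hσ0] at h4
  have h5 : ‖gans x p‖ ≠ 0 := norm_ne_zero_iff.2 fun h => hpx (gans_eq_zero_iff.1 h)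
  rw [h, mul_right_cancel₀ h5 h4]

/-! ### The area of a cell -/

section Union

variable {F : Type*} {V : Finset F} {σ : F → ℍ}

/-- The union of the chosen lifts of the Delaunay polygons of a cell. -/
def polygonUnion (S : Set ℍ) (V : Finset F) (σ : F → ℍ) : Set ℍ :=
  ⋃ f ∈ V, delaunayPolygon S (σ f)

/-- The union of the interiors of the chosen lifts of the Delaunay polygons of a cell. -/
def interiorUnion (S : Set ℍ) (V : Finset F) (σ : F → ℍ) : Set ℍ :=
  ⋃ f ∈ V, interior (delaunayPolygon S (σ f))

theorem mem_polygonUnion {q : ℍ} :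
    q ∈ polygonUnion S V σ ↔ ∃ f ∈ V, q ∈ delaunayPolygon S (σ f) := by
  simp [polygonUnion]

theorem mem_interiorUnion {q : ℍ} :
    q ∈ interiorUnion S V σ ↔ ∃ f ∈ V, q ∈ interior (delaunayPolygon S (σ f)) := by
  simp [interiorUnion]

theorem measurableSet_interiorUnion : MeasurableSet (interiorUnion S V σ) :=
  (isOpen_biUnion fun _ _ => isOpen_interior).measurableSet

theorem IsNet.measurableSet_polygonUnion (hS : IsNet S) : MeasurableSet (polygonUnion S V σ) :=
  V.measurableSet_biUnion fun f _ => (hS.isCompact_delaunayPolygon (σ f)).isClosed.measurableSet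

theorem interiorUnion_subset : interiorUnion S V σ ⊆ polygonUnion S V σ :=
  Set.iUnion₂_mono fun _ _ => interior_subset

end Union

variable {F : Type*} [MetricSpace F] {π : ℍ → F}

/-- The preimage of a cell of `F` may have many components, which is the reason for working with
`IsCellUnion`. The graph is deck invariant, so `π` maps components of its complement into
components. -/
theorem IsLocallyIsometricCovering.isCellUnion (hπ : IsLocallyIsometricCovering π) (S : Set F)
    (f : F) : IsCellUnion (π ⁻¹' S)
      (π ⁻¹' connectedComponentIn (π '' centeredDualGraph (π ⁻¹' S))ᶜ f) := by
  have hG : ∀ p, p ∉ centeredDualGraph (π ⁻¹' S) → π p ∉ π '' centeredDualGraph (π ⁻¹' S) := by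
    rintro p hp ⟨q, hq, hqp⟩
    obtain ⟨e, rfl⟩ := hπ.exists_deck hqp
    exact hp ((map_mem_centeredDualGraph (e.mem_preimage S)).2 hq)
  refine ⟨fun q hq h => connectedComponentIn_subset _ _ hq ⟨q, h, rfl⟩, fun q hq => ?_⟩
  by_cases hqG : q ∈ (centeredDualGraph (π ⁻¹' S))ᶜ
  · rw [← Set.image_subset_iff, connectedComponentIn_eq hq]
    refine (isPreconnected_connectedComponentIn.image π
      hπ.isCoveringMap.continuous.continuousOn).subset_connectedComponentIn
      ⟨q, mem_connectedComponentIn hqG, rfl⟩ ?_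
    rintro _ ⟨p, hp, rfl⟩
    exact hG p (connectedComponentIn_subset _ _ hp)
  · rw [connectedComponentIn_eq_empty hqG]
    exact Set.empty_subset _

theorem IsLocallyIsometricCovering.finite_voronoiVertices [CompactSpace F]
    (hπ : IsLocallyIsometricCovering π) {S : Set F} (hS : IsNet (π ⁻¹' S)) :
    (π '' voronoiVertices (π ⁻¹' S)).Finite := by
  obtain ⟨N, hN⟩ := hπ.exists_closedBall UpperHalfPlane.I
  refine ((hS.finite_voronoiVertices_inter UpperHalfPlane.I N).image π).subset ?_
  rintro _ ⟨v, hv, rfl⟩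
  obtain ⟨q, hq, hqv⟩ := hN (π v)
  obtain ⟨e, rfl⟩ := hπ.exists_deck hqv
  exact ⟨q, ⟨(map_mem_voronoiVertices (e.mem_preimage S)).1 hv, hq⟩, hqv⟩

/-- The union of the disks of radius `R` about the points of `S`. -/
def diskUnion (S : Set ℍ) (R : ℝ) : Set ℍ := ⋃ x ∈ S, Metric.ball x R

theorem mem_diskUnion {R : ℝ} {p : ℍ} : p ∈ diskUnion S R ↔ ∃ x ∈ S, dist p x < R := by
  simp [diskUnion]

theorem isOpen_diskUnion (R : ℝ) : IsOpen (diskUnion S R) :=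
  isOpen_biUnion fun _ _ => Metric.isOpen_ball

theorem iUnion_surfaceDisk (S : Set F) (R : ℝ) :
    ⋃ x ∈ S, surfaceDisk π x R = π '' diskUnion (π ⁻¹' S) R := by
  ext f
  simp only [Set.mem_iUnion, surfaceDisk, Set.mem_ofPred_eq, Set.mem_image, mem_diskUnion,
    exists_prop]
  constructor
  · rintro ⟨_, hx, x', p', rfl, rfl, h⟩
    exact ⟨p', ⟨x', hx, h⟩, rfl⟩
  · rintro ⟨p, ⟨x, hx, h⟩, rfl⟩
    exact ⟨π x, hx, x, p, rfl, rfl, h⟩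

theorem Deck.mem_diskUnion_iff (e : Deck π) (S : Set F) {R : ℝ} {p : ℍ} :
    e.1 p ∈ diskUnion (π ⁻¹' S) R ↔ p ∈ diskUnion (π ⁻¹' S) R := by
  rw [mem_diskUnion, mem_diskUnion, e.1.surjective.exists]
  refine exists_congr fun x => ?_
  rw [e.mem_preimage, e.1.dist_eq]

theorem IsLocallyIsometricCovering.mem_diskUnion_iff (hπ : IsLocallyIsometricCovering π) {S : Set F}
    {R : ℝ} {p : ℍ} : π p ∈ π '' diskUnion (π ⁻¹' S) R ↔ p ∈ diskUnion (π ⁻¹' S) R := by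
  refine ⟨?_, fun h => ⟨p, h, rfl⟩⟩
  rintro ⟨q, hq, hqp⟩
  obtain ⟨e, rfl⟩ := hπ.exists_deck hqp
  exact (e.mem_diskUnion_iff S).2 hq

/-- A choice of finitely many lifts of the Voronoi vertices in a cell. -/
structure IsTransversal (π : ℍ → F) (S : Set F) (C : Set ℍ) (V : Finset F) (σ : F → ℍ) : Prop where
  lift : ∀ v, π (σ v) = v
  mem_vertices : ∀ v ∈ V, σ v ∈ voronoiVertices (π ⁻¹' S)
  mem_closure : ∀ v ∈ V, σ v ∈ closure C
  exists_mem : ∀ w ∈ voronoiVertices (π ⁻¹' S), w ∈ closure C → π w ∈ V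

/-! ### Comparing areas through chosen lifts -/

section Cell

variable {T : Set F} {C : Set ℍ} {V : Finset F} {σ : F → ℍ} {R : ℝ}

theorem IsTransversal.exists_deck (hV : IsTransversal π T C V σ)
    (hπ : IsLocallyIsometricCovering π) {w : ℍ} (hw : w ∈ voronoiVertices (π ⁻¹' T))
    (hwC : w ∈ closure C) : ∃ e : Deck π, ∃ f ∈ V, e.1 w = σ f := by
  obtain ⟨e, he⟩ := hπ.exists_deck (hV.lift (π w)).symm
  exact ⟨e, π w, hV.exists_mem w hw hwC, he⟩

theorem IsTransversal.exists_deck_polygon (hV : IsTransversal π T C V σ)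
    (hπ : IsLocallyIsometricCovering π) (hS : IsNet (π ⁻¹' T)) (hC : IsCellUnion (π ⁻¹' T) C)
    {q : ℍ} (hq : q ∈ closure C) :
    ∃ e : Deck π, ∃ f ∈ V, e.1 q ∈ delaunayPolygon (π ⁻¹' T) (σ f) := by
  obtain ⟨v, hv, hvC, hqv⟩ := hC.exists_mem_delaunayPolygon hS hq
  obtain ⟨e, f, hf, he⟩ := hV.exists_deck hπ hv hvC
  exact ⟨e, f, hf, by rwa [← he, map_mem_delaunayPolygon (e.mem_preimage T)]⟩

theorem IsTransversal.exists_deck_sector (hV : IsTransversal π T C V σ)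
    (hπ : IsLocallyIsometricCovering π) (hS : IsNet (π ⁻¹' T)) (hC : IsCellUnion (π ⁻¹' T) C)
    (hR : R ≤ injRadius (π ⁻¹' T)) {q : ℍ} (hq : q ∈ closure C) (hqR : q ∈ diskUnion (π ⁻¹' T) R) :
    ∃ e : Deck π, ∃ f ∈ V, ∃ x ∈ delaunayVertices (π ⁻¹' T) (σ f),
      e.1 q ∈ sector R x (delaunayPolygon (π ⁻¹' T) (σ f)) := by
  obtain ⟨x, hx, hqx⟩ := mem_diskUnion.1 hqR
  have h := (Set.ext_iff.1 (hC.ball_inter_closure hS hR hx) q).1 ⟨hqx, hq⟩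
  simp only [Set.mem_iUnion, exists_prop, Set.mem_ofPred_eq, Set.mem_inter_iff] at h
  obtain ⟨v, ⟨⟨hvC, hv⟩, hxv⟩, hqv⟩ := h
  obtain ⟨e, f, hf, he⟩ := hV.exists_deck hπ hv hvC
  refine ⟨e, f, hf, e.1 x, ?_, ?_⟩
  · rwa [← he, map_mem_delaunayVertices (e.mem_preimage T)]
  · rwa [← he, map_mem_sector (e.mem_preimage T)]

theorem IsTransversal.eq_of_deck (hV : IsTransversal π T C V σ)
    (hπ : IsLocallyIsometricCovering π) {e : Deck π} {f f' : F} (h : e.1 (σ f) = σ f') :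
    f = f' ∧ ∀ p, e.1 p = p := by
  have hff : f = f' := by
    rw [← hV.lift f, ← hV.lift f', ← h, e.2]
  subst hff
  refine ⟨rfl, fun p => ?_⟩
  have : e = ⟨IsometryEquiv.refl ℍ, fun _ => rfl⟩ := hπ.deck_ext (p := σ f) h
  rw [this]; rfl

theorem IsTransversal.eq_of_mem_interior (hV : IsTransversal π T C V σ)
    (hπ : IsLocallyIsometricCovering π) (hS : IsNet (π ⁻¹' T)) {f f' : F} {p p' : ℍ}
    (hp : p ∈ interior (delaunayPolygon (π ⁻¹' T) (σ f)))
    (hp' : p' ∈ interior (delaunayPolygon (π ⁻¹' T) (σ f'))) (h : π p = π p') :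
    f = f' ∧ p = p' := by
  obtain ⟨e, rfl⟩ := hπ.exists_deck h
  rw [← map_mem_interior_delaunayPolygon (e.mem_preimage T)] at hp
  have h1 : e.1 (σ f) = σ f' := by
    by_contra hne
    exact Set.disjoint_left.1 (hS.disjoint_interior hne) hp (interior_subset hp')
  obtain ⟨h2, h3⟩ := hV.eq_of_deck hπ h1
  exact ⟨h2, (h3 p).symm⟩

/-- In the disk the nearest net point is unique, so a deck transformation matching the points
matches `x` with `x'`. Contraction towards the vertex then moves both points into polygon interiors,
which are disjoint or equal. -/
theorem IsTransversal.eq_of_mem_openSector (hV : IsTransversal π T C V σ)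
    (hπ : IsLocallyIsometricCovering π) (hS : IsNet (π ⁻¹' T)) (hR : R ≤ injRadius (π ⁻¹' T))
    {f f' : F} (hf : f ∈ V) (hf' : f' ∈ V) {x x' p p' : ℍ}
    (hx : x ∈ delaunayVertices (π ⁻¹' T) (σ f)) (hx' : x' ∈ delaunayVertices (π ⁻¹' T) (σ f'))
    (hp : p ∈ openSector (π ⁻¹' T) R (σ f) x) (hp' : p' ∈ openSector (π ⁻¹' T) R (σ f') x')
    (h : π p = π p') : f = f' ∧ x = x' ∧ p = p' := by
  obtain ⟨e, rfl⟩ := hπ.exists_deck h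
  have hex : e.1 x = x' := by
    have h1 := hS.delaunayVertices_eq_of_mem_ball hR hx.1 hp.1.1
    have h2 := hS.delaunayVertices_eq_of_mem_ball hR hx'.1 hp'.1.1
    have h3 : e.1 x ∈ delaunayVertices (π ⁻¹' T) (e.1 p) := by
      rw [map_mem_delaunayVertices (e.mem_preimage T), h1]; rfl
    rwa [h2] at h3
  subst hex
  have h1 := hS.eventually_dilate_mem_interior (hV.mem_vertices f hf) hx hp
  have h2 := hS.eventually_dilate_mem_interior (hV.mem_vertices f' hf') hx' hp'
  obtain ⟨τ, ⟨h3, h4⟩, hτ⟩ := ((h1.and h2).and (Ioc_mem_nhdsGT one_pos)).exists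
  rw [← map_dilate e.1 x p hτ.1.le hτ.2] at h4
  rw [← map_mem_interior_delaunayPolygon (e.mem_preimage T)] at h3
  have h5 : e.1 (σ f) = σ f' := by
    by_contra hne
    exact Set.disjoint_left.1 (hS.disjoint_interior hne) h3 (interior_subset h4)
  obtain ⟨h6, h7⟩ := hV.eq_of_deck hπ h5
  exact ⟨h6, (h7 x).symm, (h7 p).symm⟩

theorem IsTransversal.volume_inter_le (hV : IsTransversal π T C V σ) (hS : IsNet (π ⁻¹' T))
    (A : Set ℍ) : volume (polygonUnion (π ⁻¹' T) V σ ∩ A) ≤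
      volume (interiorUnion (π ⁻¹' T) V σ ∩ A) := by
  have h1 : polygonUnion (π ⁻¹' T) V σ ∩ A ⊆ interiorUnion (π ⁻¹' T) V σ ∩ A ∪
      ⋃ f ∈ V, delaunayPolygon (π ⁻¹' T) (σ f) \ interior (delaunayPolygon (π ⁻¹' T) (σ f)) := by
    rintro q ⟨hq, hqA⟩
    obtain ⟨f, hf, hqf⟩ := mem_polygonUnion.1 hq
    by_cases h : q ∈ interior (delaunayPolygon (π ⁻¹' T) (σ f))
    · exact Or.inl ⟨mem_interiorUnion.2 ⟨f, hf, h⟩, hqA⟩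
    · exact Or.inr (Set.mem_biUnion hf ⟨hqf, h⟩)
  have h2 : volume (⋃ f ∈ V, delaunayPolygon (π ⁻¹' T) (σ f) \
      interior (delaunayPolygon (π ⁻¹' T) (σ f))) = 0 :=
    (measure_biUnion_null_iff V.countable_toSet).2 fun f hf =>
      hS.volume_delaunayPolygon_diff_interior (hV.mem_vertices f hf)
  refine (measure_mono h1).trans ((measure_union_le _ _).trans_eq ?_)
  rw [h2, add_zero]

theorem IsTransversal.injOn_interiorUnion (hV : IsTransversal π T C V σ)
    (hπ : IsLocallyIsometricCovering π) (hS : IsNet (π ⁻¹' T)) :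
    Set.InjOn π (interiorUnion (π ⁻¹' T) V σ) := by
  intro p hp p' hp' h
  obtain ⟨f, hf, hpf⟩ := mem_interiorUnion.1 hp
  obtain ⟨f', hf', hpf'⟩ := mem_interiorUnion.1 hp'
  exact (hV.eq_of_mem_interior hπ hS hpf hpf' h).2

theorem IsTransversal.polygonUnion_subset (hV : IsTransversal π T C V σ)
    (hS : IsNet (π ⁻¹' T)) (hC : IsCellUnion (π ⁻¹' T) C) :
    polygonUnion (π ⁻¹' T) V σ ⊆ closure C :=
  Set.iUnion₂_subset fun f hf =>
    hC.delaunayPolygon_subset hS (hV.mem_vertices f hf) (hV.mem_closure f hf)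

theorem IsTransversal.volume_interiorUnion (hV : IsTransversal π T C V σ)
    (hπ : IsLocallyIsometricCovering π) (hS : IsNet (π ⁻¹' T)) :
    volume (interiorUnion (π ⁻¹' T) V σ) =
      ∑ f ∈ V, volume (delaunayPolygon (π ⁻¹' T) (σ f)) := by
  rw [interiorUnion, measure_biUnion_finset]
  · refine Finset.sum_congr rfl fun f hf => le_antisymm (measure_mono interior_subset) ?_
    rw [← Set.union_sdiff_cancel (interior_subset (s := delaunayPolygon (π ⁻¹' T) (σ f)))]
    refine (measure_union_le _ _).trans_eq ?_
    rw [Set.union_sdiff_cancel interior_subset,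
      hS.volume_delaunayPolygon_diff_interior (hV.mem_vertices f hf), add_zero]
  · intro f hf f' hf' hne
    rw [Function.onFun, Set.disjoint_left]
    exact fun p hp hp' => hne (hV.eq_of_mem_interior hπ hS hp hp' rfl).1
  · exact fun f _ => isOpen_interior.measurableSet

/-- A sector need not lie in its own polygon, so the two sides are not equal as sets. They are
compared through `π`: the left set projects into the image of the closed sectors, and the open
sectors project injectively into the image of the polygons within the disks. -/
theorem IsTransversal.volume_inter_diskUnion [CompactSpace F] (hV : IsTransversal π T C V σ)
    (hπ : IsLocallyIsometricCovering π) (hS : IsNet (π ⁻¹' T)) (hC : IsCellUnion (π ⁻¹' T) C)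
    (hR : R ≤ injRadius (π ⁻¹' T)) :
    volume (interiorUnion (π ⁻¹' T) V σ ∩ diskUnion (π ⁻¹' T) R) =
      ∑ f ∈ V, ∑ x ∈ (hS.finite_delaunayVertices (σ f)).toFinset,
        volume (sector R x (delaunayPolygon (π ⁻¹' T) (σ f))) := by
  set X : F → Finset ℍ := fun f => (hS.finite_delaunayVertices (σ f)).toFinset
  have hX : ∀ {f x}, x ∈ X f → x ∈ delaunayVertices (π ⁻¹' T) (σ f) :=
    fun {f x} hx => (Set.Finite.mem_toFinset _).1 hx
  set D : Set ℍ := ⋃ f ∈ V, ⋃ x ∈ X f, sector R x (delaunayPolygon (π ⁻¹' T) (σ f))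
  set D' : Set ℍ := ⋃ f ∈ V, ⋃ x ∈ X f, openSector (π ⁻¹' T) R (σ f) x
  have hW : MeasurableSet (diskUnion (π ⁻¹' T) R) := (isOpen_diskUnion R).measurableSet
  have hDm : MeasurableSet D := V.measurableSet_biUnion fun f hf =>
    (X f).measurableSet_biUnion fun x hx => hS.measurableSet_sector (hV.mem_vertices f hf) (hX hx) R
  have hDm' : ∀ f ∈ V, MeasurableSet (⋃ x ∈ X f, openSector (π ⁻¹' T) R (σ f) x) := fun f hf =>
    (X f).measurableSet_biUnion fun x hx =>
      hS.measurableSet_openSector (hV.mem_vertices f hf) (hX hx) R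
  apply le_antisymm
  · calc volume (interiorUnion (π ⁻¹' T) V σ ∩ diskUnion (π ⁻¹' T) R) ≤ volume D := by
          refine hπ.volume_le (measurableSet_interiorUnion.inter hW) hDm
            ((hV.injOn_interiorUnion hπ hS).mono Set.inter_subset_left) ?_
          rintro _ ⟨q, ⟨hq, hqW⟩, rfl⟩
          obtain ⟨e, f, hf, x, hx, h⟩ := hV.exists_deck_sector hπ hS hC hR
            (hV.polygonUnion_subset hS hC (interiorUnion_subset hq)) hqW
          exact ⟨e.1 q, Set.mem_biUnion hf (Set.mem_biUnion
            (show x ∈ X f from (Set.Finite.mem_toFinset _).2 hx) h), e.2 q⟩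
      _ ≤ ∑ f ∈ V, volume (⋃ x ∈ X f, sector R x (delaunayPolygon (π ⁻¹' T) (σ f))) :=
          measure_biUnion_finset_le _ _
      _ ≤ _ := Finset.sum_le_sum fun f _ => measure_biUnion_finset_le _ _
  · calc _ = ∑ f ∈ V, ∑ x ∈ X f, volume (openSector (π ⁻¹' T) R (σ f) x) :=
          Finset.sum_congr rfl fun f _ => Finset.sum_congr rfl fun x _ =>
            (hS.volume_openSector R (σ f) x).symm
      _ = volume D' := by
          rw [measure_biUnion_finset _ hDm']
          · refine Finset.sum_congr rfl fun f hf => (measure_biUnion_finset ?_ fun x hx =>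
              hS.measurableSet_openSector (hV.mem_vertices f hf) (hX hx) R).symm
            intro x hx x' hx' hne
            rw [Function.onFun, Set.disjoint_left]
            exact fun p hp hp' =>
              hne (hV.eq_of_mem_openSector hπ hS hR hf hf (hX hx) (hX hx') hp hp' rfl).2.1
          · intro f hf f' hf' hne
            rw [Function.onFun, Set.disjoint_left]
            intro p hp hp'
            simp only [Set.mem_iUnion, exists_prop] at hp hp'
            obtain ⟨x, hx, hp⟩ := hp
            obtain ⟨x', hx', hp'⟩ := hp'
            exact hne (hV.eq_of_mem_openSector hπ hS hR hf hf' (hX hx) (hX hx') hp hp' rfl).1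
      _ ≤ volume (polygonUnion (π ⁻¹' T) V σ ∩ diskUnion (π ⁻¹' T) R) := by
          refine hπ.volume_le (V.measurableSet_biUnion hDm')
            (hS.measurableSet_polygonUnion.inter hW) ?_ ?_
          · intro p hp p' hp' h
            simp only [D', Set.mem_iUnion, exists_prop] at hp hp'
            obtain ⟨f, hf, x, hx, hp⟩ := hp
            obtain ⟨f', hf', x', hx', hp'⟩ := hp'
            exact (hV.eq_of_mem_openSector hπ hS hR hf hf' (hX hx) (hX hx') hp hp' h).2.2
          · rintro _ ⟨p, hp, rfl⟩
            simp only [D', Set.mem_iUnion, exists_prop] at hp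
            obtain ⟨f, hf, x, hx, hp⟩ := hp
            have hxT := (hX hx).1
            have h1 := (Set.ext_iff.1 (hC.ball_inter_closure hS hR hxT) p).2
              (Set.mem_biUnion (⟨⟨hV.mem_closure f hf, hV.mem_vertices f hf⟩, hX hx⟩ : σ f ∈
                {v ∈ closure C ∩ voronoiVertices (π ⁻¹' T) | x ∈ delaunayVertices (π ⁻¹' T) v})
                hp.1)
            obtain ⟨e, f', hf', h2⟩ := hV.exists_deck_polygon hπ hS hC h1.2
            exact ⟨e.1 p, ⟨mem_polygonUnion.2 ⟨f', hf', h2⟩,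
              (e.mem_diskUnion_iff T).2 (mem_diskUnion.2 ⟨x, hxT, h1.1⟩)⟩, e.2 p⟩
      _ ≤ _ := hV.volume_inter_le hS _

/-- The chosen polygons minus the disks compete in the infimum, which bounds it above up to null
sets. Any other competitor covers the projection of the interiors, and
`IsLocallyIsometricCovering.volume_le` bounds it below. -/
theorem IsTransversal.surfaceArea_eq [CompactSpace F] (hV : IsTransversal π T C V σ)
    (hπ : IsLocallyIsometricCovering π) (hS : IsNet (π ⁻¹' T)) (hC : IsCellUnion (π ⁻¹' T) C)
    {Q : Set F} (hQ : π ⁻¹' Q = closure C) :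
    surfaceArea π (Q \ ⋃ x ∈ T, surfaceDisk π x R ∩ Q) =
      volume (interiorUnion (π ⁻¹' T) V σ \ diskUnion (π ⁻¹' T) R) := by
  have hA : Q \ ⋃ x ∈ T, surfaceDisk π x R ∩ Q = Q \ π '' diskUnion (π ⁻¹' T) R := by
    rw [← iUnion_surfaceDisk, ← Set.iUnion₂_inter, Set.sdiff_inter_self_eq_sdiff]
  have hW : MeasurableSet (diskUnion (π ⁻¹' T) R) := (isOpen_diskUnion R).measurableSet
  rw [hA, surfaceArea]
  apply le_antisymm
  · refine (iInf₂_le _ (hS.measurableSet_polygonUnion (V := V) (σ := σ).diff hW)).trans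
      ((iInf_le _ ?_).trans (hV.volume_inter_le hS _))
    rintro f ⟨hf, hfW⟩
    obtain ⟨q, rfl⟩ := hπ.surjective f
    have hq : q ∈ closure C := hQ ▸ hf
    obtain ⟨e, f', hf', h⟩ := hV.exists_deck_polygon hπ hS hC hq
    refine ⟨e.1 q, ⟨mem_polygonUnion.2 ⟨f', hf', h⟩, fun h' => hfW ?_⟩, e.2 q⟩
    exact ⟨_, h', e.2 q⟩
  · refine le_iInf₂ fun B hB => le_iInf fun hAB => ?_
    refine hπ.volume_le (measurableSet_interiorUnion.diff hW) hB
      ((hV.injOn_interiorUnion hπ hS).mono Set.sdiff_subset) ?_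
    rintro _ ⟨q, ⟨hq, hqW⟩, rfl⟩
    refine hAB ⟨?_, fun h => hqW (hπ.mem_diskUnion_iff.1 h)⟩
    have := hV.polygonUnion_subset hS hC (interiorUnion_subset hq)
    rwa [← hQ] at this

end Cell

/-- For each vertex, polygon area minus sector areas is `(n - 2) π - ∑ θ - (cosh R - 1) ∑ θ`, the
defect. The sum is first written additively in `ENNReal` and subtracted only after finiteness is
known. -/
theorem IsLocallyIsometricCovering.area_identity [CompactSpace F]
    (hπ : IsLocallyIsometricCovering π) {T : Set F} (hfin : T.Finite) (hne : T.Nonempty) {R : ℝ}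
    (hR0 : 0 ≤ R) (hR : R ≤ injRadius (π ⁻¹' T)) {Q : Set F}
    (hQ : Q ∈ twoCells (π '' centeredDualGraph (π ⁻¹' T))) {σ : F → ℍ} (hσ : ∀ v, π (σ v) = v) :
    (Q ∩ π '' voronoiVertices (π ⁻¹' T)).Finite ∧
      surfaceArea π (Q \ ⋃ x ∈ T, surfaceDisk π x R ∩ Q) ≠ ⊤ ∧
      (surfaceArea π (Q \ ⋃ x ∈ T, surfaceDisk π x R ∩ Q)).toReal =
        ∑ᶠ v ∈ Q ∩ π '' voronoiVertices (π ⁻¹' T),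
          radiusDefect R (delaunayVertices (π ⁻¹' T) (σ v)) := by
  obtain ⟨f₀, -, rfl⟩ := hQ
  set C₀ := connectedComponentIn (π '' centeredDualGraph (π ⁻¹' T))ᶜ f₀
  have hS := hπ.isNet hfin hne
  have hC : IsCellUnion (π ⁻¹' T) (π ⁻¹' C₀) := hπ.isCellUnion T f₀
  have hQ : π ⁻¹' closure C₀ = closure (π ⁻¹' C₀) :=
    hπ.isCoveringMap.isOpenMap.preimage_closure_eq_closure_preimage hπ.isCoveringMap.continuous _
  have hVfin : (closure C₀ ∩ π '' voronoiVertices (π ⁻¹' T)).Finite :=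
    (hπ.finite_voronoiVertices hS).subset Set.inter_subset_right
  have hV : IsTransversal π T (π ⁻¹' C₀) hVfin.toFinset σ := by
    refine ⟨hσ, fun f hf => ?_, fun f hf => ?_, fun w hw hwC => ?_⟩
    · obtain ⟨-, w, hw, rfl⟩ := hVfin.mem_toFinset.1 hf
      obtain ⟨e, he⟩ := hπ.exists_deck (hσ (π w)).symm
      rwa [← he, map_mem_voronoiVertices (e.mem_preimage T)]
    · rw [← hQ, Set.mem_preimage, hσ]
      exact (hVfin.mem_toFinset.1 hf).1
    · rw [← hQ] at hwC
      exact hVfin.mem_toFinset.2 ⟨hwC, w, hw, rfl⟩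
  set a : F → ℝ := fun f => (((delaunayVertices (π ⁻¹' T) (σ f)).ncard : ℝ) - 2) * Real.pi -
    ∑ x ∈ (hS.finite_delaunayVertices (σ f)).toFinset,
      interiorAngle (delaunayVertices (π ⁻¹' T) (σ f)) x with ha
  set b : F → ℝ := fun f => ∑ x ∈ (hS.finite_delaunayVertices (σ f)).toFinset,
    (Real.cosh R - 1) * interiorAngle (delaunayVertices (π ⁻¹' T) (σ f)) x with hb
  have hR1 : 0 ≤ Real.cosh R - 1 := sub_nonneg.2 (Real.one_le_cosh R)
  have hang : ∀ f ∈ hVfin.toFinset, ∀ x ∈ (hS.finite_delaunayVertices (σ f)).toFinset,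
      0 ≤ (Real.cosh R - 1) * interiorAngle (delaunayVertices (π ⁻¹' T) (σ f)) x :=
    fun f hf x hx => mul_nonneg hR1 (hS.volume_sector (hV.mem_vertices f hf)
      ((Set.Finite.mem_toFinset _).1 hx) hR0).1
  have ha0 : ∀ f ∈ hVfin.toFinset, 0 ≤ a f := fun f hf =>
    (hS.volume_delaunayPolygon (hV.mem_vertices f hf)).1
  have hb0 : ∀ f ∈ hVfin.toFinset, 0 ≤ b f := fun f hf => Finset.sum_nonneg (hang f hf)
  have h1 : volume (interiorUnion (π ⁻¹' T) hVfin.toFinset σ) =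
      ENNReal.ofReal (∑ f ∈ hVfin.toFinset, a f) := by
    rw [hV.volume_interiorUnion hπ hS, ENNReal.ofReal_sum_of_nonneg ha0]
    exact Finset.sum_congr rfl fun f hf => (hS.volume_delaunayPolygon (hV.mem_vertices f hf)).2
  have h2 : volume (interiorUnion (π ⁻¹' T) hVfin.toFinset σ ∩ diskUnion (π ⁻¹' T) R) =
      ENNReal.ofReal (∑ f ∈ hVfin.toFinset, b f) := by
    rw [hV.volume_inter_diskUnion hπ hS hC hR, ENNReal.ofReal_sum_of_nonneg hb0]
    refine Finset.sum_congr rfl fun f hf => ?_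
    rw [hb, ENNReal.ofReal_sum_of_nonneg (hang f hf)]
    exact Finset.sum_congr rfl fun x hx => (hS.volume_sector (hV.mem_vertices f hf)
      ((Set.Finite.mem_toFinset _).1 hx) hR0).2
  -- The disks split the area of the chosen interiors into the sector total and the surface area in
  -- question.
  have h3 := measure_inter_add_sdiff (μ := volume) (interiorUnion (π ⁻¹' T) hVfin.toFinset σ)
    (isOpen_diskUnion (S := π ⁻¹' T) R).measurableSet
  rw [← hV.surfaceArea_eq hπ hS hC hQ, h1, h2] at h3
  have h4 : surfaceArea π (closure C₀ \ ⋃ x ∈ T, surfaceDisk π x R ∩ closure C₀) ≠ ⊤ := fun h => by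
    rw [h, add_top] at h3
    exact ENNReal.ofReal_ne_top h3.symm
  refine ⟨hVfin, h4, ?_⟩
  have h5 := congrArg ENNReal.toReal h3
  rw [ENNReal.toReal_add ENNReal.ofReal_ne_top h4, ENNReal.toReal_ofReal (Finset.sum_nonneg ha0),
    ENNReal.toReal_ofReal (Finset.sum_nonneg hb0)] at h5
  rw [finsum_mem_eq_finite_toFinset_sum _ hVfin, eq_sub_of_add_eq' h5, ← Finset.sum_sub_distrib]
  refine Finset.sum_congr rfl fun f _ => ?_
  rw [radiusDefect, finsum_mem_eq_finite_toFinset_sum _ (hS.finite_delaunayVertices (σ f)), ha, hb]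
  simp only
  rw [← Finset.mul_sum]
  ring

end

end CenteredDual

end

theorem mainTheorem3 {F : Type*} [MetricSpace F] [CompactSpace F]
    (π : ℍ → F) (hπ : CenteredDual.IsLocallyIsometricCovering π)
    (S : Set F) (hfin : S.Finite) (hne : S.Nonempty)
    (R : ℝ) (hR0 : 0 ≤ R) (hR : R ≤ CenteredDual.injRadius (π ⁻¹' S)) :
    -- the area identity, where `σ` picks for each point of `F` an arbitrary lift to `ℍ`
    (∀ Q ∈ CenteredDual.twoCells (π '' CenteredDual.centeredDualGraph (π ⁻¹' S)),
      ∀ σ : F → ℍ, (∀ v, π (σ v) = v) →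
        (Q ∩ π '' CenteredDual.voronoiVertices (π ⁻¹' S)).Finite ∧
        CenteredDual.surfaceArea π (Q \ ⋃ x ∈ S, CenteredDual.surfaceDisk π x R ∩ Q) ≠ ⊤ ∧
        (CenteredDual.surfaceArea π (Q \ ⋃ x ∈ S, CenteredDual.surfaceDisk π x R ∩ Q)).toReal =
          ∑ᶠ v ∈ Q ∩ π '' CenteredDual.voronoiVertices (π ⁻¹' S),
            CenteredDual.radiusDefect R (CenteredDual.delaunayVertices (π ⁻¹' S) (σ v))) ∧
    -- each lifted disk meets each lifted cell in the full sectors determined by its Delaunay polygons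
    (∀ Q ∈ CenteredDual.twoCells (CenteredDual.centeredDualGraph (π ⁻¹' S)), ∀ x ∈ π ⁻¹' S,
      Metric.ball x R ∩ Q =
        ⋃ v ∈ {v ∈ Q ∩ CenteredDual.voronoiVertices (π ⁻¹' S) |
            x ∈ CenteredDual.delaunayVertices (π ⁻¹' S) v},
          CenteredDual.sector R x (CenteredDual.delaunayPolygon (π ⁻¹' S) v)) := by
  have hS := hπ.isNet hfin hne
  refine ⟨fun Q hQ σ hσ => hπ.area_identity hfin hne hR0 hR hQ hσ, ?_⟩
  rintro _ ⟨p, -, rfl⟩ x hx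
  exact (CenteredDual.isCellUnion_connectedComponentIn _ p).ball_inter_closure hS hR hx
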